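/- Let $n\ge 1$, let $\Omega\subset\mathbb R^n$ be a uniformly convex domain (bounded, open, convex, with smooth boundary all of whose principal curvatures are bounded below by a positive constant), let $T>0$, $Q_T=\Omega\times(0,T]$, and let $\partial_pQ_T=(\overline\Omega\times\{0\})\cup(\partial\Omega\times[0,T])$ be its parabolic boundary. For a function $w$ on $\overline Q_T=\overline\Omega\times[0,T]$ write $w\in\tilde C^4(\overline Q_T)$ if all derivatives $D_x^\gamma D_t^s w$ with $|\gamma|+2s\le 4$ exist and are continuous on $\overline Q_T$, and put $$\|w\|_{\tilde C^4(\overline Q_T)}=\sup_{|\gamma|+2s\le 4}\ \sup_{(x,t)\in Q_T}|D_x^\gamma D_t^s w(x,t)| .$$ For all constants $c_0>0$, $\theta>0$ and $M_1,M_2,M_3,M_4\ge 0$ there is a constant $C>0$, depending only on $n,T,\Omega,c_0,\theta,M_1,M_2,M_3,M_4$, such that the following holds. Let $\phi,\psi$ be smooth functions on $\overline Q_T$ with * $\phi_t+\psi\ge c_0$ on $\partial\Omega\times[0,T]$; * $D^2\phi(x,0)\ge\theta I$ for all $x\in\overline\Omega$ (uniform convexity of $\phi(\cdot,0)$); * $\psi(\cdot,t)$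 concave on $\overline\Omega$ for every $t\in[0,T]$; * $\|\phi\|_{\tilde C^4(\overline Q_T)}\le M_1$, $\|\psi\|_{L^\infty(Q_T)}\le M_2$, $\|D\psi\|_{L^\infty(Q_T)}\le M_3$ and $\|\psi_t\|_{L^{n+1}(Q_T)}\le M_4$, where $D$ is the gradient in $x$. Let $u\in\tilde C^4(\overline Q_T)$ be convex in $x$ and satisfy $$-u_t+\det D^2u=\psi(x,t)\ \text{ in } Q_T,\qquad u=\phi\ \text{ on }\partial_pQ_T,$$ where $D^2u$ is the Hessian in $x$. Then at every point of $\partial_pQ_T$ all eigenvalues of $D^2u$ lie in $[1/C,\,C]$. -/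

import Mathlib

open Set MeasureTheory
open scoped ENNReal NNReal

namespace ParabolicMA

/-- A uniformly convex domain `Ω ⊂ ℝⁿ` with smooth boundary: a nonempty bounded convex open set
`Ω = {ρ < 0}`, with `ρ` smooth and `Dρ ≠ 0` on `∂Ω = {ρ = 0}`, whose second fundamental form
`τ ↦ D²ρ(τ, τ) / |Dρ|` (on tangent vectors `τ`, for the inner normal) is bounded below by a
positive constant, i.e. all principal curvatures of `∂Ω` are at least some `κ > 0`. -/
structure IsUniformlyConvexDomain {n : ℕ} (Ω : Set (EuclideanSpace ℝ (Fin n))) : Prop where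
  nonempty : Ω.Nonempty
  bounded : Bornology.IsBounded Ω
  convex : Convex ℝ Ω
  smooth_uniformlyConvex_boundary :
    ∃ ρ : EuclideanSpace ℝ (Fin n) → ℝ, ContDiff ℝ ((⊤ : ℕ∞) : WithTop ℕ∞) ρ ∧
      Ω = {x | ρ x < 0} ∧
      (∀ x, ρ x = 0 → fderiv ℝ ρ x ≠ 0) ∧
      ∃ κ : ℝ, 0 < κ ∧ ∀ x, ρ x = 0 → ∀ τ, fderiv ℝ ρ x τ = 0 →
        κ * ‖fderiv ℝ ρ x‖ * ‖τ‖ ^ 2 ≤ iteratedFDeriv ℝ 2 ρ x ![τ, τ]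

/-- The parabolic cylinder `Q_T = Ω × (0, T]`. -/
def parabolicCylinder {n : ℕ} (Ω : Set (EuclideanSpace ℝ (Fin n))) (T : ℝ) :
    Set (EuclideanSpace ℝ (Fin n) × ℝ) :=
  Ω ×ˢ Ioc 0 T

/-- The closed cylinder `closure Ω × [0, T]`. -/
def closedCylinder {n : ℕ} (Ω : Set (EuclideanSpace ℝ (Fin n))) (T : ℝ) :
    Set (EuclideanSpace ℝ (Fin n) × ℝ) :=
  closure Ω ×ˢ Icc 0 T

/-- The parabolic boundary `(closure Ω × {0}) ∪ (∂Ω × [0, T])`. -/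
def parabolicBoundary {n : ℕ} (Ω : Set (EuclideanSpace ℝ (Fin n))) (T : ℝ) :
    Set (EuclideanSpace ℝ (Fin n) × ℝ) :=
  closure Ω ×ˢ {0} ∪ frontier Ω ×ˢ Icc 0 T

/-- Smoothness up to the boundary of the cylinder, jointly in `(x, t)`. -/
def SmoothOnClosedCylinder {n : ℕ} (Ω : Set (EuclideanSpace ℝ (Fin n))) (T : ℝ)
    (w : EuclideanSpace ℝ (Fin n) → ℝ → ℝ) : Prop :=
  ContDiffOn ℝ ((⊤ : ℕ∞) : WithTop ℕ∞) (Function.uncurry w) (closedCylinder Ω T)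

/-- The time derivative `w_t` on the closed cylinder (one-sided at `t = 0` and `t = T`). -/
noncomputable def timeDeriv {n : ℕ} (T : ℝ) (w : EuclideanSpace ℝ (Fin n) → ℝ → ℝ)
    (x : EuclideanSpace ℝ (Fin n)) (t : ℝ) : ℝ :=
  derivWithin (w x) (Icc 0 T) t

/-- The spatial derivative `D w` on the closed cylinder (up to `∂Ω`). -/
noncomputable def spaceDeriv {n : ℕ} (Ω : Set (EuclideanSpace ℝ (Fin n)))
    (w : EuclideanSpace ℝ (Fin n) → ℝ → ℝ) (x : EuclideanSpace ℝ (Fin n)) (t : ℝ) :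
    EuclideanSpace ℝ (Fin n) →L[ℝ] ℝ :=
  fderivWithin ℝ (fun y => w y t) (closure Ω) x

/-- The spatial Hessian matrix `D²w` on the closed cylinder (up to `∂Ω`). -/
noncomputable def hessian {n : ℕ} (Ω : Set (EuclideanSpace ℝ (Fin n)))
    (w : EuclideanSpace ℝ (Fin n) → ℝ → ℝ) (x : EuclideanSpace ℝ (Fin n)) (t : ℝ) :
    Matrix (Fin n) (Fin n) ℝ :=
  Matrix.of fun i j => iteratedFDerivWithin ℝ 2 (fun y => w y t) (closure Ω) x
    ![EuclideanSpace.single i 1, EuclideanSpace.single j 1]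

/-- The parabolic derivative `D_x^j D_t^s w` on the closed cylinder. -/
noncomputable def parabolicDeriv {n : ℕ} (Ω : Set (EuclideanSpace ℝ (Fin n))) (T : ℝ)
    (j s : ℕ) (w : EuclideanSpace ℝ (Fin n) → ℝ → ℝ) (x : EuclideanSpace ℝ (Fin n)) (t : ℝ) :
    ContinuousMultilinearMap ℝ (fun _ : Fin j => EuclideanSpace ℝ (Fin n)) ℝ :=
  iteratedFDerivWithin ℝ j (fun y => iteratedDerivWithin s (w y) (Icc 0 T) t) (closure Ω) x

/-- The parabolic space `C̃^k` of the closed cylinder: all derivatives `D_x^j D_t^s w` with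
`j + 2 s ≤ k` exist and are jointly continuous on `closure Ω × [0, T]`. -/
structure MemParabolicC {n : ℕ} (k : ℕ) (Ω : Set (EuclideanSpace ℝ (Fin n))) (T : ℝ)
    (w : EuclideanSpace ℝ (Fin n) → ℝ → ℝ) : Prop where
  contDiffOn_time : ∀ s : ℕ, 2 * s ≤ k → ∀ x ∈ closure Ω, ContDiffOn ℝ s (w x) (Icc 0 T)
  contDiffOn_space : ∀ j s : ℕ, j + 2 * s ≤ k → ∀ t ∈ Icc 0 T,
    ContDiffOn ℝ j (fun y => iteratedDerivWithin s (w y) (Icc 0 T) t) (closure Ω)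
  continuousOn : ∀ j s : ℕ, j + 2 * s ≤ k →
    ContinuousOn (fun p : EuclideanSpace ℝ (Fin n) × ℝ => parabolicDeriv Ω T j s w p.1 p.2)
      (closedCylinder Ω T)

/-- The `C̃^k` norm: the supremum over `Q_T` of all partial derivatives `|D_x^γ D_t^s w|` with
`|γ| + 2 s ≤ k`; the multi-index `γ` of order `j` is listed as coordinate directions
`v 0, …, v (j - 1)`. -/
noncomputable def parabolicNorm {n : ℕ} (k : ℕ) (Ω : Set (EuclideanSpace ℝ (Fin n))) (T : ℝ)
    (w : EuclideanSpace ℝ (Fin n) → ℝ → ℝ) : ℝ≥0∞ :=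
  ⨆ (j : ℕ) (s : ℕ) (_ : j + 2 * s ≤ k) (p ∈ parabolicCylinder Ω T) (v : Fin j → Fin n),
    ‖parabolicDeriv Ω T j s w p.1 p.2 (fun i => EuclideanSpace.single (v i) 1)‖ₑ

/-- `w(·, 0)` is uniformly convex on `closure Ω` with constant `θ`: `D²w(x, 0) ≥ θ I`. -/
def InitiallyUniformlyConvex {n : ℕ} (Ω : Set (EuclideanSpace ℝ (Fin n))) (θ : ℝ)
    (w : EuclideanSpace ℝ (Fin n) → ℝ → ℝ) : Prop :=
  ∀ x ∈ closure Ω, ∀ v : EuclideanSpace ℝ (Fin n),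
    θ * ‖v‖ ^ 2 ≤ iteratedFDerivWithin ℝ 2 (fun y => w y 0) (closure Ω) x ![v, v]

/-- `u` solves `-u_t + det D²u = ψ` in `Q_T` with `u = φ` on the parabolic boundary. -/
structure IsSolution {n : ℕ} (Ω : Set (EuclideanSpace ℝ (Fin n))) (T : ℝ)
    (φ ψ u : EuclideanSpace ℝ (Fin n) → ℝ → ℝ) : Prop where
  equation : ∀ x ∈ Ω, ∀ t ∈ Ioc 0 T, -timeDeriv T u x t + (hessian Ω u x t).det = ψ x t
  boundary : ∀ p ∈ parabolicBoundary Ω T, u p.1 p.2 = φ p.1 p.2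

end ParabolicMA

open ParabolicMA

/-!
Boundary estimates for the second derivatives of solutions of the parabolic Monge-Ampère equation
`-u_t + det D²u = ψ`, by barriers and the maximum principle. The eigenvalues of `D²u` at a point
of the parabolic boundary are controlled once `det D²u` is bounded above and below and the
tangential and mixed second derivatives are bounded, with the tangential ones bounded away from
zero.

* Since `ψ` is concave in `x`, the function `det D²u = u_t + ψ` is a supersolution of the
  linearized equation. Its minimum over the cylinder is therefore attained on the parabolic
  boundary, where it is at least `c₁ = min c₀ θⁿ` (`SolutionData.le_det`). This is the only place
  where the compatibility condition `φ_t + ψ ≥ c₀` and the concavity enter.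
* A paraboloid below and convexity above bound the normal derivative of `u - φ` on `∂Ω`
  (`DefiningFunction.exists_normal_deriv_le`); the tangential derivatives vanish there.
* At a boundary point `x₀` with inner normal `N` and a tangential unit vector `e`, an affine
  function `φ(x₀) + Dφ X + μ ⟨X, N⟩`, `X = x - x₀`, can be chosen so that along `∂Ω` it differs
  from `φ` only by `⟨X, e⟩ ⟨a, z⟩ + O(|z|²)`, where `z` is the part of `X` orthogonal to `e`. The
  coefficient `μ` cancels the term in `⟨X, e⟩²`; since `∂Ω` is a level set, the same relation
  turns the term in `⟨X, e⟩³` into one of this form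
  (`DefiningFunction.exists_boundary_expansion`). This remainder lies below a quadratic whose
  Hessian is degenerate in one direction. As `det D²u ≥ c₁`, comparison on a single time slice
  shows that the normal derivative of `u` lies below that of the affine function by a fixed `ε`
  (`DefiningFunction.exists_normal_deriv_gap`). Expanding `u = φ` along `∂Ω`, this gap is, up to
  the curvature of `∂Ω`, the second derivative `D²u(e, e)`, which gives its bounds from both sides
  (`DefiningFunction.exists_tangential_bounds`).
* For a tangential unit vector `τ` at `x₀` there is a field `V = τ + S (x - x₀)` with `S` skew
  that is tangential to `∂Ω` up to second order (`DefiningFunction.exists_rotation`). Because `S`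
  is skew, the linearized operator sends `D_V u` to `D_V ψ`, so that `D_V (u - φ)` admits a
  barrier of the form `(A + B) R ⟨X, N⟩ - A |X|²`, where uniform convexity supplies
  `|X|² ≤ R ⟨X, N⟩` on `Ω`. This bounds `D²u(τ, N)` (`DefiningFunction.exists_mixed_bound`).
* Finally `det D²u = φ_t + ψ` is bounded on `∂Ω`, which bounds `D²u(N, N)` and hence all
  eigenvalues from above (`form_le_of_hyperplane`); the lower bound of the determinant bounds them
  from below. At `t = 0` the Hessian is that of `φ`.
-/

namespace ParabolicMA

-- needed for the norms of iterated spaces of continuous linear maps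
set_option maxSynthPendingDepth 3

/-! ### Determinants and eigenvalues of symmetric bilinear forms -/

section LinearAlgebra

variable {n : ℕ}

/-- The matrix of a bilinear form on `ℝⁿ` in the standard basis. -/
noncomputable def formMatrix
    (B : EuclideanSpace ℝ (Fin n) →L[ℝ] EuclideanSpace ℝ (Fin n) →L[ℝ] ℝ) :
    Matrix (Fin n) (Fin n) ℝ :=
  Matrix.of fun i j => B (EuclideanSpace.single i 1) (EuclideanSpace.single j 1)

lemma sum_smul_single (v : EuclideanSpace ℝ (Fin n)) :
    v = ∑ i, v i • EuclideanSpace.single i (1 : ℝ) := by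
  ext j
  simp [Pi.single_apply]

lemma form_apply_eq_sum (B : EuclideanSpace ℝ (Fin n) →L[ℝ] EuclideanSpace ℝ (Fin n) →L[ℝ] ℝ)
    (v w : EuclideanSpace ℝ (Fin n)) :
    B v w = ∑ i, v i * ∑ j, formMatrix B i j * w j := by
  conv_lhs => rw [sum_smul_single v, sum_smul_single w]
  simp only [map_sum, map_smul, sum_apply, smul_apply,
    smul_eq_mul, formMatrix, Matrix.of_apply]
  simp only [Finset.mul_sum]
  rw [Finset.sum_comm]
  refine Finset.sum_congr rfl fun i _ => Finset.sum_congr rfl fun j _ => by ring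

lemma isHermitian_formMatrix
    {B : EuclideanSpace ℝ (Fin n) →L[ℝ] EuclideanSpace ℝ (Fin n) →L[ℝ] ℝ}
    (hB : ∀ v w, B v w = B w v) : (formMatrix B).IsHermitian := by
  ext i j
  simp [formMatrix, hB]

/-- The orthonormal eigenbasis of the matrix diagonalizes the form. -/
lemma form_eigenvectorBasis
    {B : EuclideanSpace ℝ (Fin n) →L[ℝ] EuclideanSpace ℝ (Fin n) →L[ℝ] ℝ}
    (hH : (formMatrix B).IsHermitian) (v : EuclideanSpace ℝ (Fin n)) (i : Fin n) :
    B v (hH.eigenvectorBasis i) = hH.eigenvalues i * inner ℝ v (hH.eigenvectorBasis i) := by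
  rw [form_apply_eq_sum]
  have h := hH.mulVec_eigenvectorBasis i
  have h' : ∀ k, ∑ j, formMatrix B k j * (hH.eigenvectorBasis i) j
      = hH.eigenvalues i * (hH.eigenvectorBasis i) k := fun k => by
    have := congrFun h k
    simpa [Matrix.mulVec, dotProduct] using this
  simp only [h', PiLp.inner_apply, Finset.mul_sum]
  refine Finset.sum_congr rfl fun k _ => ?_
  simp
  ring

lemma form_eq_sum_eigenvalues
    {B : EuclideanSpace ℝ (Fin n) →L[ℝ] EuclideanSpace ℝ (Fin n) →L[ℝ] ℝ}
    (hH : (formMatrix B).IsHermitian) (v w : EuclideanSpace ℝ (Fin n)) :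
    B v w = ∑ i, hH.eigenvalues i *
      (inner ℝ v (hH.eigenvectorBasis i) * inner ℝ w (hH.eigenvectorBasis i)) := by
  conv_lhs => rw [← hH.eigenvectorBasis.sum_repr' w]
  simp only [map_sum, map_smul, smul_eq_mul, form_eigenvectorBasis]
  refine Finset.sum_congr rfl fun i _ => ?_
  rw [real_inner_comm w]
  ring

lemma norm_sq_eq_sum_inner (b : OrthonormalBasis (Fin n) ℝ (EuclideanSpace ℝ (Fin n)))
    (v : EuclideanSpace ℝ (Fin n)) : ‖v‖ ^ 2 = ∑ i, inner ℝ v (b i) ^ 2 := by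
  rw [← b.sum_sq_norm_inner_right v]
  refine Finset.sum_congr rfl fun i _ => ?_
  rw [real_inner_comm]
  simp

lemma eigenvalue_eq_form
    {B : EuclideanSpace ℝ (Fin n) →L[ℝ] EuclideanSpace ℝ (Fin n) →L[ℝ] ℝ}
    (hH : (formMatrix B).IsHermitian) (i : Fin n) :
    hH.eigenvalues i = B (hH.eigenvectorBasis i) (hH.eigenvectorBasis i) := by
  rw [form_eigenvectorBasis, real_inner_self_eq_norm_sq]
  simp

lemma le_eigenvalue {B : EuclideanSpace ℝ (Fin n) →L[ℝ] EuclideanSpace ℝ (Fin n) →L[ℝ] ℝ}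
    (hH : (formMatrix B).IsHermitian) {a : ℝ} (h : ∀ v, a * ‖v‖ ^ 2 ≤ B v v) (i : Fin n) :
    a ≤ hH.eigenvalues i := by
  rw [eigenvalue_eq_form]
  simpa using h (hH.eigenvectorBasis i)

lemma eigenvalue_le {B : EuclideanSpace ℝ (Fin n) →L[ℝ] EuclideanSpace ℝ (Fin n) →L[ℝ] ℝ}
    (hH : (formMatrix B).IsHermitian) {a : ℝ} (h : ∀ v, B v v ≤ a * ‖v‖ ^ 2) (i : Fin n) :
    hH.eigenvalues i ≤ a := by
  rw [eigenvalue_eq_form]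
  simpa using h (hH.eigenvectorBasis i)

lemma det_formMatrix_eq_prod
    {B : EuclideanSpace ℝ (Fin n) →L[ℝ] EuclideanSpace ℝ (Fin n) →L[ℝ] ℝ}
    (hH : (formMatrix B).IsHermitian) : (formMatrix B).det = ∏ i, hH.eigenvalues i := by
  simpa using hH.det_eq_prod_eigenvalues

lemma pow_le_det {B : EuclideanSpace ℝ (Fin n) →L[ℝ] EuclideanSpace ℝ (Fin n) →L[ℝ] ℝ}
    (hB : ∀ v w, B v w = B w v) {a : ℝ} (ha : 0 ≤ a) (h : ∀ v, a * ‖v‖ ^ 2 ≤ B v v) :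
    a ^ n ≤ (formMatrix B).det := by
  have hH := isHermitian_formMatrix hB
  rw [det_formMatrix_eq_prod hH]
  calc a ^ n = ∏ _i : Fin n, a := by simp
    _ ≤ _ := Finset.prod_le_prod (fun _ _ => ha) fun i _ => le_eigenvalue hH h i

/-- Separating one eigenvalue from the product of the others. -/
lemma prod_le_mul_pow {l : Fin n → ℝ} (hl : ∀ i, 0 ≤ l i) {L : ℝ}
    (hL : ∀ i, l i ≤ L) (i : Fin n) : ∏ j, l j ≤ l i * L ^ (n - 1) := by
  rw [← Finset.mul_prod_erase Finset.univ l (Finset.mem_univ i)]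
  refine mul_le_mul_of_nonneg_left ?_ (hl i)
  calc ∏ j ∈ Finset.univ.erase i, l j ≤ ∏ _j ∈ Finset.univ.erase i, L :=
        Finset.prod_le_prod (fun j _ => hl j) fun j _ => hL j
    _ = L ^ (n - 1) := by simp [Finset.card_erase_of_mem]

lemma mul_pow_le_prod {l : Fin n → ℝ} {a : ℝ} (ha : 0 ≤ a)
    (hl : ∀ i, a ≤ l i) (i : Fin n) : l i * a ^ (n - 1) ≤ ∏ j, l j := by
  rw [← Finset.mul_prod_erase Finset.univ l (Finset.mem_univ i)]
  refine mul_le_mul_of_nonneg_left ?_ (ha.trans (hl i))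
  calc a ^ (n - 1) = ∏ _j ∈ Finset.univ.erase i, a := by simp [Finset.card_erase_of_mem]
    _ ≤ ∏ j ∈ Finset.univ.erase i, l j := Finset.prod_le_prod (fun j _ => ha) fun j _ => hl j

/-- A nonnegative form that is almost degenerate in one direction has small determinant. -/
lemma det_le_of_degenerate (hn : 1 ≤ n)
    {B : EuclideanSpace ℝ (Fin n) →L[ℝ] EuclideanSpace ℝ (Fin n) →L[ℝ] ℝ}
    (hB : ∀ v w, B v w = B w v) (hpos : ∀ v, 0 ≤ B v v) {L δ : ℝ}
    (hL : ∀ v, B v v ≤ L * ‖v‖ ^ 2) {k : EuclideanSpace ℝ (Fin n)} (hk : k ≠ 0)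
    (hδ : B k k ≤ δ * ‖k‖ ^ 2) : (formMatrix B).det ≤ δ * L ^ (n - 1) := by
  have hH := isHermitian_formMatrix hB
  have h0 : ∀ i, 0 ≤ hH.eigenvalues i := le_eigenvalue hH (by simpa using hpos)
  have hL' : ∀ i, hH.eigenvalues i ≤ L := eigenvalue_le hH hL
  have hLnn : 0 ≤ L := (h0 ⟨0, hn⟩).trans (hL' _)
  obtain ⟨i, hi⟩ : ∃ i, hH.eigenvalues i ≤ δ := by
    by_contra! hcon
    have hks : ‖k‖ ^ 2 = ∑ i, inner ℝ k (hH.eigenvectorBasis i) ^ 2 := norm_sq_eq_sum_inner _ k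
    have hpos' : 0 < ‖k‖ ^ 2 := by positivity
    obtain ⟨i, -, hi⟩ : ∃ i ∈ Finset.univ, 0 < inner ℝ k (hH.eigenvectorBasis i) ^ 2 :=
      Finset.exists_lt_of_sum_lt (by simpa [← hks] using hpos')
    have : δ * ‖k‖ ^ 2 < B k k := by
      rw [form_eq_sum_eigenvalues hH k k, hks, Finset.mul_sum]
      refine Finset.sum_lt_sum (fun j _ => ?_) ⟨i, Finset.mem_univ _, ?_⟩
      · rw [← sq]; exact mul_le_mul_of_nonneg_right (hcon j).le (sq_nonneg _)
      · rw [← sq]; exact mul_lt_mul_of_pos_right (hcon i) hi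
    linarith
  rw [det_formMatrix_eq_prod hH]
  exact (prod_le_mul_pow h0 hL' i).trans (mul_le_mul_of_nonneg_right hi (by positivity))

/-- The `i`-th diagonal cofactor of `diag l`. -/
def diagCofactor (l : Fin n → ℝ) (i : Fin n) : ℝ := ∏ j ∈ Finset.univ.erase i, l j

lemma diagCofactor_nonneg {l : Fin n → ℝ} (hl : ∀ i, 0 ≤ l i) (i : Fin n) :
    0 ≤ diagCofactor l i :=
  Finset.prod_nonneg fun j _ => hl j

lemma diagCofactor_mul (l : Fin n → ℝ) (i : Fin n) : diagCofactor l i * l i = ∏ j, l j :=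
  Finset.prod_erase_mul Finset.univ l (Finset.mem_univ i)

/-- The cofactor of the least entry is at least `1` if that entry exceeds `1`, and at least the
determinant otherwise. -/
lemma min_one_le_sum_diagCofactor (hn : 1 ≤ n) {l : Fin n → ℝ} (hl : ∀ i, 0 ≤ l i) {c : ℝ}
    (h : c ≤ ∏ j, l j) : min 1 c ≤ ∑ i, diagCofactor l i := by
  have : Nonempty (Fin n) := ⟨⟨0, hn⟩⟩
  obtain ⟨i, hi⟩ := Finite.exists_min l
  refine le_trans ?_ (Finset.single_le_sum (fun j _ => diagCofactor_nonneg hl j)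
    (Finset.mem_univ i))
  rcases le_or_gt (l i) 1 with h1 | h1
  · refine (min_le_right _ _).trans (h.trans ?_)
    rw [← diagCofactor_mul l i]
    exact mul_le_of_le_one_right (diagCofactor_nonneg hl i) h1
  · refine (min_le_left _ _).trans ?_
    calc (1 : ℝ) = ∏ _j ∈ Finset.univ.erase i, (1 : ℝ) := by simp
      _ ≤ _ := Finset.prod_le_prod (fun _ _ => zero_le_one) fun j _ => h1.le.trans (hi j)

/-- Jacobi's formula at a diagonal matrix. -/
lemma hasDerivWithinAt_det_of_diagonal {A : ℝ → Matrix (Fin n) (Fin n) ℝ}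
    {A' : Matrix (Fin n) (Fin n) ℝ} {S : Set ℝ} {s : ℝ} {l : Fin n → ℝ}
    (hA : ∀ i j, HasDerivWithinAt (fun r => A r i j) (A' i j) S s)
    (hl : A s = Matrix.diagonal l) :
    HasDerivWithinAt (fun r => (A r).det) (∑ i, diagCofactor l i * A' i i) S s := by
  have hprod : ∀ σ : Equiv.Perm (Fin n), HasDerivWithinAt (fun r => ∏ i, A r (σ i) i)
      (∑ i, (∏ j ∈ Finset.univ.erase i, A s (σ j) j) • A' (σ i) i) S s := fun σ =>
    HasDerivWithinAt.fun_finsetProd fun i _ => hA (σ i) i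
  have hsum : HasDerivWithinAt (fun r => ∑ σ : Equiv.Perm (Fin n),
      Equiv.Perm.sign σ • ∏ i, A r (σ i) i)
      (∑ σ : Equiv.Perm (Fin n), Equiv.Perm.sign σ •
        ∑ i, (∏ j ∈ Finset.univ.erase i, A s (σ j) j) • A' (σ i) i) S s :=
    HasDerivWithinAt.fun_sum fun σ _ => by
      simpa only [Units.smul_def, zsmul_eq_mul, smul_eq_mul] using (hprod σ).const_mul
        (((Equiv.Perm.sign σ : ℤˣ) : ℤ) : ℝ)
  simp only [Matrix.det_apply]
  convert hsum using 1
  symm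
  rw [Finset.sum_eq_single 1]
  · simp [hl, diagCofactor]
  · intro σ _ hσ
    rw [Finset.sum_eq_zero, smul_zero]
    intro i _
    -- a nontrivial permutation moves at least two points, hence one different from `i`
    obtain ⟨j, hji, hj⟩ : ∃ j, j ≠ i ∧ σ j ≠ j := by
      by_contra! hcon
      apply hσ
      have hi : σ i = i := by
        by_contra hne
        exact hne (σ.injective (hcon (σ i) hne))
      ext j
      by_cases hji : j = i
      · simp [hji, hi]
      · simp [hcon j hji]
    rw [Finset.prod_eq_zero (Finset.mem_erase.2 ⟨hji, Finset.mem_univ j⟩), zero_smul]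
    rw [hl, Matrix.diagonal_apply_ne _ hj]
  · simp

/-- The determinant of a form may be computed in any orthonormal basis. -/
lemma det_formMatrix_eq_of_basis
    (B : EuclideanSpace ℝ (Fin n) →L[ℝ] EuclideanSpace ℝ (Fin n) →L[ℝ] ℝ)
    (b : OrthonormalBasis (Fin n) ℝ (EuclideanSpace ℝ (Fin n))) :
    (formMatrix B).det = (Matrix.of fun i j => B (b i) (b j)).det := by
  set Q : Matrix (Fin n) (Fin n) ℝ := Matrix.of fun k i => b i k with hQ
  have hQQ : Q.transpose * Q = 1 := by
    ext i j
    have := b.inner_eq_ite i j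
    rw [PiLp.inner_apply] at this
    simp only [Matrix.mul_apply, hQ, Matrix.transpose_apply, Matrix.of_apply, Matrix.one_apply]
    rw [← this]
    refine Finset.sum_congr rfl fun k _ => ?_
    simp [mul_comm]
  have hM : (Matrix.of fun i j => B (b i) (b j)) = Q.transpose * (formMatrix B * Q) := by
    ext i j
    simp only [Matrix.of_apply, Matrix.mul_apply, Matrix.transpose_apply, hQ]
    rw [form_apply_eq_sum]
  have hdet : Q.det * Q.det = 1 := by
    have := congrArg Matrix.det hQQ
    simpa [Matrix.det_mul, Matrix.det_transpose] using this
  rw [hM, Matrix.det_mul, Matrix.det_mul, Matrix.det_transpose]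
  linear_combination (-(formMatrix B).det) * hdet

/-- Jacobi's formula in an eigenbasis: only the diagonal entries of the derivative enter. -/
lemma hasDerivWithinAt_det_formMatrix
    {B : ℝ → EuclideanSpace ℝ (Fin n) →L[ℝ] EuclideanSpace ℝ (Fin n) →L[ℝ] ℝ}
    {B' : EuclideanSpace ℝ (Fin n) →L[ℝ] EuclideanSpace ℝ (Fin n) →L[ℝ] ℝ} {S : Set ℝ} {s : ℝ}
    (hB : HasDerivWithinAt B B' S s) (hH : (formMatrix (B s)).IsHermitian) :
    HasDerivWithinAt (fun r => (formMatrix (B r)).det)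
      (∑ i, diagCofactor hH.eigenvalues i *
        B' (hH.eigenvectorBasis i) (hH.eigenvectorBasis i)) S s := by
  simp only [fun r => det_formMatrix_eq_of_basis (B r) hH.eigenvectorBasis]
  refine hasDerivWithinAt_det_of_diagonal
    (A' := Matrix.of fun i j => B' (hH.eigenvectorBasis i) (hH.eigenvectorBasis j)) ?_ ?_
  · intro i j
    simp only [Matrix.of_apply]
    exact (hB.clm_apply (hasDerivWithinAt_const s S (hH.eigenvectorBasis i))).clm_apply
      (hasDerivWithinAt_const s S (hH.eigenvectorBasis j)) |>.congr_deriv (by simp)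
  · ext i j
    simp only [Matrix.of_apply, form_eigenvectorBasis, hH.eigenvectorBasis.inner_eq_ite,
      Matrix.diagonal_apply]
    split_ifs with h <;> simp [h]

/-- A form that is controlled on a hyperplane `N^⊥` and against `N`, with determinant bounded
above, has bounded eigenvalues: a large `B(N, N)` would make the form bounded below. -/
lemma form_le_of_hyperplane {c C M : ℝ} (hc : 0 < c) (hC : 0 ≤ C) (hM : 0 ≤ M) :
    ∃ L : ℝ, 0 < L ∧
    ∀ {B : EuclideanSpace ℝ (Fin n) →L[ℝ] EuclideanSpace ℝ (Fin n) →L[ℝ] ℝ}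
    (_ : ∀ v w, B v w = B w v) (N : EuclideanSpace ℝ (Fin n)) (_ : ‖N‖ = 1)
    (_ : ∀ e, ‖e‖ = 1 → inner ℝ e N = 0 → c ≤ B e e ∧ B e e ≤ C ∧ |B e N| ≤ C)
    (_ : (formMatrix B).det ≤ M) (hH : (formMatrix B).IsHermitian) (i : Fin n),
    hH.eigenvalues i ≤ L := by
  -- if `K ≤ B N N`, completing the square gives `c / 2 ≤ B`
  set K : ℝ := 2 * C ^ 2 / c + c / 2 with hK
  refine ⟨(C + 2 * C + K) + M * (2 / c) ^ (n - 1), by positivity, ?_⟩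
  intro B hB N hN htan hdet hH i
  have hscale : ∀ w : EuclideanSpace ℝ (Fin n), inner ℝ w N = 0 →
      c * ‖w‖ ^ 2 ≤ B w w ∧ B w w ≤ C * ‖w‖ ^ 2 ∧ |B w N| ≤ C * ‖w‖ := by
    intro w hw
    by_cases hw0 : w = 0
    · simp [hw0]
    have hpos : 0 < ‖w‖ := norm_pos_iff.2 hw0
    obtain ⟨h1, h2, h3⟩ := htan (‖w‖⁻¹ • w) (by simp [norm_smul, hpos.ne'])
      (by simp [inner_smul_left, hw])
    simp only [map_smul, smul_apply, smul_eq_mul, abs_mul, abs_inv,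
      abs_norm] at h1 h2 h3
    have e1 : ‖w‖⁻¹ * (‖w‖⁻¹ * B w w) * ‖w‖ ^ 2 = B w w := by field_simp
    have e2 : ‖w‖⁻¹ * |B w N| * ‖w‖ = |B w N| := by field_simp
    refine ⟨?_, ?_, ?_⟩
    · calc _ ≤ ‖w‖⁻¹ * (‖w‖⁻¹ * B w w) * ‖w‖ ^ 2 := by gcongr
        _ = _ := e1
    · calc _ = ‖w‖⁻¹ * (‖w‖⁻¹ * B w w) * ‖w‖ ^ 2 := e1.symm
        _ ≤ _ := by gcongr
    · calc _ = ‖w‖⁻¹ * |B w N| * ‖w‖ := e2.symm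
        _ ≤ _ := by gcongr
  have hNN : inner ℝ N N = 1 := by rw [real_inner_self_eq_norm_sq, hN]; norm_num
  -- decomposition of a vector into tangential and normal part
  have hdec : ∀ v : EuclideanSpace ℝ (Fin n), ∃ (w : EuclideanSpace ℝ (Fin n)) (s : ℝ),
      inner ℝ w N = 0 ∧ ‖v‖ ^ 2 = ‖w‖ ^ 2 + s ^ 2 ∧
      B v v = B w w + 2 * s * B w N + s ^ 2 * B N N := by
    intro v
    have hw : inner ℝ (v - inner ℝ v N • N) N = 0 := by
      rw [inner_sub_left, real_inner_smul_left, hNN, mul_one, sub_self]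
    refine ⟨v - inner ℝ v N • N, inner ℝ v N, hw, ?_, ?_⟩
    · have hv : v = (v - inner ℝ v N • N) + inner ℝ v N • N := by abel
      conv_lhs => rw [hv]
      rw [sq, norm_add_sq_eq_norm_sq_add_norm_sq_of_inner_eq_zero _ _
        (by rw [inner_smul_right, hw, mul_zero])]
      simp [norm_smul, hN, ← sq]
    · have hv : v = (v - inner ℝ v N • N) + inner ℝ v N • N := by abel
      generalize hs : inner ℝ v N = s at hv ⊢
      generalize hw' : v - s • N = w at hv ⊢
      rw [hv]
      simp only [map_add, map_smul, add_apply,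
        smul_apply, smul_eq_mul]
      rw [hB N w]
      ring
  have hPow : 0 ≤ M * (2 / c) ^ (n - 1) := by positivity
  rcases le_or_gt (B N N) K with hBN | hBN
  · refine (eigenvalue_le hH (a := C + 2 * C + K) (fun v => ?_) i).trans (by linarith)
    obtain ⟨w, s, hw, hv, hBv⟩ := hdec v
    obtain ⟨h1, h2, h3⟩ := hscale w hw
    rw [hv, hBv]
    have h4 : s * B w N ≤ |s| * (C * ‖w‖) := by
      calc s * B w N ≤ |s * B w N| := le_abs_self _
        _ = |s| * |B w N| := abs_mul _ _
        _ ≤ _ := by gcongr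
    have h5 : |s| * (C * ‖w‖) ≤ C * (‖w‖ ^ 2 + s ^ 2) / 2 := by
      nlinarith [mul_nonneg hC (sq_nonneg (|s| - ‖w‖)), sq_abs s]
    have hKnn : 0 ≤ K := by positivity
    nlinarith [mul_le_mul_of_nonneg_left hBN (sq_nonneg s), mul_nonneg hKnn (sq_nonneg ‖w‖),
      mul_nonneg hC (sq_nonneg s), mul_nonneg hC (sq_nonneg ‖w‖)]
  · have hlow : ∀ v, c / 2 * ‖v‖ ^ 2 ≤ B v v := by
      intro v
      obtain ⟨w, s, hw, hv, hBv⟩ := hdec v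
      obtain ⟨h1, h2, h3⟩ := hscale w hw
      rw [hv, hBv]
      have h4 : -(|s| * (C * ‖w‖)) ≤ s * B w N := by
        rw [neg_le]
        calc -(s * B w N) ≤ |s * B w N| := neg_le_abs _
          _ = |s| * |B w N| := abs_mul _ _
          _ ≤ _ := by gcongr
      have h5 : |s| * (C * ‖w‖) * 2 ≤ c / 2 * ‖w‖ ^ 2 + 2 * C ^ 2 / c * s ^ 2 := by
        have : 0 ≤ (c * ‖w‖ - 2 * C * |s|) ^ 2 / (2 * c) := by positivity
        have e : (c * ‖w‖ - 2 * C * |s|) ^ 2 / (2 * c)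
          = c / 2 * ‖w‖ ^ 2 + 2 * C ^ 2 / c * s ^ 2 - |s| * (C * ‖w‖) * 2 := by
          rw [← sq_abs s]; field_simp; ring
        linarith
      have h6 := mul_le_mul_of_nonneg_left hBN.le (sq_nonneg s)
      rw [hK] at h6
      nlinarith
    have hge : ∀ j, c / 2 ≤ hH.eigenvalues j := le_eigenvalue hH hlow
    have := mul_pow_le_prod (by positivity) hge i
    rw [← det_formMatrix_eq_prod hH] at this
    have h7 : hH.eigenvalues i ≤ M * (2 / c) ^ (n - 1) := by
      have hp : 0 < (c / 2) ^ (n - 1) := by positivity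
      have e : (2 / c) ^ (n - 1) = ((c / 2) ^ (n - 1))⁻¹ := by
        rw [← inv_pow, inv_div]
      rw [e, ← div_eq_mul_inv, le_div_iff₀ hp]
      exact this.trans hdet
    refine h7.trans ?_
    have hKnn : 0 ≤ K := by positivity
    linarith

end LinearAlgebra

/-! ### Extremum conditions, Taylor expansions and interchange of derivatives -/

section Calculus

open Filter Topology

lemma nonpos_of_le_mul {a C r : ℝ} (hr : 0 < r) (h : ∀ s ∈ Ioc 0 r, a ≤ C * s) : a ≤ 0 := by
  have hlim : Filter.Tendsto (fun s : ℝ => C * s) (nhdsWithin 0 (Ioi 0)) (nhds 0) := by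
    have : Filter.Tendsto (fun s : ℝ => C * s) (nhds 0) (nhds (C * 0)) :=
      (continuous_const.mul continuous_id).tendsto 0
    rw [mul_zero] at this
    exact this.mono_left nhdsWithin_le_nhds
  exact ge_of_tendsto hlim (Filter.mem_of_superset (Ioc_mem_nhdsGT hr) h)

variable {E F : Type*} [NormedAddCommGroup E] [NormedSpace ℝ E]
  [NormedAddCommGroup F] [NormedSpace ℝ F]

/-- The second order necessary condition at a local minimum. -/
lemma second_fderiv_nonneg_of_isLocalMin {f : E → ℝ} {f' : E → E →L[ℝ] ℝ}
    {f'' : E →L[ℝ] E →L[ℝ] ℝ} {x : E} (hf : ∀ᶠ y in 𝓝 x, HasFDerivAt f (f' y) y)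
    (hf' : HasFDerivAt f' f'' x) (hmin : IsLocalMin f x) (v : E) : 0 ≤ f'' v v := by
  by_contra! hneg
  set p : ℝ → ℝ := fun s => f (x + s • v) with hp
  have hline : ∀ s : ℝ, HasDerivAt (fun s : ℝ => x + s • v) v s := fun s => by
    simpa using ((hasDerivAt_id s).smul_const v).const_add x
  have hx0 : x + (0 : ℝ) • v = x := by simp
  have hcont : Tendsto (fun s : ℝ => x + s • v) (𝓝 0) (𝓝 x) := by
    have := (hline 0).continuousAt.tendsto
    rwa [hx0] at this
  have hp1 : ∀ᶠ s in 𝓝 (0 : ℝ), HasDerivAt p (f' (x + s • v) v) s :=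
    (hcont.eventually hf).mono fun s hs => hs.comp_hasDerivAt s (hline s)
  have hp2 : HasDerivAt (fun s : ℝ => f' (x + s • v) v) (f'' v v) 0 := by
    have h1 : HasFDerivAt f' f'' (x + (0 : ℝ) • v) := by rwa [hx0]
    have h2 : HasDerivAt (fun s : ℝ => f' (x + s • v)) (f'' v) 0 :=
      h1.comp_hasDerivAt (0 : ℝ) (hline 0)
    exact (h2.clm_apply (hasDerivAt_const (0 : ℝ) v)).congr_deriv (by simp)
  have hminp : IsLocalMin p 0 := by
    have : ∀ᶠ s in 𝓝 (0 : ℝ), f x ≤ f (x + s • v) := hcont.eventually hmin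
    simpa [IsLocalMin, IsMinFilter, hp] using this
  have hd1 : deriv p =ᶠ[𝓝 0] fun s : ℝ => f' (x + s • v) v := hp1.mono fun s hs => hs.deriv
  have hdd : deriv (deriv p) 0 = f'' v v := by rw [hd1.deriv_eq, hp2.deriv]
  have hmax : IsLocalMax p 0 := isLocalMax_of_deriv_deriv_neg (by rw [hdd]; exact hneg)
    hminp.deriv_eq_zero hp1.self_of_nhds.continuousAt
  -- a function that is both locally minimal and maximal is locally constant
  have hconst : p =ᶠ[𝓝 0] fun _ => p 0 := by
    filter_upwards [hminp, hmax] with s h1 h2 using le_antisymm h2 h1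
  have hz : deriv (deriv p) 0 = 0 := by
    have : deriv p =ᶠ[𝓝 0] deriv fun _ => p 0 := hconst.deriv
    rw [this.deriv_eq]
    simp
  rw [hdd] at hz
  exact hneg.ne hz

/-- The tangent plane at an interior point lies below the graph of a convex function, so the
second derivative is nonnegative. -/
lemma second_fderiv_nonneg_of_convexOn {f : E → ℝ} {f' : E → E →L[ℝ] ℝ}
    {f'' : E →L[ℝ] E →L[ℝ] ℝ} {K : Set E} {x : E} (hK : K ∈ 𝓝 x) (hconv : ConvexOn ℝ K f)
    (hf : ∀ᶠ y in 𝓝 x, HasFDerivAt f (f' y) y)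
    (hf' : HasFDerivAt f' f'' x) (v : E) : 0 ≤ f'' v v := by
  have hlin : ConvexOn ℝ K fun y => -(f' x y) :=
    LinearMap.convexOn (((-(f' x) : E →L[ℝ] ℝ)) : E →ₗ[ℝ] ℝ) hconv.1
  have hg : ConvexOn ℝ K fun y => f y + -(f' x y) := hconv.add hlin
  have hgd : ∀ᶠ y in 𝓝 x, HasFDerivAt (fun y => f y + -(f' x y)) (f' y + -(f' x)) y :=
    hf.mono fun y hy => hy.add (f' x).hasFDerivAt.neg
  have hgd' : HasFDerivAt (fun y => f' y + -(f' x)) f'' x := by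
    simpa using hf'.add_const (-(f' x))
  refine second_fderiv_nonneg_of_isLocalMin hgd hgd' ?_ v
  filter_upwards [hK] with y hy
  -- along the segment from `x` to `y` the one-variable function has vanishing derivative at `0`
  have hxK : x ∈ K := mem_of_mem_nhds hK
  by_contra! hlt
  obtain ⟨g, hgdef⟩ : ∃ g : E → ℝ, g = fun y => f y + -(f' x y) := ⟨_, rfl⟩
  rw [← hgdef] at hg hgd
  have hgx : HasFDerivAt g (0 : E →L[ℝ] ℝ) x := hgd.self_of_nhds.congr_fderiv (by simp)
  have hline : HasDerivAt (fun s : ℝ => x + s • (y - x)) (y - x) 0 := by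
    simpa using ((hasDerivAt_id (0 : ℝ)).smul_const (y - x)).const_add x
  have h0 : HasDerivAt (fun s : ℝ => g (x + s • (y - x))) 0 0 := by
    have h1 : HasFDerivAt g (0 : E →L[ℝ] ℝ) (x + (0 : ℝ) • (y - x)) := by simpa using hgx
    exact (h1.comp_hasDerivAt (0 : ℝ) hline).congr_deriv (by simp)
  have hε : 0 < g x - g y := by simpa [hgdef] using hlt
  have hlo := h0.isLittleO
  have hsm' := hlo.def (half_pos hε)
  simp only [sub_zero, zero_smul, add_zero, smul_zero, Real.norm_eq_abs] at hsm'
  obtain ⟨r, hr, hr0, hr1⟩ := ((hsm'.filter_mono (nhdsWithin_le_nhds (s := Ioi (0 : ℝ)))).and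
    (Ioo_mem_nhdsGT one_pos)).exists
  have hcr := hg.2 hxK hy (by linarith : 0 ≤ 1 - r) hr0.le (by ring)
  have harg' : (1 - r) • x + r • y = x + r • (y - x) := by
    rw [smul_sub, sub_smul, one_smul]; abel
  rw [harg'] at hcr
  have hcr' : g (x + r • (y - x)) ≤ (1 - r) * g x + r * g y := hcr
  rw [abs_of_pos hr0] at hr
  have h3 := (abs_le.1 hr).1
  nlinarith

/-- At a minimum in time over `[0, T]`, attained at a positive time, the derivative is
nonpositive; this covers the one-sided derivative at `T`. -/
lemma deriv_time_nonpos_of_min {T t p' : ℝ} {p : ℝ → ℝ} (ht : t ∈ Ioc 0 T)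
    (hp : HasDerivWithinAt p p' (Icc 0 T) t) (hmin : ∀ s ∈ Icc 0 T, p t ≤ p s) : p' ≤ 0 := by
  have htm : t ∈ Icc 0 T := ⟨ht.1.le, ht.2⟩
  have hl : IsLocalMinOn p (Icc 0 T) t := by
    filter_upwards [self_mem_nhdsWithin] with s hs using hmin s hs
  have hcone : (0 : ℝ) - t ∈ posTangentConeAt (Icc 0 T) t :=
    sub_mem_posTangentConeAt_of_segment_subset
      ((convex_Icc 0 T).segment_subset htm ⟨le_rfl, ht.1.le.trans ht.2⟩)
  have h := hl.hasFDerivWithinAt_nonneg hp.hasFDerivWithinAt hcone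
  simp only [ContinuousLinearMap.toSpanSingleton_apply, smul_eq_mul] at h
  nlinarith [ht.1]

lemma hasDerivWithinAt_comp_segment {f : E → F} {f' : E → E →L[ℝ] F} {K : Set E}
    (hK : Convex ℝ K) (hf : ∀ x ∈ K, HasFDerivWithinAt f (f' x) K x) {x y : E} (hx : x ∈ K)
    (hy : y ∈ K) {s : ℝ} (hs : s ∈ Icc (0 : ℝ) 1) :
    HasDerivWithinAt (fun s : ℝ => f (x + s • (y - x))) (f' (x + s • (y - x)) (y - x))
      (Icc 0 1) s := by
  have hmaps : MapsTo (fun s : ℝ => x + s • (y - x)) (Icc 0 1) K := fun r hr =>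
    hK.add_smul_sub_mem hx hy hr
  have hline : HasDerivWithinAt (fun s : ℝ => x + s • (y - x)) (y - x) (Icc 0 1) s := by
    simpa using (((hasDerivAt_id s).smul_const (y - x)).const_add x).hasDerivWithinAt
  exact (hf _ (hmaps hs)).comp_hasDerivWithinAt s hline hmaps

lemma norm_le_of_deriv_le {p q : ℝ → F} {C : ℝ}
    (hp : ∀ s ∈ Icc (0 : ℝ) 1, HasDerivWithinAt p (q s) (Icc 0 1) s)
    (hq : ∀ s ∈ Icc (0 : ℝ) 1, ‖q s‖ ≤ C) (h0 : p 0 = 0) : ∀ s ∈ Icc (0 : ℝ) 1, ‖p s‖ ≤ C := by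
  intro s hs
  have h := (convex_Icc (0 : ℝ) 1).norm_image_sub_le_of_norm_hasDerivWithin_le hp hq
    (left_mem_Icc.2 zero_le_one) hs
  rw [h0, sub_zero, sub_zero, Real.norm_of_nonneg hs.1] at h
  have hC : 0 ≤ C := (norm_nonneg _).trans (hq s hs)
  exact h.trans (mul_le_of_le_one_right hC hs.2)

/-- Lipschitz bound along segments of a convex set. -/
lemma norm_sub_le_of_fderiv_le {f : E → F} {f' : E → E →L[ℝ] F} {K : Set E} (hK : Convex ℝ K)
    (hf : ∀ x ∈ K, HasFDerivWithinAt f (f' x) K x) {C : ℝ} (hC : ∀ x ∈ K, ‖f' x‖ ≤ C)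
    {x y : E} (hx : x ∈ K) (hy : y ∈ K) : ‖f y - f x‖ ≤ C * ‖y - x‖ :=
  hK.norm_image_sub_le_of_norm_hasFDerivWithin_le hf hC hx hy

/-- First order Taylor expansion in a convex set. -/
lemma taylor_one_le {f : E → F} {f' : E → E →L[ℝ] F} {f'' : E → E →L[ℝ] E →L[ℝ] F} {K : Set E}
    (hK : Convex ℝ K) (hf : ∀ x ∈ K, HasFDerivWithinAt f (f' x) K x)
    (hf' : ∀ x ∈ K, HasFDerivWithinAt f' (f'' x) K x) {C : ℝ} (hC : ∀ x ∈ K, ‖f'' x‖ ≤ C)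
    {x y : E} (hx : x ∈ K) (hy : y ∈ K) :
    ‖f y - f x - f' x (y - x)‖ ≤ C * ‖y - x‖ ^ 2 := by
  have hp : ∀ s ∈ Icc (0 : ℝ) 1, HasDerivWithinAt
      (fun s : ℝ => f (x + s • (y - x)) - f x - s • f' x (y - x))
      (f' (x + s • (y - x)) (y - x) - f' x (y - x)) (Icc 0 1) s := fun s hs => by
    have h2 : HasDerivWithinAt (fun s : ℝ => s • f' x (y - x)) (f' x (y - x)) (Icc 0 1) s := by
      simpa using ((hasDerivAt_id s).smul_const (f' x (y - x))).hasDerivWithinAt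
    exact ((hasDerivWithinAt_comp_segment hK hf hx hy hs).sub_const (f x)).sub h2
  have h := norm_le_of_deriv_le (C := C * ‖y - x‖ ^ 2) hp (fun s hs => ?_) (by simp) 1
    (right_mem_Icc.2 zero_le_one)
  · simpa using h
  · have hm := hK.add_smul_sub_mem hx hy hs
    have h1 := norm_sub_le_of_fderiv_le hK hf' hC hx hm
    rw [add_sub_cancel_left, norm_smul, Real.norm_of_nonneg hs.1] at h1
    have hCn : 0 ≤ C := (norm_nonneg _).trans (hC x hx)
    have h1' : ‖f' (x + s • (y - x)) - f' x‖ ≤ C * ‖y - x‖ :=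
      h1.trans (by gcongr; exact mul_le_of_le_one_left (norm_nonneg _) hs.2)
    calc ‖f' (x + s • (y - x)) (y - x) - f' x (y - x)‖
        = ‖(f' (x + s • (y - x)) - f' x) (y - x)‖ := by simp
      _ ≤ ‖f' (x + s • (y - x)) - f' x‖ * ‖y - x‖ := ContinuousLinearMap.le_opNorm _ _
      _ ≤ C * ‖y - x‖ * ‖y - x‖ := by gcongr
      _ = _ := by ring

/-- Second order Taylor expansion in a convex set. -/
lemma taylor_two_le {f : E → F} {f' : E → E →L[ℝ] F} {f'' : E → E →L[ℝ] E →L[ℝ] F}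
    {f₃ : E → E →L[ℝ] E →L[ℝ] E →L[ℝ] F} {K : Set E}
    (hK : Convex ℝ K) (hf : ∀ x ∈ K, HasFDerivWithinAt f (f' x) K x)
    (hf' : ∀ x ∈ K, HasFDerivWithinAt f' (f'' x) K x)
    (hf'' : ∀ x ∈ K, HasFDerivWithinAt f'' (f₃ x) K x) {C : ℝ} (hC : ∀ x ∈ K, ‖f₃ x‖ ≤ C)
    {x y : E} (hx : x ∈ K) (hy : y ∈ K) :
    ‖f y - f x - f' x (y - x) - (1 / 2 : ℝ) • f'' x (y - x) (y - x)‖ ≤ C * ‖y - x‖ ^ 3 := by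
  have hp : ∀ s ∈ Icc (0 : ℝ) 1, HasDerivWithinAt
      (fun s : ℝ => f (x + s • (y - x)) - f x - s • f' x (y - x)
        - (s ^ 2 / 2) • f'' x (y - x) (y - x))
      (f' (x + s • (y - x)) (y - x) - f' x (y - x) - s • f'' x (y - x) (y - x))
      (Icc 0 1) s := fun s hs => by
    have h2 : HasDerivWithinAt (fun s : ℝ => s • f' x (y - x)) (f' x (y - x)) (Icc 0 1) s := by
      simpa using ((hasDerivAt_id s).smul_const (f' x (y - x))).hasDerivWithinAt
    have h3 : HasDerivWithinAt (fun s : ℝ => (s ^ 2 / 2) • f'' x (y - x) (y - x))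
        (s • f'' x (y - x) (y - x)) (Icc 0 1) s := by
      have h4 : HasDerivAt (fun s : ℝ => s ^ 2 / 2) s s := by
        simpa using ((hasDerivAt_id s).pow 2).div_const 2
      exact (h4.smul_const _).hasDerivWithinAt
    exact (((hasDerivWithinAt_comp_segment hK hf hx hy hs).sub_const (f x)).sub h2).sub h3
  have h := norm_le_of_deriv_le (C := C * ‖y - x‖ ^ 3) hp (fun s hs => ?_) (by simp) 1
    (right_mem_Icc.2 zero_le_one)
  · simpa using h
  · have hm := hK.add_smul_sub_mem hx hy hs
    have h1 := taylor_one_le hK hf' hf'' hC hx hm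
    rw [add_sub_cancel_left, norm_smul, Real.norm_of_nonneg hs.1] at h1
    have hCn : 0 ≤ C := (norm_nonneg _).trans (hC x hx)
    have hs0 := hs.1
    have h1' : ‖f' (x + s • (y - x)) - f' x - f'' x (s • (y - x))‖ ≤ C * ‖y - x‖ ^ 2 :=
      h1.trans (by gcongr; exact mul_le_of_le_one_left (norm_nonneg _) hs.2)
    calc _ = ‖(f' (x + s • (y - x)) - f' x - f'' x (s • (y - x))) (y - x)‖ := by simp
      _ ≤ ‖f' (x + s • (y - x)) - f' x - f'' x (s • (y - x))‖ * ‖y - x‖ :=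
        ContinuousLinearMap.le_opNorm _ _
      _ ≤ C * ‖y - x‖ ^ 2 * ‖y - x‖ := by gcongr
      _ = _ := by ring

/-- Third order Taylor expansion in a convex set. -/
lemma taylor_three_le {f : E → F} {f' : E → E →L[ℝ] F} {f'' : E → E →L[ℝ] E →L[ℝ] F}
    {f₃ : E → E →L[ℝ] E →L[ℝ] E →L[ℝ] F} {f₄ : E → E →L[ℝ] E →L[ℝ] E →L[ℝ] E →L[ℝ] F} {K : Set E}
    (hK : Convex ℝ K) (hf : ∀ x ∈ K, HasFDerivWithinAt f (f' x) K x)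
    (hf' : ∀ x ∈ K, HasFDerivWithinAt f' (f'' x) K x)
    (hf'' : ∀ x ∈ K, HasFDerivWithinAt f'' (f₃ x) K x)
    (hf₃ : ∀ x ∈ K, HasFDerivWithinAt f₃ (f₄ x) K x) {C : ℝ} (hC : ∀ x ∈ K, ‖f₄ x‖ ≤ C)
    {x y : E} (hx : x ∈ K) (hy : y ∈ K) :
    ‖f y - f x - f' x (y - x) - (1 / 2 : ℝ) • f'' x (y - x) (y - x)
      - (1 / 6 : ℝ) • f₃ x (y - x) (y - x) (y - x)‖ ≤ C * ‖y - x‖ ^ 4 := by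
  have hp : ∀ s ∈ Icc (0 : ℝ) 1, HasDerivWithinAt
      (fun s : ℝ => f (x + s • (y - x)) - f x - s • f' x (y - x)
        - (s ^ 2 / 2) • f'' x (y - x) (y - x) - (s ^ 3 / 6) • f₃ x (y - x) (y - x) (y - x))
      (f' (x + s • (y - x)) (y - x) - f' x (y - x) - s • f'' x (y - x) (y - x)
        - (s ^ 2 / 2) • f₃ x (y - x) (y - x) (y - x))
      (Icc 0 1) s := fun s hs => by
    have h2 : HasDerivWithinAt (fun s : ℝ => s • f' x (y - x)) (f' x (y - x)) (Icc 0 1) s := by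
      simpa using ((hasDerivAt_id s).smul_const (f' x (y - x))).hasDerivWithinAt
    have h3 : HasDerivWithinAt (fun s : ℝ => (s ^ 2 / 2) • f'' x (y - x) (y - x))
        (s • f'' x (y - x) (y - x)) (Icc 0 1) s := by
      have h4 : HasDerivAt (fun s : ℝ => s ^ 2 / 2) s s := by
        simpa using ((hasDerivAt_id s).pow 2).div_const 2
      exact (h4.smul_const _).hasDerivWithinAt
    have h4 : HasDerivWithinAt (fun s : ℝ => (s ^ 3 / 6) • f₃ x (y - x) (y - x) (y - x))
        ((s ^ 2 / 2) • f₃ x (y - x) (y - x) (y - x)) (Icc 0 1) s := by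
      have h5 : HasDerivAt (fun s : ℝ => s ^ 3 / 6) (s ^ 2 / 2) s :=
        (((hasDerivAt_id s).pow 3).div_const 6).congr_deriv (by simp; ring)
      exact (h5.smul_const _).hasDerivWithinAt
    exact ((((hasDerivWithinAt_comp_segment hK hf hx hy hs).sub_const (f x)).sub h2).sub h3).sub h4
  have h := norm_le_of_deriv_le (C := C * ‖y - x‖ ^ 4) hp (fun s hs => ?_) (by simp) 1
    (right_mem_Icc.2 zero_le_one)
  · simpa using h
  · have hm := hK.add_smul_sub_mem hx hy hs
    have h1 := taylor_two_le hK hf' hf'' hf₃ hC hx hm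
    rw [add_sub_cancel_left, norm_smul, Real.norm_of_nonneg hs.1] at h1
    have hCn : 0 ≤ C := (norm_nonneg (f₄ x)).trans (hC x hx)
    have hs0 := hs.1
    have h1' : ‖f' (x + s • (y - x)) - f' x - f'' x (s • (y - x))
        - (1 / 2 : ℝ) • f₃ x (s • (y - x)) (s • (y - x))‖ ≤ C * ‖y - x‖ ^ 3 :=
      h1.trans (by gcongr; exact mul_le_of_le_one_left (norm_nonneg _) hs.2)
    calc _ = ‖(f' (x + s • (y - x)) - f' x - f'' x (s • (y - x))
          - (1 / 2 : ℝ) • f₃ x (s • (y - x)) (s • (y - x))) (y - x)‖ := by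
          congr 1
          simp only [map_smul, smul_apply, sub_apply, smul_smul]
          congr 2
          ring
      _ ≤ ‖f' (x + s • (y - x)) - f' x - f'' x (s • (y - x))
          - (1 / 2 : ℝ) • f₃ x (s • (y - x)) (s • (y - x))‖ * ‖y - x‖ :=
        ContinuousLinearMap.le_opNorm _ _
      _ ≤ C * ‖y - x‖ ^ 3 * ‖y - x‖ := by gcongr
      _ = _ := by ring

/-- Interchange of a time derivative and a space derivative, when only the mixed derivative
`D_x ∂_t f` is known to exist and to be continuous. -/
lemma hasDerivWithinAt_fderiv_of_mixed {Ω : Set E} (hΩ : IsOpen Ω) {T : ℝ} {f g : E → ℝ → F}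
    {f' g' : E → ℝ → E →L[ℝ] F}
    (hft : ∀ x ∈ Ω, ∀ t ∈ Icc 0 T, HasDerivWithinAt (f x) (g x t) (Icc 0 T) t)
    (hfx : ∀ x ∈ Ω, ∀ t ∈ Icc 0 T, HasFDerivAt (fun y => f y t) (f' x t) x)
    (hgx : ∀ x ∈ Ω, ∀ t ∈ Icc 0 T, HasFDerivAt (fun y => g y t) (g' x t) x)
    (hg' : ContinuousOn (fun p : E × ℝ => g' p.1 p.2) (Ω ×ˢ Icc 0 T))
    {x : E} (hx : x ∈ Ω) {t : ℝ} (ht : t ∈ Icc 0 T) :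
    HasDerivWithinAt (fun s => f' x s) (g' x t) (Icc 0 T) t := by
  rw [hasDerivWithinAt_iff_isLittleO, Asymptotics.isLittleO_iff]
  intro ε hε
  have hcont := hg' (x, t) ⟨hx, ht⟩
  rw [Metric.continuousWithinAt_iff] at hcont
  obtain ⟨δ₁, hδ₁, h₁⟩ := hcont (ε / 2) (by positivity)
  obtain ⟨δ₂, hδ₂, h₂⟩ := Metric.isOpen_iff.1 hΩ x hx
  set δ := min δ₁ δ₂ with hδ
  have hδpos : 0 < δ := lt_min hδ₁ hδ₂
  have hclose : ∀ y ∈ Metric.ball x δ, ∀ s ∈ Icc 0 T, dist s t < δ → y ∈ Ω ∧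
      ‖g' y s - g' x t‖ ≤ ε / 2 := by
    intro y hy s hs hst
    have hyΩ : y ∈ Ω := h₂ (Metric.ball_subset_ball (min_le_right _ _) hy)
    refine ⟨hyΩ, ?_⟩
    rw [← dist_eq_norm]
    refine (h₁ (x := (y, s)) ⟨hyΩ, hs⟩ ?_).le
    rw [Prod.dist_eq]
    exact max_lt (lt_of_lt_of_le hy (min_le_left _ _)) (lt_of_lt_of_le hst (min_le_left _ _))
  filter_upwards [self_mem_nhdsWithin, mem_nhdsWithin_of_mem_nhds (Metric.ball_mem_nhds t hδpos)]
    with s hs hst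
  have hder : HasFDerivAt (fun y => f y s - f y t - (s - t) • g y t)
      (f' x s - f' x t - (s - t) • g' x t) x :=
    ((hfx x hx s hs).sub (hfx x hx t ht)).sub ((hgx x hx t ht).const_smul (s - t))
  refine hder.le_of_lip' (by positivity) ?_
  filter_upwards [Metric.ball_mem_nhds x hδpos] with y hy
  -- the increment of `z ↦ g z r - g z t` from `x` to `y`
  have hinc : ∀ r ∈ Icc 0 T, dist r t < δ →
      ‖(g y r - g y t) - (g x r - g x t)‖ ≤ ε * ‖y - x‖ := by
    intro r hr hrt
    refine (convex_ball x δ).norm_image_sub_le_of_norm_hasFDerivWithin_le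
      (f := fun z => g z r - g z t) (f' := fun z => g' z r - g' z t) ?_ ?_
      (Metric.mem_ball_self hδpos) hy
    · intro z hz
      have hzΩ := (hclose z hz t ht (by simpa using hδpos)).1
      exact ((hgx z hzΩ r hr).sub (hgx z hzΩ t ht)).hasFDerivWithinAt
    · intro z hz
      have e1 := (hclose z hz t ht (by simpa using hδpos)).2
      have e2 := (hclose z hz r hr hrt).2
      calc ‖g' z r - g' z t‖ = ‖(g' z r - g' x t) - (g' z t - g' x t)‖ := by congr 1; abel
        _ ≤ ‖g' z r - g' x t‖ + ‖g' z t - g' x t‖ := norm_sub_le _ _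
        _ ≤ ε := by linarith
  have hyΩ := (hclose y hy t ht (by simpa using hδpos)).1
  have hsub : uIcc t s ⊆ Icc 0 T := (convex_Icc 0 T).ordConnected.uIcc_subset ht hs
  have hmv := (convex_uIcc t s).norm_image_sub_le_of_norm_hasDerivWithin_le
    (f := fun r => f y r - f x r - r • (g y t - g x t))
    (f' := fun r => g y r - g x r - (g y t - g x t)) (C := ε * ‖y - x‖) (x := t) (y := s)
    (fun r hr => ?_) (fun r hr => ?_) left_mem_uIcc right_mem_uIcc
  · calc _ = ‖(f y s - f x s - s • (g y t - g x t)) - (f y t - f x t - t • (g y t - g x t))‖ := by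
          congr 1
          simp only [smul_sub, sub_smul]
          abel
      _ ≤ ε * ‖y - x‖ * ‖s - t‖ := hmv
      _ = _ := by ring
  · have hr' := hsub hr
    have h2 : HasDerivWithinAt (fun r : ℝ => r • (g y t - g x t)) (g y t - g x t) (uIcc t s) r := by
      simpa using ((hasDerivAt_id r).smul_const (g y t - g x t)).hasDerivWithinAt
    exact (((hft y hyΩ r hr').mono hsub).sub ((hft x hx r hr').mono hsub)).sub h2
  · have hr' := hsub hr
    have hrt : dist r t < δ := by
      refine lt_of_le_of_lt ?_ hst
      rw [Real.dist_eq, Real.dist_eq]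
      exact abs_sub_left_of_mem_uIcc hr
    calc _ = ‖(g y r - g y t) - (g x r - g x t)‖ := by congr 1; abel
      _ ≤ _ := hinc r hr' hrt

end Calculus

/-! ### Nested derivatives within a set -/

section NestedDerivatives

open Filter Topology

variable {E : Type*} [NormedAddCommGroup E] [NormedSpace ℝ E]

/-- The first derivative of `f` within `K`. -/
noncomputable abbrev sd1 (K : Set E) (f : E → ℝ) : E → E →L[ℝ] ℝ := fderivWithin ℝ f K

/-- The second derivative of `f` within `K`, as a nested derivative. -/
noncomputable abbrev sd2 (K : Set E) (f : E → ℝ) : E → E →L[ℝ] E →L[ℝ] ℝ :=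
  fderivWithin ℝ (sd1 K f) K

/-- The third derivative of `f` within `K`, as a nested derivative. -/
noncomputable abbrev sd3 (K : Set E) (f : E → ℝ) : E → E →L[ℝ] E →L[ℝ] E →L[ℝ] ℝ :=
  fderivWithin ℝ (sd2 K f) K

/-- The fourth derivative of `f` within `K`, as a nested derivative. -/
noncomputable abbrev sd4 (K : Set E) (f : E → ℝ) : E → E →L[ℝ] E →L[ℝ] E →L[ℝ] E →L[ℝ] ℝ :=
  fderivWithin ℝ (sd3 K f) K

variable {K : Set E} {f : E → ℝ}

lemma contDiffOn_sd1 (hK : UniqueDiffOn ℝ K) {m : ℕ} (hf : ContDiffOn ℝ (m + 1 : ℕ) f K) :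
    ContDiffOn ℝ m (sd1 K f) K :=
  hf.fderivWithin hK (by exact_mod_cast le_rfl)

lemma contDiffOn_sd2 (hK : UniqueDiffOn ℝ K) {m : ℕ} (hf : ContDiffOn ℝ (m + 2 : ℕ) f K) :
    ContDiffOn ℝ m (sd2 K f) K :=
  (contDiffOn_sd1 (m := m + 1) hK hf).fderivWithin hK (by exact_mod_cast le_rfl)

lemma contDiffOn_sd3 (hK : UniqueDiffOn ℝ K) {m : ℕ} (hf : ContDiffOn ℝ (m + 3 : ℕ) f K) :
    ContDiffOn ℝ m (sd3 K f) K :=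
  (contDiffOn_sd2 (m := m + 1) hK hf).fderivWithin hK (by exact_mod_cast le_rfl)

lemma contDiffOn_sd4 (hK : UniqueDiffOn ℝ K) {m : ℕ} (hf : ContDiffOn ℝ (m + 4 : ℕ) f K) :
    ContDiffOn ℝ m (sd4 K f) K :=
  (contDiffOn_sd3 (m := m + 1) hK hf).fderivWithin hK (by exact_mod_cast le_rfl)

lemma hasFDerivWithinAt_sd1 {m : ℕ} (hf : ContDiffOn ℝ (m + 1 : ℕ) f K) {x : E} (hx : x ∈ K) :
    HasFDerivWithinAt f (sd1 K f x) K x :=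
  ((hf x hx).differentiableWithinAt (by simp)).hasFDerivWithinAt

lemma hasFDerivWithinAt_sd2 (hK : UniqueDiffOn ℝ K) {m : ℕ}
    (hf : ContDiffOn ℝ (m + 2 : ℕ) f K) {x : E} (hx : x ∈ K) :
    HasFDerivWithinAt (sd1 K f) (sd2 K f x) K x :=
  ((contDiffOn_sd1 (m := m + 1) hK hf x hx).differentiableWithinAt (by simp)).hasFDerivWithinAt

lemma hasFDerivWithinAt_sd3 (hK : UniqueDiffOn ℝ K) {m : ℕ}
    (hf : ContDiffOn ℝ (m + 3 : ℕ) f K) {x : E} (hx : x ∈ K) :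
    HasFDerivWithinAt (sd2 K f) (sd3 K f x) K x :=
  ((contDiffOn_sd2 (m := m + 1) hK hf x hx).differentiableWithinAt (by simp)).hasFDerivWithinAt

lemma hasFDerivWithinAt_sd4 (hK : UniqueDiffOn ℝ K) {m : ℕ}
    (hf : ContDiffOn ℝ (m + 4 : ℕ) f K) {x : E} (hx : x ∈ K) :
    HasFDerivWithinAt (sd3 K f) (sd4 K f x) K x :=
  ((contDiffOn_sd3 (m := m + 1) hK hf x hx).differentiableWithinAt (by simp)).hasFDerivWithinAt

lemma sd2_symm (hK : UniqueDiffOn ℝ K) (hKi : K ⊆ closure (interior K)) {m : ℕ}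
    (hf : ContDiffOn ℝ (m + 2 : ℕ) f K) {x : E} (hx : x ∈ K) (v w : E) :
    sd2 K f x v w = sd2 K f x w v := by
  refine ContDiffWithinAt.isSymmSndFDerivWithinAt (hf x hx) ?_ hK (hKi hx) hx v w
  simp only [minSmoothness_of_isRCLikeNormedField]
  exact_mod_cast (by omega : 2 ≤ m + 2)

lemma sd3_symm_left (hK : UniqueDiffOn ℝ K) (hKi : K ⊆ closure (interior K)) {m : ℕ}
    (hf : ContDiffOn ℝ (m + 3 : ℕ) f K) {x : E} (hx : x ∈ K) (v w z : E) :
    sd3 K f x v w z = sd3 K f x w v z := by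
  have h : IsSymmSndFDerivWithinAt ℝ (sd1 K f) K x := by
    refine ContDiffWithinAt.isSymmSndFDerivWithinAt
      (contDiffOn_sd1 (m := m + 2) hK hf x hx) ?_ hK (hKi hx) hx
    simp only [minSmoothness_of_isRCLikeNormedField]
    exact_mod_cast (by omega : 2 ≤ m + 2)
  rw [sd3, sd2]
  rw [h v w]

lemma sd3_symm_right (hK : UniqueDiffOn ℝ K) (hKi : K ⊆ closure (interior K)) {m : ℕ}
    (hf : ContDiffOn ℝ (m + 3 : ℕ) f K) {x : E} (hx : x ∈ K) (v w z : E) :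
    sd3 K f x v w z = sd3 K f x v z w := by
  have h := hasFDerivWithinAt_sd3 hK hf hx
  have key : ∀ a b : E, HasFDerivWithinAt (fun y => sd2 K f y a b)
      (((sd3 K f x).flip a).flip b) K x := fun a b =>
    ((h.clm_apply (hasFDerivWithinAt_const a x K)).clm_apply
      (hasFDerivWithinAt_const b x K)).congr_fderiv (by ext; simp)
  have h3 := (key z w).congr (fun y hy => sd2_symm hK hKi (m := m + 1) hf hy w z)
    (sd2_symm hK hKi (m := m + 1) hf hx w z)
  exact congrArg (fun L : E →L[ℝ] ℝ => L v) ((hK x hx).eq (key w z) h3)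

lemma sd3_rotate (hK : UniqueDiffOn ℝ K) (hKi : K ⊆ closure (interior K)) {m : ℕ}
    (hf : ContDiffOn ℝ (m + 3 : ℕ) f K) {x : E} (hx : x ∈ K) (v w z : E) :
    sd3 K f x v w z = sd3 K f x z v w := by
  rw [sd3_symm_right hK hKi hf hx v w z, sd3_symm_left hK hKi hf hx v z w]

/-- A continuous bilinear form that is nonnegative on a set is nonnegative on its closure. -/
lemma form_nonneg_closure {Ω : Set E} {H : E → E →L[ℝ] E →L[ℝ] ℝ}
    (hH : ContinuousOn H (closure Ω)) (h : ∀ x ∈ Ω, ∀ v, 0 ≤ H x v v) {x : E}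
    (hx : x ∈ closure Ω) (v : E) : 0 ≤ H x v v := by
  have hc : ContinuousOn (fun y => H y v v) (closure Ω) :=
    (hH.clm_apply continuousOn_const).clm_apply continuousOn_const
  have := hc.image_closure (s := Ω)
  have h2 : (fun y => H y v v) x ∈ closure ((fun y => H y v v) '' Ω) := this ⟨x, hx, rfl⟩
  refine closure_minimal ?_ isClosed_Ici h2
  rintro _ ⟨y, hy, rfl⟩
  exact h y hy v

/-- A norm bound on a set extends to points of the closure by continuity. -/
lemma norm_le_closure {F : Type*} [NormedAddCommGroup F] {X : Type*} [TopologicalSpace X]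
    {Ω S : Set X} {g : X → F} {C : ℝ} (h : ∀ x ∈ Ω, ‖g x‖ ≤ C) {x : X}
    (hg : ContinuousWithinAt g S x) (hΩS : Ω ⊆ S) (hx : x ∈ closure Ω) : ‖g x‖ ≤ C := by
  have h2 := (hg.mono hΩS).mem_closure_image hx
  have h3 : g x ∈ {y : F | ‖y‖ ≤ C} := by
    refine closure_minimal ?_ (isClosed_le continuous_norm continuous_const) h2
    rintro _ ⟨y, hy, rfl⟩
    exact h y hy
  exact h3

end NestedDerivatives

/-! ### Closures of open convex sets -/

section ConvexClosure

variable {E : Type*} [NormedAddCommGroup E] [NormedSpace ℝ E] {Ω : Set E}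

lemma uniqueDiffOn_closure (hΩ : IsOpen Ω) (hc : Convex ℝ Ω) (hne : Ω.Nonempty) :
    UniqueDiffOn ℝ (closure Ω) :=
  uniqueDiffOn_convex hc.closure (hne.mono (hΩ.subset_interior_iff.2 subset_closure))

lemma closure_subset_closure_interior {X : Type*} [TopologicalSpace X] {Ω : Set X}
    (hΩ : IsOpen Ω) : closure Ω ⊆ closure (interior (closure Ω)) :=
  closure_mono (hΩ.subset_interior_iff.2 subset_closure)

lemma closure_mem_nhds {X : Type*} [TopologicalSpace X] {Ω : Set X} (hΩ : IsOpen Ω) {x : X}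
    (hx : x ∈ Ω) : closure Ω ∈ nhds x :=
  Filter.mem_of_superset (hΩ.mem_nhds hx) subset_closure

end ConvexClosure

/-! ### Derivatives of functions in the parabolic space -/

section ParabolicDerivatives

open Filter Topology

variable {n : ℕ} {Ω : Set (EuclideanSpace ℝ (Fin n))} {T : ℝ}
  {w : EuclideanSpace ℝ (Fin n) → ℝ → ℝ}

lemma hessian_eq_formMatrix (hK : UniqueDiffOn ℝ (closure Ω)) {x : EuclideanSpace ℝ (Fin n)}
    (hx : x ∈ closure Ω) (t : ℝ) :
    hessian Ω w x t = formMatrix (sd2 (closure Ω) (fun y => w y t) x) := by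
  ext i j
  simp only [hessian, formMatrix, Matrix.of_apply]
  rw [iteratedFDerivWithin_two_apply _ hK hx]
  simp

lemma parabolicDeriv_zero_left (s : ℕ) (x : EuclideanSpace ℝ (Fin n)) (t : ℝ)
    (m : Fin 0 → EuclideanSpace ℝ (Fin n)) :
    parabolicDeriv Ω T 0 s w x t m = iteratedDerivWithin s (w x) (Icc 0 T) t := by
  simp [parabolicDeriv]

/-- The slice at time `t` of the `s`-th time derivative. -/
noncomputable def timeSlice (T : ℝ) (s : ℕ) (w : EuclideanSpace ℝ (Fin n) → ℝ → ℝ) (t : ℝ) :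
    EuclideanSpace ℝ (Fin n) → ℝ :=
  fun y => iteratedDerivWithin s (w y) (Icc 0 T) t

lemma timeSlice_zero (t : ℝ) : timeSlice T 0 w t = fun y => w y t := by
  ext y
  simp [timeSlice]

lemma timeSlice_one (t : ℝ) : timeSlice T 1 w t = fun y => timeDeriv T w y t := by
  ext y
  simp [timeSlice, timeDeriv, iteratedDerivWithin_one]

lemma parabolicDeriv_one (hK : UniqueDiffOn ℝ (closure Ω)) (s : ℕ)
    {x : EuclideanSpace ℝ (Fin n)} (hx : x ∈ closure Ω) (t : ℝ)
    (m : Fin 1 → EuclideanSpace ℝ (Fin n)) :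
    parabolicDeriv Ω T 1 s w x t m = sd1 (closure Ω) (timeSlice T s w t) x (m 0) := by
  simp only [parabolicDeriv, iteratedFDerivWithin_succ_apply_right hK hx,
    iteratedFDerivWithin_zero_apply]
  rfl

lemma parabolicDeriv_two (hK : UniqueDiffOn ℝ (closure Ω)) (s : ℕ)
    {x : EuclideanSpace ℝ (Fin n)} (hx : x ∈ closure Ω) (t : ℝ)
    (m : Fin 2 → EuclideanSpace ℝ (Fin n)) :
    parabolicDeriv Ω T 2 s w x t m = sd2 (closure Ω) (timeSlice T s w t) x (m 0) (m 1) := by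
  simp only [parabolicDeriv, iteratedFDerivWithin_succ_apply_right hK hx,
    iteratedFDerivWithin_zero_apply]
  rfl

lemma parabolicDeriv_three (hK : UniqueDiffOn ℝ (closure Ω)) (s : ℕ)
    {x : EuclideanSpace ℝ (Fin n)} (hx : x ∈ closure Ω) (t : ℝ)
    (m : Fin 3 → EuclideanSpace ℝ (Fin n)) :
    parabolicDeriv Ω T 3 s w x t m
      = sd3 (closure Ω) (timeSlice T s w t) x (m 0) (m 1) (m 2) := by
  simp only [parabolicDeriv, iteratedFDerivWithin_succ_apply_right hK hx,
    iteratedFDerivWithin_zero_apply]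
  rfl

lemma parabolicDeriv_four (hK : UniqueDiffOn ℝ (closure Ω)) (s : ℕ)
    {x : EuclideanSpace ℝ (Fin n)} (hx : x ∈ closure Ω) (t : ℝ)
    (m : Fin 4 → EuclideanSpace ℝ (Fin n)) :
    parabolicDeriv Ω T 4 s w x t m
      = sd4 (closure Ω) (timeSlice T s w t) x (m 0) (m 1) (m 2) (m 3) := by
  simp only [parabolicDeriv, iteratedFDerivWithin_succ_apply_right hK hx,
    iteratedFDerivWithin_zero_apply]
  rfl

lemma norm_clm_le_of_single {F : Type*} [NormedAddCommGroup F] [NormedSpace ℝ F]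
    {L : EuclideanSpace ℝ (Fin n) →L[ℝ] F} {C : ℝ} (hC : 0 ≤ C)
    (h : ∀ i, ‖L (EuclideanSpace.single i 1)‖ ≤ C) : ‖L‖ ≤ n * C := by
  refine L.opNorm_le_bound (by positivity) fun v => ?_
  conv_lhs => rw [sum_smul_single v]
  rw [map_sum]
  calc ‖∑ i, L (v i • EuclideanSpace.single i (1 : ℝ))‖
      ≤ ∑ i, ‖L (v i • EuclideanSpace.single i (1 : ℝ))‖ := norm_sum_le _ _
    _ ≤ ∑ _i : Fin n, C * ‖v‖ := by
        refine Finset.sum_le_sum fun i _ => ?_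
        rw [map_smul, norm_smul, mul_comm]
        exact mul_le_mul (h i) (PiLp.norm_apply_le v i) (norm_nonneg _) hC
    _ = n * C * ‖v‖ := by simp [mul_assoc]

variable {M : ℝ≥0}

lemma abs_parabolicDeriv_le (hw : parabolicNorm 4 Ω T w ≤ M) {j s : ℕ} (hjs : j + 2 * s ≤ 4)
    {x : EuclideanSpace ℝ (Fin n)} (hx : x ∈ Ω) {t : ℝ} (ht : t ∈ Ioc 0 T) (v : Fin j → Fin n) :
    |parabolicDeriv Ω T j s w x t (fun i => EuclideanSpace.single (v i) 1)| ≤ M := by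
  have hmem : (x, t) ∈ parabolicCylinder Ω T := ⟨hx, ht⟩
  have h : ‖parabolicDeriv Ω T j s w x t (fun i => EuclideanSpace.single (v i) 1)‖ₑ ≤ M := by
    refine le_trans ?_ hw
    unfold parabolicNorm
    refine le_iSup_of_le j (le_iSup_of_le s (le_iSup_of_le hjs ?_))
    exact le_iSup_of_le (x, t) (le_iSup_of_le hmem (le_iSup_of_le v le_rfl))
  rw [enorm_le_coe] at h
  exact_mod_cast h

lemma abs_timeSlice_le (hw : parabolicNorm 4 Ω T w ≤ M) {s : ℕ} (hs : 2 * s ≤ 4)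
    {x : EuclideanSpace ℝ (Fin n)} (hx : x ∈ Ω) {t : ℝ} (ht : t ∈ Ioc 0 T) :
    |timeSlice T s w t x| ≤ M := by
  have := abs_parabolicDeriv_le hw (j := 0) (s := s) (by omega) hx ht Fin.elim0
  rwa [parabolicDeriv_zero_left] at this

lemma norm_sd1_le (hK : UniqueDiffOn ℝ (closure Ω)) (hw : parabolicNorm 4 Ω T w ≤ M) {s : ℕ}
    (hs : 1 + 2 * s ≤ 4) {x : EuclideanSpace ℝ (Fin n)} (hx : x ∈ Ω) {t : ℝ}
    (ht : t ∈ Ioc 0 T) : ‖sd1 (closure Ω) (timeSlice T s w t) x‖ ≤ n * M := by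
  refine norm_clm_le_of_single M.2 fun i => ?_
  have := abs_parabolicDeriv_le hw hs hx ht ![i]
  rw [parabolicDeriv_one hK s (subset_closure hx)] at this
  simpa using this

lemma norm_sd2_le (hK : UniqueDiffOn ℝ (closure Ω)) (hw : parabolicNorm 4 Ω T w ≤ M) {s : ℕ}
    (hs : 2 + 2 * s ≤ 4) {x : EuclideanSpace ℝ (Fin n)} (hx : x ∈ Ω) {t : ℝ}
    (ht : t ∈ Ioc 0 T) : ‖sd2 (closure Ω) (timeSlice T s w t) x‖ ≤ n * (n * M) := by
  refine norm_clm_le_of_single (by positivity) fun i => ?_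
  refine norm_clm_le_of_single M.2 fun j => ?_
  have := abs_parabolicDeriv_le hw hs hx ht ![i, j]
  rw [parabolicDeriv_two hK s (subset_closure hx)] at this
  simpa using this

lemma norm_sd3_le (hK : UniqueDiffOn ℝ (closure Ω)) (hw : parabolicNorm 4 Ω T w ≤ M) {s : ℕ}
    (hs : 3 + 2 * s ≤ 4) {x : EuclideanSpace ℝ (Fin n)} (hx : x ∈ Ω) {t : ℝ}
    (ht : t ∈ Ioc 0 T) : ‖sd3 (closure Ω) (timeSlice T s w t) x‖ ≤ n * (n * (n * M)) := by
  refine norm_clm_le_of_single (by positivity) fun i => ?_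
  refine norm_clm_le_of_single (by positivity) fun j => ?_
  refine norm_clm_le_of_single M.2 fun k => ?_
  have := abs_parabolicDeriv_le hw hs hx ht ![i, j, k]
  rw [parabolicDeriv_three hK s (subset_closure hx)] at this
  simpa using this

lemma norm_sd4_le (hK : UniqueDiffOn ℝ (closure Ω)) (hw : parabolicNorm 4 Ω T w ≤ M) {s : ℕ}
    (hs : 4 + 2 * s ≤ 4) {x : EuclideanSpace ℝ (Fin n)} (hx : x ∈ Ω) {t : ℝ}
    (ht : t ∈ Ioc 0 T) : ‖sd4 (closure Ω) (timeSlice T s w t) x‖ ≤ n * (n * (n * (n * M))) := by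
  refine norm_clm_le_of_single (by positivity) fun i => ?_
  refine norm_clm_le_of_single (by positivity) fun j => ?_
  refine norm_clm_le_of_single (by positivity) fun k => ?_
  refine norm_clm_le_of_single M.2 fun l => ?_
  have := abs_parabolicDeriv_le hw hs hx ht ![i, j, k, l]
  rw [parabolicDeriv_four hK s (subset_closure hx)] at this
  simpa using this

/-! ### Joint continuity and time derivatives of the nested derivatives -/

lemma MemParabolicC.continuousOn_timeSlice (hw : MemParabolicC 4 Ω T w) {s : ℕ}
    (hs : 2 * s ≤ 4) :
    ContinuousOn (fun p : EuclideanSpace ℝ (Fin n) × ℝ => timeSlice T s w p.2 p.1)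
      (closedCylinder Ω T) := by
  have h := hw.continuousOn 0 s (by omega)
  have h2 : ContinuousOn (fun p : EuclideanSpace ℝ (Fin n) × ℝ =>
      parabolicDeriv Ω T 0 s w p.1 p.2 Fin.elim0) (closedCylinder Ω T) :=
    (ContinuousMultilinearMap.apply ℝ (fun _ : Fin 0 => EuclideanSpace ℝ (Fin n)) ℝ
      Fin.elim0).continuous.comp_continuousOn h
  exact h2.congr fun p _ => (parabolicDeriv_zero_left s p.1 p.2 _).symm

lemma MemParabolicC.continuousOn_sd1 (hK : UniqueDiffOn ℝ (closure Ω))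
    (hw : MemParabolicC 4 Ω T w) {s : ℕ} (hs : 1 + 2 * s ≤ 4) :
    ContinuousOn (fun p : EuclideanSpace ℝ (Fin n) × ℝ =>
      sd1 (closure Ω) (timeSlice T s w p.2) p.1) (closedCylinder Ω T) := by
  refine continuousOn_clm_apply.2 fun v => ?_
  have h2 : ContinuousOn (fun p : EuclideanSpace ℝ (Fin n) × ℝ =>
      parabolicDeriv Ω T 1 s w p.1 p.2 ![v]) (closedCylinder Ω T) :=
    (ContinuousMultilinearMap.apply ℝ (fun _ : Fin 1 => EuclideanSpace ℝ (Fin n)) ℝ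
      ![v]).continuous.comp_continuousOn (hw.continuousOn 1 s hs)
  exact h2.congr fun p hp => (parabolicDeriv_one hK s hp.1 p.2 ![v]).symm

lemma MemParabolicC.continuousOn_sd2 (hK : UniqueDiffOn ℝ (closure Ω))
    (hw : MemParabolicC 4 Ω T w) {s : ℕ} (hs : 2 + 2 * s ≤ 4) :
    ContinuousOn (fun p : EuclideanSpace ℝ (Fin n) × ℝ =>
      sd2 (closure Ω) (timeSlice T s w p.2) p.1) (closedCylinder Ω T) := by
  refine continuousOn_clm_apply.2 fun v => continuousOn_clm_apply.2 fun v' => ?_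
  have h2 : ContinuousOn (fun p : EuclideanSpace ℝ (Fin n) × ℝ =>
      parabolicDeriv Ω T 2 s w p.1 p.2 ![v, v']) (closedCylinder Ω T) :=
    (ContinuousMultilinearMap.apply ℝ (fun _ : Fin 2 => EuclideanSpace ℝ (Fin n)) ℝ
      ![v, v']).continuous.comp_continuousOn (hw.continuousOn 2 s hs)
  exact h2.congr fun p hp => (parabolicDeriv_two hK s hp.1 p.2 ![v, v']).symm

lemma MemParabolicC.contDiffOn_timeSlice (hw : MemParabolicC 4 Ω T w) {j s : ℕ}
    (hjs : j + 2 * s ≤ 4) {t : ℝ} (ht : t ∈ Icc 0 T) :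
    ContDiffOn ℝ j (timeSlice T s w t) (closure Ω) :=
  hw.contDiffOn_space j s hjs t ht

lemma MemParabolicC.contDiffOn_slice (hw : MemParabolicC 4 Ω T w) {t : ℝ} (ht : t ∈ Icc 0 T) :
    ContDiffOn ℝ (4 : ℕ) (fun y => w y t) (closure Ω) := by
  have := hw.contDiffOn_timeSlice (j := 4) (s := 0) (by omega) ht
  rwa [timeSlice_zero] at this

lemma MemParabolicC.hasDerivWithinAt_time (hw : MemParabolicC 4 Ω T w)
    {x : EuclideanSpace ℝ (Fin n)} (hx : x ∈ closure Ω) {t : ℝ} (ht : t ∈ Icc 0 T) :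
    HasDerivWithinAt (w x) (timeDeriv T w x t) (Icc 0 T) t :=
  ((hw.contDiffOn_time 1 (by omega) x hx t ht).differentiableWithinAt (by simp)).hasDerivWithinAt

/-- `∂_t D w = D w_t` in the interior. -/
lemma MemParabolicC.hasDerivWithinAt_sd1 (hΩ : IsOpen Ω) (hK : UniqueDiffOn ℝ (closure Ω))
    (hw : MemParabolicC 4 Ω T w) {x : EuclideanSpace ℝ (Fin n)} (hx : x ∈ Ω) {t : ℝ}
    (ht : t ∈ Icc 0 T) :
    HasDerivWithinAt (fun r => sd1 (closure Ω) (fun y => w y r) x)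
      (sd1 (closure Ω) (fun y => timeDeriv T w y t) x) (Icc 0 T) t := by
  refine hasDerivWithinAt_fderiv_of_mixed (f := w) (g := timeDeriv T w)
    (f' := fun x r => sd1 (closure Ω) (fun y => w y r) x)
    (g' := fun x r => sd1 (closure Ω) (fun y => timeDeriv T w y r) x) hΩ ?_ ?_ ?_ ?_ hx ht
  · intro y hy r hr
    exact hw.hasDerivWithinAt_time (subset_closure hy) hr
  · intro y hy r hr
    exact (hasFDerivWithinAt_sd1 (m := 3) (hw.contDiffOn_slice hr)
      (subset_closure hy)).hasFDerivAt (closure_mem_nhds hΩ hy)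
  · intro y hy r hr
    have h := hw.contDiffOn_timeSlice (j := 1) (s := 1) (by omega) hr
    rw [timeSlice_one] at h
    exact (hasFDerivWithinAt_sd1 (m := 0) h (subset_closure hy)).hasFDerivAt
      (closure_mem_nhds hΩ hy)
  · have h := hw.continuousOn_sd1 hK (s := 1) (by omega)
    simp only [timeSlice_one] at h
    exact h.mono (prod_mono subset_closure Subset.rfl)

/-- `∂_t D² w = D² w_t` in the interior. -/
lemma MemParabolicC.hasDerivWithinAt_sd2 (hΩ : IsOpen Ω) (hK : UniqueDiffOn ℝ (closure Ω))
    (hw : MemParabolicC 4 Ω T w) {x : EuclideanSpace ℝ (Fin n)} (hx : x ∈ Ω) {t : ℝ}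
    (ht : t ∈ Icc 0 T) :
    HasDerivWithinAt (fun r => sd2 (closure Ω) (fun y => w y r) x)
      (sd2 (closure Ω) (fun y => timeDeriv T w y t) x) (Icc 0 T) t := by
  refine hasDerivWithinAt_fderiv_of_mixed
    (f := fun x r => sd1 (closure Ω) (fun y => w y r) x)
    (g := fun x r => sd1 (closure Ω) (fun y => timeDeriv T w y r) x)
    (f' := fun x r => sd2 (closure Ω) (fun y => w y r) x)
    (g' := fun x r => sd2 (closure Ω) (fun y => timeDeriv T w y r) x) hΩ ?_ ?_ ?_ ?_ hx ht
  · intro y hy r hr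
    exact hw.hasDerivWithinAt_sd1 hΩ hK hy hr
  · intro y hy r hr
    exact (hasFDerivWithinAt_sd2 hK (m := 2) (hw.contDiffOn_slice hr)
      (subset_closure hy)).hasFDerivAt (closure_mem_nhds hΩ hy)
  · intro y hy r hr
    have h := hw.contDiffOn_timeSlice (j := 2) (s := 1) (by omega) hr
    rw [timeSlice_one] at h
    exact (hasFDerivWithinAt_sd2 hK (m := 0) h (subset_closure hy)).hasFDerivAt
      (closure_mem_nhds hΩ hy)
  · have h := hw.continuousOn_sd2 hK (s := 1) (by omega)
    simp only [timeSlice_one] at h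
    exact h.mono (prod_mono subset_closure Subset.rfl)

end ParabolicDerivatives

/-! ### Smooth functions and essential bounds on the closed cylinder -/

section Smooth

variable {E G : Type*} [NormedAddCommGroup E] [NormedSpace ℝ E]
  [NormedAddCommGroup G] [NormedSpace ℝ G] {K : Set E} {I : Set ℝ}

lemma contDiffOn_fderivWithin_left (hK : UniqueDiffOn ℝ K) (hI : UniqueDiffOn ℝ I)
    {F : E → ℝ → G} (hF : ContDiffOn ℝ ((⊤ : ℕ∞) : WithTop ℕ∞) (Function.uncurry F) (K ×ˢ I)) :
    ContDiffOn ℝ ((⊤ : ℕ∞) : WithTop ℕ∞)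
      (Function.uncurry fun x t => fderivWithin ℝ (fun y => F y t) K x) (K ×ˢ I) := by
  have h1 : ContDiffOn ℝ ((⊤ : ℕ∞) : WithTop ℕ∞)
      (fun p : E × ℝ => (fderivWithin ℝ (Function.uncurry F) (K ×ˢ I) p).comp
        (ContinuousLinearMap.inl ℝ E ℝ)) (K ×ˢ I) :=
    (hF.fderivWithin (hK.prod hI) (by simp)).clm_comp contDiffOn_const
  refine h1.congr fun p hp => ?_
  obtain ⟨x, t⟩ := p
  have h2 : HasFDerivWithinAt (Function.uncurry F)
      (fderivWithin ℝ (Function.uncurry F) (K ×ˢ I) (x, t)) (K ×ˢ I) (x, t) :=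
    ((hF _ hp).differentiableWithinAt (by simp)).hasFDerivWithinAt
  have h3 : HasFDerivWithinAt (fun y : E => (y, t)) (ContinuousLinearMap.inl ℝ E ℝ) K x :=
    (hasFDerivAt_prodMk_left x t).hasFDerivWithinAt
  have hm : MapsTo (fun y : E => (y, t)) K (K ×ˢ I) := fun y hy => ⟨hy, hp.2⟩
  exact (h2.comp x h3 hm).fderivWithin (hK x hp.1)

lemma contDiffOn_derivWithin_right (hK : UniqueDiffOn ℝ K) (hI : UniqueDiffOn ℝ I)
    {F : E → ℝ → G} (hF : ContDiffOn ℝ ((⊤ : ℕ∞) : WithTop ℕ∞) (Function.uncurry F) (K ×ˢ I)) :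
    ContDiffOn ℝ ((⊤ : ℕ∞) : WithTop ℕ∞)
      (Function.uncurry fun x t => derivWithin (F x) I t) (K ×ˢ I) := by
  have h1 : ContDiffOn ℝ ((⊤ : ℕ∞) : WithTop ℕ∞)
      (fun p : E × ℝ => fderivWithin ℝ (Function.uncurry F) (K ×ˢ I) p (0, 1)) (K ×ˢ I) :=
    (hF.fderivWithin (hK.prod hI) (by simp)).clm_apply contDiffOn_const
  refine h1.congr fun p hp => ?_
  obtain ⟨x, t⟩ := p
  have h2 : HasFDerivWithinAt (Function.uncurry F)
      (fderivWithin ℝ (Function.uncurry F) (K ×ˢ I) (x, t)) (K ×ˢ I) (x, t) :=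
    ((hF _ hp).differentiableWithinAt (by simp)).hasFDerivWithinAt
  have h3 : HasDerivWithinAt (fun s : ℝ => (x, s)) ((0 : E), (1 : ℝ)) I t :=
    (hasDerivWithinAt_const t I x).prodMk (hasDerivWithinAt_id t I)
  have hm : MapsTo (fun s : ℝ => (x, s)) I (K ×ˢ I) := fun s hs => ⟨hp.1, hs⟩
  exact (h2.comp_hasDerivWithinAt t h3 hm).derivWithin (hI t hp.2)

lemma contDiffOn_iteratedDerivWithin_right (hK : UniqueDiffOn ℝ K) (hI : UniqueDiffOn ℝ I)
    {F : E → ℝ → G} (hF : ContDiffOn ℝ ((⊤ : ℕ∞) : WithTop ℕ∞) (Function.uncurry F) (K ×ˢ I))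
    (s : ℕ) : ContDiffOn ℝ ((⊤ : ℕ∞) : WithTop ℕ∞)
      (Function.uncurry fun x t => iteratedDerivWithin s (F x) I t) (K ×ˢ I) := by
  induction s with
  | zero => simpa using! hF
  | succ s ih =>
    have := contDiffOn_derivWithin_right hK hI ih
    simpa only [iteratedDerivWithin_succ] using! this

lemma contDiffOn_iteratedFDerivWithin_left (hK : UniqueDiffOn ℝ K) (hI : UniqueDiffOn ℝ I)
    {F : E → ℝ → G} (hF : ContDiffOn ℝ ((⊤ : ℕ∞) : WithTop ℕ∞) (Function.uncurry F) (K ×ˢ I))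
    (j : ℕ) : ContDiffOn ℝ ((⊤ : ℕ∞) : WithTop ℕ∞)
      (Function.uncurry fun x t => iteratedFDerivWithin ℝ j (fun y => F y t) K x) (K ×ˢ I) := by
  induction j with
  | zero =>
    simp only [iteratedFDerivWithin_zero_eq_comp]
    exact (ContinuousLinearEquiv.contDiff
      (continuousMultilinearCurryFin0 ℝ E G).symm.toContinuousLinearEquiv).comp_contDiffOn hF
  | succ j ih =>
    have := contDiffOn_fderivWithin_left hK hI ih
    simp only [iteratedFDerivWithin_succ_eq_comp_left]
    exact (ContinuousLinearEquiv.contDiff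
      (continuousMultilinearCurryLeftEquiv ℝ
        (fun _ : Fin (j + 1) => E) G).symm.toContinuousLinearEquiv).comp_contDiffOn this

lemma SmoothOnClosedCylinder.memParabolicC {n : ℕ} {Ω : Set (EuclideanSpace ℝ (Fin n))} {T : ℝ}
    (hT : 0 < T) (hK : UniqueDiffOn ℝ (closure Ω)) {w : EuclideanSpace ℝ (Fin n) → ℝ → ℝ}
    (hw : SmoothOnClosedCylinder Ω T w) (k : ℕ) : MemParabolicC k Ω T w := by
  have hI : UniqueDiffOn ℝ (Icc 0 T) := uniqueDiffOn_Icc hT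
  have hle : ∀ m : ℕ, ((m : ℕ) : WithTop ℕ∞) ≤ ((⊤ : ℕ∞) : WithTop ℕ∞) := fun m => by
    exact_mod_cast le_top
  refine ⟨fun s _ x hx => ?_, fun j s _ t ht => ?_, fun j s _ => ?_⟩
  · exact (hw.comp (contDiffOn_const.prodMk contDiffOn_id)
      (fun t ht => ⟨hx, ht⟩)).of_le (hle s)
  · exact ((contDiffOn_iteratedDerivWithin_right hK hI hw s).comp
      (contDiffOn_id.prodMk contDiffOn_const) (fun x hx => ⟨hx, ht⟩)).of_le (hle j)
  · exact (contDiffOn_iteratedFDerivWithin_left hK hI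
      (contDiffOn_iteratedDerivWithin_right hK hI hw s) j).continuousOn

/-- An essential bound on a continuous function holds everywhere. -/
lemma norm_le_of_eLpNorm_top_le {n : ℕ} {Ω : Set (EuclideanSpace ℝ (Fin n))} (hΩ : IsOpen Ω)
    {G : Type*} [NormedAddCommGroup G] {T : ℝ} (hT : 0 < T) {g : EuclideanSpace ℝ (Fin n) × ℝ → G}
    (hg : ContinuousOn g (closedCylinder Ω T)) {M : ℝ≥0}
    (hM : eLpNorm g ⊤ (volume.restrict (parabolicCylinder Ω T)) ≤ M)
    {x : EuclideanSpace ℝ (Fin n)} (hx : x ∈ closure Ω) {t : ℝ} (ht : t ∈ Icc 0 T) :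
    ‖g (x, t)‖ ≤ M := by
  set U : Set (EuclideanSpace ℝ (Fin n) × ℝ) := Ω ×ˢ Ioo 0 T with hU
  have hUo : IsOpen U := hΩ.prod isOpen_Ioo
  have hUc : U ⊆ closedCylinder Ω T := prod_mono subset_closure Ioo_subset_Icc_self
  have hUp : U ⊆ parabolicCylinder Ω T := prod_mono Subset.rfl Ioo_subset_Ioc_self
  have hae : ∀ᵐ p ∂(volume.restrict U), ‖g p‖ₑ ≤ M := by
    have h1 : ∀ᵐ p ∂(volume.restrict (parabolicCylinder Ω T)), ‖g p‖ₑ ≤ M := by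
      rw [eLpNorm_exponent_top] at hM
      filter_upwards [ae_le_eLpNormEssSup (f := g)] with p hp using hp.trans hM
    exact ae_restrict_of_ae_restrict_of_subset hUp h1
  have hV : IsOpen (U ∩ g ⁻¹' {y | (M : ℝ) < ‖y‖}) :=
    (hg.mono hUc).isOpen_inter_preimage hUo (isOpen_lt continuous_const continuous_norm)
  have hV0 : volume (U ∩ g ⁻¹' {y | (M : ℝ) < ‖y‖}) = 0 := by
    rw [ae_restrict_iff' hUo.measurableSet] at hae
    refine measure_mono_null ?_ hae
    rintro p ⟨hp, hlt⟩
    simp only [mem_compl_iff, mem_ofPred_eq, not_forall]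
    refine ⟨hp, ?_⟩
    rw [enorm_le_coe, not_le]
    exact_mod_cast hlt
  have hempty := (hV.measure_eq_zero_iff volume).1 hV0
  have hin : ∀ p ∈ U, ‖g p‖ ≤ M := fun p hp => by
    by_contra! hlt
    have : p ∈ U ∩ g ⁻¹' {y | (M : ℝ) < ‖y‖} := ⟨hp, hlt⟩
    rw [hempty] at this
    exact this
  refine norm_le_closure hin (hg (x, t) ⟨hx, ht⟩) hUc ?_
  rw [hU, closure_prod_eq, closure_Ioo hT.ne]
  exact ⟨hx, ht⟩

end Smooth

/-! ### Expansions of functions with four bounded derivatives -/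

section Jets

variable {E : Type*} [NormedAddCommGroup E] [InnerProductSpace ℝ E]

/-- `f` has derivatives `f₁, …, f₄` of order up to four within `K`, all bounded by `C`. -/
structure HasJet (K : Set E) (f : E → ℝ) (f₁ : E → E →L[ℝ] ℝ) (f₂ : E → E →L[ℝ] E →L[ℝ] ℝ)
    (f₃ : E → E →L[ℝ] E →L[ℝ] E →L[ℝ] ℝ) (f₄ : E → E →L[ℝ] E →L[ℝ] E →L[ℝ] E →L[ℝ] ℝ)
    (C : ℝ) : Prop where
  deriv₁ : ∀ x ∈ K, HasFDerivWithinAt f (f₁ x) K x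
  deriv₂ : ∀ x ∈ K, HasFDerivWithinAt f₁ (f₂ x) K x
  deriv₃ : ∀ x ∈ K, HasFDerivWithinAt f₂ (f₃ x) K x
  deriv₄ : ∀ x ∈ K, HasFDerivWithinAt f₃ (f₄ x) K x
  bound₁ : ∀ x ∈ K, ‖f₁ x‖ ≤ C
  bound₂ : ∀ x ∈ K, ‖f₂ x‖ ≤ C
  bound₃ : ∀ x ∈ K, ‖f₃ x‖ ≤ C
  bound₄ : ∀ x ∈ K, ‖f₄ x‖ ≤ C

lemma HasJet.mono {K K' : Set E} {f : E → ℝ} {f₁ : E → E →L[ℝ] ℝ} {f₂ : E → E →L[ℝ] E →L[ℝ] ℝ}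
    {f₃ : E → E →L[ℝ] E →L[ℝ] E →L[ℝ] ℝ} {f₄ : E → E →L[ℝ] E →L[ℝ] E →L[ℝ] E →L[ℝ] ℝ} {C : ℝ}
    (h : HasJet K f f₁ f₂ f₃ f₄ C) (hK : K' ⊆ K) : HasJet K' f f₁ f₂ f₃ f₄ C :=
  ⟨fun x hx => (h.deriv₁ x (hK hx)).mono hK, fun x hx => (h.deriv₂ x (hK hx)).mono hK,
    fun x hx => (h.deriv₃ x (hK hx)).mono hK, fun x hx => (h.deriv₄ x (hK hx)).mono hK,
    fun x hx => h.bound₁ x (hK hx), fun x hx => h.bound₂ x (hK hx),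
    fun x hx => h.bound₃ x (hK hx), fun x hx => h.bound₄ x (hK hx)⟩

lemma abs_apply_le {L : E →L[ℝ] ℝ} {C : ℝ} (h : ‖L‖ ≤ C) (v : E) : |L v| ≤ C * ‖v‖ :=
  L.le_of_opNorm_le h v

lemma abs_apply₂_le {L : E →L[ℝ] E →L[ℝ] ℝ} {C : ℝ} (h : ‖L‖ ≤ C) (v w : E) :
    |L v w| ≤ C * ‖v‖ * ‖w‖ :=
  (L v).le_of_opNorm_le (L.le_of_opNorm_le h v) w

lemma abs_apply₃_le {L : E →L[ℝ] E →L[ℝ] E →L[ℝ] ℝ} {C : ℝ} (h : ‖L‖ ≤ C) (v w z : E) :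
    |L v w z| ≤ C * ‖v‖ * ‖w‖ * ‖z‖ :=
  abs_apply₂_le (L.le_of_opNorm_le h v) w z

lemma inner_sub_smul_self {e : E} (he : ‖e‖ = 1) (X : E) :
    inner ℝ (X - inner ℝ X e • e) e = 0 := by
  rw [inner_sub_left, real_inner_smul_left, real_inner_self_eq_norm_sq, he]
  ring

/-- Pythagoras for the splitting of `X` along and across a unit vector. -/
lemma norm_sq_split {e : E} (he : ‖e‖ = 1) (X : E) :
    ‖X‖ ^ 2 = inner ℝ X e ^ 2 + ‖X - inner ℝ X e • e‖ ^ 2 := by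
  have h : inner ℝ (inner ℝ X e • e) (X - inner ℝ X e • e) = 0 := by
    rw [real_inner_smul_left, real_inner_comm (X - inner ℝ X e • e) e, inner_sub_smul_self he,
      mul_zero]
  have := norm_add_sq_eq_norm_sq_add_norm_sq_of_inner_eq_zero _ _ h
  rw [add_sub_cancel] at this
  rw [sq, this, norm_smul, he, mul_one, Real.norm_eq_abs, abs_mul_abs_self]
  ring

lemma norm_sub_smul_le {e : E} (he : ‖e‖ = 1) (X : E) :
    ‖X - inner ℝ X e • e‖ ≤ ‖X‖ := by
  refine le_of_sq_le_sq ?_ (norm_nonneg _) |>.trans le_rfl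
  nlinarith [norm_sq_split he X, sq_nonneg (inner ℝ X e)]

lemma abs_inner_le {e : E} (he : ‖e‖ = 1) (X : E) : |inner ℝ X e| ≤ ‖X‖ := by
  simpa [he] using abs_real_inner_le_norm X e

/-- Fourth order expansion of `f` at `x₀` in terms of the coordinate `s` of `X = x - x₀` along a
unit vector `e` and of the complementary part `z`, at points where `s² = O(|z|)`. -/
lemma HasJet.abs_sub_le {K : Set E} (hK : Convex ℝ K) {f : E → ℝ} {f₁ : E → E →L[ℝ] ℝ}
    {f₂ : E → E →L[ℝ] E →L[ℝ] ℝ} {f₃ : E → E →L[ℝ] E →L[ℝ] E →L[ℝ] ℝ}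
    {f₄ : E → E →L[ℝ] E →L[ℝ] E →L[ℝ] E →L[ℝ] ℝ} {C : ℝ} (h : HasJet K f f₁ f₂ f₃ f₄ C)
    {x₀ x e z : E} {s R D : ℝ} (hx₀ : x₀ ∈ K) (hx : x ∈ K) (he : ‖e‖ = 1)
    (hX : x - x₀ = s • e + z) (hR : ‖x - x₀‖ ^ 2 ≤ R * ‖z‖) (hs : s ^ 2 ≤ R * ‖z‖)
    (hD : |s| ≤ D) (hz : ‖z‖ ≤ D) :
    |f x - f x₀ - f₁ x₀ (x - x₀) - (1 / 2 * f₂ x₀ e e) * s ^ 2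
      - s * (1 / 2 * (f₂ x₀ e z + f₂ x₀ z e)) - (1 / 6 * f₃ x₀ e e e) * s ^ 3|
      ≤ (C * R ^ 2 + C + 3 * C * R + 4 * C * D) * ‖z‖ ^ 2 := by
  have hC : 0 ≤ C := (norm_nonneg (f₁ x₀)).trans (h.bound₁ x₀ hx₀)
  have hRz : 0 ≤ R * ‖z‖ := (sq_nonneg s).trans hs
  have hD0 : 0 ≤ D := (abs_nonneg s).trans hD
  have hT := taylor_three_le hK h.deriv₁ h.deriv₂ h.deriv₃ h.deriv₄ h.bound₄ hx₀ hx
  rw [Real.norm_eq_abs] at hT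
  simp only [smul_eq_mul] at hT
  have hT4 : C * ‖x - x₀‖ ^ 4 ≤ C * R ^ 2 * ‖z‖ ^ 2 := by
    have : ‖x - x₀‖ ^ 4 ≤ (R * ‖z‖) ^ 2 := by
      calc ‖x - x₀‖ ^ 4 = (‖x - x₀‖ ^ 2) ^ 2 := by ring
        _ ≤ _ := by gcongr
    calc _ ≤ C * (R * ‖z‖) ^ 2 := by gcongr
      _ = _ := by ring
  set X := x - x₀
  have b2 : ∀ v w, |f₂ x₀ v w| ≤ C * ‖v‖ * ‖w‖ := abs_apply₂_le (h.bound₂ x₀ hx₀)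
  have b3 : ∀ u v w, |f₃ x₀ u v w| ≤ C * ‖u‖ * ‖v‖ * ‖w‖ := abs_apply₃_le (h.bound₃ x₀ hx₀)
  have e2 : f₂ x₀ X X = s ^ 2 * f₂ x₀ e e + s * (f₂ x₀ e z + f₂ x₀ z e) + f₂ x₀ z z := by
    rw [hX]
    simp only [map_add, map_smul, add_apply, smul_apply, smul_eq_mul]
    ring
  have e3 : f₃ x₀ X X X = s ^ 3 * f₃ x₀ e e e
      + s ^ 2 * (f₃ x₀ e e z + f₃ x₀ e z e + f₃ x₀ z e e)
      + s * (f₃ x₀ e z z + f₃ x₀ z e z + f₃ x₀ z z e) + f₃ x₀ z z z := by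
    rw [hX]
    simp only [map_add, map_smul, add_apply, smul_apply, smul_eq_mul]
    ring
  have c1 := b2 z z
  have c2 : |f₃ x₀ e e z + f₃ x₀ e z e + f₃ x₀ z e e| ≤ 3 * C * ‖z‖ := by
    have h1 := b3 e e z
    have h2 := b3 e z e
    have h3 := b3 z e e
    simp only [he, mul_one] at h1 h2 h3
    calc _ ≤ |f₃ x₀ e e z| + |f₃ x₀ e z e| + |f₃ x₀ z e e| := abs_add_three _ _ _
      _ ≤ _ := by linarith
  have c3 : |f₃ x₀ e z z + f₃ x₀ z e z + f₃ x₀ z z e| ≤ 3 * C * ‖z‖ ^ 2 := by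
    have h1 := b3 e z z
    have h2 := b3 z e z
    have h3 := b3 z z e
    simp only [he, mul_one] at h1 h2 h3
    calc _ ≤ |f₃ x₀ e z z| + |f₃ x₀ z e z| + |f₃ x₀ z z e| := abs_add_three _ _ _
      _ ≤ _ := by nlinarith
  have c4 : |f₃ x₀ z z z| ≤ C * D * ‖z‖ ^ 2 := by
    calc _ ≤ C * ‖z‖ * ‖z‖ * ‖z‖ := b3 z z z
      _ = C * ‖z‖ * ‖z‖ ^ 2 := by ring
      _ ≤ _ := by gcongr
  have c2' : |s ^ 2 * (f₃ x₀ e e z + f₃ x₀ e z e + f₃ x₀ z e e)| ≤ 3 * C * R * ‖z‖ ^ 2 := by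
    rw [abs_mul, abs_of_nonneg (sq_nonneg s)]
    calc _ ≤ (R * ‖z‖) * (3 * C * ‖z‖) := by gcongr
      _ = _ := by ring
  have c3' : |s * (f₃ x₀ e z z + f₃ x₀ z e z + f₃ x₀ z z e)| ≤ 3 * C * D * ‖z‖ ^ 2 := by
    rw [abs_mul]
    calc _ ≤ D * (3 * C * ‖z‖ ^ 2) := by gcongr
      _ = _ := by ring
  have c1' : |f₂ x₀ z z| ≤ C * ‖z‖ ^ 2 := by rw [sq, ← mul_assoc]; exact c1
  rw [e2, e3] at hT
  have n1 : 0 ≤ C * ‖z‖ ^ 2 := by positivity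
  have n2 : 0 ≤ C * R * ‖z‖ ^ 2 := by
    calc 0 ≤ C * (R * ‖z‖) * ‖z‖ := by positivity
      _ = _ := by ring
  have n3 : 0 ≤ C * D * ‖z‖ ^ 2 := by positivity
  have hT' := hT.trans hT4
  clear hT hT4 c1 c2 c3 e2 e3 b2 b3
  rw [abs_le] at hT' c1' c2' c3' c4 ⊢
  obtain ⟨hT1, hT2⟩ := hT'
  constructor <;> linarith [c1'.1, c1'.2, c2'.1, c2'.2, c3'.1, c3'.2, c4.1, c4.2]

end Jets

section ScalarExpansion

/-- Elimination of `s²` and `s³` from the expansion of `F` by means of the boundary relation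
`p y = α s² + s Lρ + Bρ s³ + O(ζ²)`. -/
lemma abs_eliminated_le {p y α s Lρ Bρ F A Lf Bf ζ C C₁ R D α₀ : ℝ} (hα₀ : 0 < α₀) (hα : α₀ ≤ α)
    (hC : 0 ≤ C) (hR : 0 ≤ R)
    (hρ : |p * y - α * s ^ 2 - s * Lρ - Bρ * s ^ 3| ≤ C₁ * ζ ^ 2)
    (hF : |F - A * s ^ 2 - s * Lf - Bf * s ^ 3| ≤ C₁ * ζ ^ 2)
    (hLρ : |Lρ| ≤ C * ζ) (hA : |A| ≤ C) (hBρ : |Bρ| ≤ C) (hBf : |Bf| ≤ C)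
    (hs : s ^ 2 ≤ R * ζ) (hsD : |s| ≤ D) (hζ : 0 ≤ ζ) :
    |F - A * p / α * y - s * (Lf - A / α * Lρ + (Bf - A * Bρ / α) * (p / α) * y)|
      ≤ (C₁ + C / α₀ * C₁ + (C + C * C / α₀) * ((D * C₁ + R * C + C * R ^ 2) / α₀))
        * ζ ^ 2 := by
  have hαpos : 0 < α := hα₀.trans_le hα
  set e1 := p * y - α * s ^ 2 - s * Lρ - Bρ * s ^ 3 with he1
  set e2 := F - A * s ^ 2 - s * Lf - Bf * s ^ 3 with he2
  have hid : F - A * p / α * y - s * (Lf - A / α * Lρ + (Bf - A * Bρ / α) * (p / α) * y)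
      = e2 - A / α * e1
        - (Bf - A * Bρ / α) * ((s * e1 + s ^ 2 * Lρ + Bρ * (s ^ 2) ^ 2) / α) := by
    rw [he1, he2]
    field_simp
    ring
  rw [hid]
  have t1 : |A / α| ≤ C / α₀ := by
    rw [abs_div, abs_of_pos hαpos]
    gcongr
  have t2 : |Bf - A * Bρ / α| ≤ C + C * C / α₀ := by
    calc _ ≤ |Bf| + |A * Bρ / α| := abs_sub _ _
      _ ≤ _ := by
        rw [abs_div, abs_mul, abs_of_pos hαpos]
        gcongr
  have hD : 0 ≤ D := (abs_nonneg s).trans hsD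
  have hζ2 : 0 ≤ C₁ * ζ ^ 2 := (abs_nonneg _).trans hρ
  have t3 : |(s * e1 + s ^ 2 * Lρ + Bρ * (s ^ 2) ^ 2) / α|
      ≤ (D * C₁ + R * C + C * R ^ 2) / α₀ * ζ ^ 2 := by
    rw [abs_div, abs_of_pos hαpos]
    have u1 : |s * e1| ≤ D * (C₁ * ζ ^ 2) := by rw [abs_mul]; gcongr
    have u2 : |s ^ 2 * Lρ| ≤ (R * ζ) * (C * ζ) := by
      rw [abs_mul, abs_of_nonneg (sq_nonneg s)]; gcongr
    have u3 : |Bρ * (s ^ 2) ^ 2| ≤ C * (R * ζ) ^ 2 := by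
      rw [abs_mul, abs_of_nonneg (sq_nonneg (s ^ 2))]; gcongr
    have u : |s * e1 + s ^ 2 * Lρ + Bρ * (s ^ 2) ^ 2| ≤ (D * C₁ + R * C + C * R ^ 2) * ζ ^ 2 := by
      calc _ ≤ _ := abs_add_three _ _ _
        _ ≤ D * (C₁ * ζ ^ 2) + (R * ζ) * (C * ζ) + C * (R * ζ) ^ 2 := by gcongr
        _ = _ := by ring
    calc _ ≤ (D * C₁ + R * C + C * R ^ 2) * ζ ^ 2 / α₀ := by
          apply div_le_div₀ ((abs_nonneg _).trans u) u hα₀ hα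
      _ = _ := by ring
  calc _ ≤ |e2| + |A / α * e1|
      + |(Bf - A * Bρ / α) * ((s * e1 + s ^ 2 * Lρ + Bρ * (s ^ 2) ^ 2) / α)| :=
        (abs_sub _ _).trans (by gcongr; exact abs_sub _ _)
    _ ≤ C₁ * ζ ^ 2 + C / α₀ * (C₁ * ζ ^ 2)
      + (C + C * C / α₀) * ((D * C₁ + R * C + C * R ^ 2) / α₀ * ζ ^ 2) := by
        rw [abs_mul, abs_mul]
        gcongr
    _ = _ := by ring

end ScalarExpansion

/-! ### Geometry of uniformly convex domains -/

section BoundaryGeometry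

lemma inter_frontier_nonempty {X : Type*} [TopologicalSpace X] {c s : Set X}
    (hc : IsPreconnected c) (h₁ : (c ∩ s).Nonempty) (h₂ : (c ∩ sᶜ).Nonempty) :
    (c ∩ frontier s).Nonempty := by
  by_contra hcon
  rw [not_nonempty_iff_eq_empty] at hcon
  have hnf : ∀ x ∈ c, x ∉ frontier s := fun x hx hf => by
    have : x ∈ c ∩ frontier s := ⟨hx, hf⟩
    rw [hcon] at this
    exact this
  obtain ⟨x, hx, hxs⟩ := h₁
  obtain ⟨y, hy, hys⟩ := h₂
  obtain ⟨z, -, hz₁, hz₂⟩ := hc (interior s) (closure s)ᶜ isOpen_interior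
    isClosed_closure.isOpen_compl
    (fun z hz => by
      by_cases h : z ∈ closure s
      · exact Or.inl (by_contra fun hi => hnf z hz ⟨h, hi⟩)
      · exact Or.inr h)
    ⟨x, hx, by_contra fun hi => hnf x hx ⟨subset_closure hxs, hi⟩⟩
    ⟨y, hy, fun hcl => hnf y hy ⟨hcl, fun hi => hys (interior_subset hi)⟩⟩
  exact hz₂ (subset_closure (interior_subset hz₁))

variable {E : Type*} [NormedAddCommGroup E] [InnerProductSpace ℝ E]

/-- Quantitative description of a uniformly convex domain by a defining function `ρ`: the
derivatives of `ρ` are bounded on a ball containing a neighbourhood of the domain, and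
`|Dρ| ≥ p₀` and the curvature bound hold on the boundary. The field `N` is the inner unit
normal. -/
structure DefiningFunction (Ω : Set E) (ρ : E → ℝ) (ρ₁ : E → E →L[ℝ] ℝ)
    (ρ₂ : E → E →L[ℝ] E →L[ℝ] ℝ) (ρ₃ : E → E →L[ℝ] E →L[ℝ] E →L[ℝ] ℝ)
    (ρ₄ : E → E →L[ℝ] E →L[ℝ] E →L[ℝ] E →L[ℝ] ℝ) (N : E → E) (C D κ p₀ : ℝ) : Prop where
  convex : Convex ℝ Ω
  eq : Ω = {x | ρ x < 0}
  jet : HasJet (Metric.closedBall 0 D) ρ ρ₁ ρ₂ ρ₃ ρ₄ C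
  closure_subset : closure Ω ⊆ Metric.closedBall 0 (D - 1)
  frontier_zero : ∀ x ∈ frontier Ω, ρ x = 0
  κ_pos : 0 < κ
  p₀_pos : 0 < p₀
  le_norm : ∀ x ∈ frontier Ω, p₀ ≤ ‖ρ₁ x‖
  norm_normal : ∀ x ∈ frontier Ω, ‖N x‖ = 1
  fderiv_eq : ∀ x ∈ frontier Ω, ∀ v, ρ₁ x v = -(‖ρ₁ x‖ * inner ℝ v (N x))
  curvature : ∀ x ∈ frontier Ω, ∀ τ, inner ℝ τ (N x) = 0 → κ * ‖ρ₁ x‖ * ‖τ‖ ^ 2 ≤ ρ₂ x τ τ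

namespace DefiningFunction

variable {Ω : Set E} {ρ : E → ℝ} {ρ₁ : E → E →L[ℝ] ℝ}
    {ρ₂ : E → E →L[ℝ] E →L[ℝ] ℝ} {ρ₃ : E → E →L[ℝ] E →L[ℝ] E →L[ℝ] ℝ}
    {ρ₄ : E → E →L[ℝ] E →L[ℝ] E →L[ℝ] E →L[ℝ] ℝ} {N : E → E} {C D κ p₀ : ℝ}

lemma closure_subset_ball (h : DefiningFunction Ω ρ ρ₁ ρ₂ ρ₃ ρ₄ N C D κ p₀) :
    closure Ω ⊆ Metric.closedBall 0 D :=
  h.closure_subset.trans (Metric.closedBall_subset_closedBall (by linarith))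

lemma frontier_subset_ball (h : DefiningFunction Ω ρ ρ₁ ρ₂ ρ₃ ρ₄ N C D κ p₀) :
    frontier Ω ⊆ Metric.closedBall 0 D :=
  frontier_subset_closure.trans h.closure_subset_ball

lemma add_mem_ball (h : DefiningFunction Ω ρ ρ₁ ρ₂ ρ₃ ρ₄ N C D κ p₀) {x v : E}
    (hx : x ∈ closure Ω) (hv : ‖v‖ ≤ 1) : x + v ∈ Metric.closedBall (0 : E) D := by
  have := h.closure_subset hx
  rw [mem_closedBall_zero_iff] at *
  linarith [norm_add_le x v]

lemma nonpos_closure (h : DefiningFunction Ω ρ ρ₁ ρ₂ ρ₃ ρ₄ N C D κ p₀) {x : E}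
    (hx : x ∈ closure Ω) : ρ x ≤ 0 := by
  rw [closure_eq_self_union_frontier] at hx
  rcases hx with hx | hx
  · rw [h.eq] at hx
    exact le_of_lt hx
  · exact (h.frontier_zero x hx).le

lemma norm_sub_le (h : DefiningFunction Ω ρ ρ₁ ρ₂ ρ₃ ρ₄ N C D κ p₀) {x y : E}
    (hx : x ∈ closure Ω) (hy : y ∈ closure Ω) : ‖x - y‖ ≤ 2 * D := by
  have h1 := h.closure_subset_ball hx
  have h2 := h.closure_subset_ball hy
  rw [mem_closedBall_zero_iff] at h1 h2
  linarith [_root_.norm_sub_le x y]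

lemma C_pos (h : DefiningFunction Ω ρ ρ₁ ρ₂ ρ₃ ρ₄ N C D κ p₀) {x : E} (hx : x ∈ frontier Ω) :
    0 < C :=
  h.p₀_pos.trans_le ((h.le_norm x hx).trans (h.jet.bound₁ x (h.frontier_subset_ball hx)))

lemma inner_normal_nonneg (h : DefiningFunction Ω ρ ρ₁ ρ₂ ρ₃ ρ₄ N C D κ p₀) {x₀ x : E}
    (hx₀ : x₀ ∈ frontier Ω) (hx : x ∈ closure Ω) : 0 ≤ inner ℝ (x - x₀) (N x₀) := by
  have hx₀' := frontier_subset_closure hx₀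
  have hp := h.p₀_pos.trans_le (h.le_norm x₀ hx₀)
  -- `ρ ≤ 0` along the segment, so the derivative of `ρ` along it is nonpositive
  have key : ∀ s ∈ Ioc (0 : ℝ) 1, ρ₁ x₀ (x - x₀) ≤ C * ‖x - x₀‖ ^ 2 * s := by
    intro s hs
    have hm : x₀ + s • (x - x₀) ∈ closure Ω :=
      h.convex.closure.add_smul_sub_mem hx₀' hx ⟨hs.1.le, hs.2⟩
    have hT := taylor_one_le (convex_closedBall 0 D) h.jet.deriv₁ h.jet.deriv₂ h.jet.bound₂
      (h.closure_subset_ball hx₀') (h.closure_subset_ball hm)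
    rw [add_sub_cancel_left, norm_smul, Real.norm_of_nonneg hs.1.le, map_smul, smul_eq_mul,
      h.frontier_zero x₀ hx₀, Real.norm_eq_abs] at hT
    have h1 := (abs_le.1 hT).1
    have h2 := h.nonpos_closure hm
    have h3 : s * ρ₁ x₀ (x - x₀) ≤ s * (C * ‖x - x₀‖ ^ 2 * s) := by nlinarith
    exact le_of_mul_le_mul_left h3 hs.1
  have h0 := nonpos_of_le_mul one_pos key
  rw [h.fderiv_eq x₀ hx₀] at h0
  nlinarith

/-- On the boundary the normal coordinate is quadratically small. -/
lemma abs_inner_normal_le (h : DefiningFunction Ω ρ ρ₁ ρ₂ ρ₃ ρ₄ N C D κ p₀) {x₀ x : E}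
    (hx₀ : x₀ ∈ frontier Ω) (hx : x ∈ frontier Ω) :
    |inner ℝ (x - x₀) (N x₀)| ≤ C / p₀ * ‖x - x₀‖ ^ 2 := by
  have hT := taylor_one_le (convex_closedBall 0 D) h.jet.deriv₁ h.jet.deriv₂ h.jet.bound₂
    (h.frontier_subset_ball hx₀) (h.frontier_subset_ball hx)
  rw [h.frontier_zero x₀ hx₀, h.frontier_zero x hx, h.fderiv_eq x₀ hx₀, Real.norm_eq_abs,
    sub_zero, zero_sub, neg_neg, abs_mul, abs_norm] at hT
  have hp := h.le_norm x₀ hx₀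
  have := h.p₀_pos
  rw [div_mul_eq_mul_div, le_div_iff₀ this, mul_comm]
  exact le_trans (by gcongr) hT

/-- The enclosing ball property near a boundary point: there the second order Taylor expansion of
`ρ` is dominated by the curvature term. -/
lemma exists_enclosing_near (h : DefiningFunction Ω ρ ρ₁ ρ₂ ρ₃ ρ₄ N C D κ p₀) (hC : 0 < C) :
    ∃ r R : ℝ, 0 < r ∧ 0 < R ∧ ∀ x₀ ∈ frontier Ω, ∀ x ∈ closure Ω, ‖x - x₀‖ ≤ r →
      ‖x - x₀‖ ^ 2 ≤ R * inner ℝ (x - x₀) (N x₀) := by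
  have hκ := h.κ_pos
  have hp₀ := h.p₀_pos
  set r : ℝ := min 1 (κ * p₀ / (4 * C)) with hr
  have hr0 : 0 < r := lt_min one_pos (by positivity)
  have hr1 : r ≤ 1 := min_le_left _ _
  have hrC : C * r ≤ κ * p₀ / 4 := by
    have : r ≤ κ * p₀ / (4 * C) := min_le_right _ _
    calc C * r ≤ C * (κ * p₀ / (4 * C)) := by gcongr
      _ = _ := by field_simp
  set R₁ : ℝ := 16 * C / (κ * p₀) + 1 with hR₁
  have hR₁0 : 0 < R₁ := by positivity
  refine ⟨r, R₁, hr0, hR₁0, ?_⟩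
  intro x₀ hx₀ x hx hxr
  have hT := taylor_two_le (convex_closedBall 0 D) h.jet.deriv₁ h.jet.deriv₂ h.jet.deriv₃
    h.jet.bound₃ (h.frontier_subset_ball hx₀) (h.closure_subset_ball hx)
  rw [h.frontier_zero x₀ hx₀, h.fderiv_eq x₀ hx₀, Real.norm_eq_abs, smul_eq_mul] at hT
  have hN := h.norm_normal x₀ hx₀
  have hy0 := h.inner_normal_nonneg hx₀ hx
  have hyX := (abs_le.1 (abs_inner_le hN (x - x₀))).2
  have hsplit := norm_sq_split hN (x - x₀)
  have hwX := norm_sub_smul_le hN (x - x₀)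
  have hwN := inner_sub_smul_self hN (x - x₀)
  have hρ := h.nonpos_closure hx
  have hp := h.le_norm x₀ hx₀
  have hpC := h.jet.bound₁ x₀ (h.frontier_subset_ball hx₀)
  have b2 : ∀ v w, |ρ₂ x₀ v w| ≤ C * ‖v‖ * ‖w‖ :=
    abs_apply₂_le (h.jet.bound₂ x₀ (h.frontier_subset_ball hx₀))
  generalize hX : x - x₀ = X at *
  generalize hy : inner ℝ X (N x₀) = y at *
  have hXw : X = (X - y • N x₀) + y • N x₀ := by abel
  generalize hw : X - y • N x₀ = w at *
  have hcur := h.curvature x₀ hx₀ w hwN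
  have e2 : ρ₂ x₀ X X = ρ₂ x₀ w w + y * (ρ₂ x₀ w (N x₀) + ρ₂ x₀ (N x₀) w)
      + y ^ 2 * ρ₂ x₀ (N x₀) (N x₀) := by
    rw [hXw]
    simp only [map_add, map_smul, add_apply, smul_apply, smul_eq_mul]
    ring
  have q1 := (abs_le.1 (b2 w (N x₀))).1
  have q2 := (abs_le.1 (b2 (N x₀) w)).1
  have q3 := (abs_le.1 (b2 (N x₀) (N x₀))).1
  rw [hN] at q1 q2 q3
  have hlow := (abs_le.1 hT).1
  have hw1 : ‖w‖ ≤ 1 := hwX.trans (hxr.trans hr1)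
  have hy1 : y ≤ 1 := hyX.trans (hxr.trans hr1)
  have hX3 : ‖X‖ ^ 3 ≤ r * (‖w‖ ^ 2 + y ^ 2) := by
    calc ‖X‖ ^ 3 = ‖X‖ * ‖X‖ ^ 2 := by ring
      _ ≤ r * ‖X‖ ^ 2 := by gcongr
      _ = _ := by rw [hsplit]; ring
  have hyy : y ^ 2 ≤ y := by nlinarith
  have m1 : y * (ρ₂ x₀ w (N x₀) + ρ₂ x₀ (N x₀) w) ≥ -(2 * C * y) := by
    have : ρ₂ x₀ w (N x₀) + ρ₂ x₀ (N x₀) w ≥ -(2 * C) := by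
      have := mul_le_mul_of_nonneg_left hw1 hC.le
      linarith
    nlinarith
  have m2 : y ^ 2 * ρ₂ x₀ (N x₀) (N x₀) ≥ -(C * y) := by nlinarith
  have m3 : C * ‖X‖ ^ 3 ≤ κ * p₀ / 4 * ‖w‖ ^ 2 + C * y := by
    calc C * ‖X‖ ^ 3 ≤ C * (r * (‖w‖ ^ 2 + y ^ 2)) := by gcongr
      _ = (C * r) * ‖w‖ ^ 2 + C * (r * y ^ 2) := by ring
      _ ≤ κ * p₀ / 4 * ‖w‖ ^ 2 + C * y := by
        have : r * y ^ 2 ≤ y := by nlinarith [sq_nonneg y]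
        gcongr
  have m4 : κ * p₀ * ‖w‖ ^ 2 ≤ ρ₂ x₀ w w := by
    refine le_trans ?_ hcur
    gcongr
  have m5 : ‖ρ₁ x₀‖ * y ≤ C * y := by gcongr
  have hfin : κ * p₀ / 4 * ‖w‖ ^ 2 ≤ 4 * C * y := by
    rw [e2] at hlow
    linarith [mul_nonneg hC.le hy0]
  have : ‖w‖ ^ 2 ≤ 16 * C / (κ * p₀) * y := by
    rw [div_mul_eq_mul_div, le_div_iff₀ (by positivity)]
    linarith
  rw [hsplit, hR₁, add_mul]
  linarith

/-- The enclosing ball property of a uniformly convex domain. -/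
lemma exists_enclosing (h : DefiningFunction Ω ρ ρ₁ ρ₂ ρ₃ ρ₄ N C D κ p₀) :
    ∃ R : ℝ, 0 < R ∧ ∀ x₀ ∈ frontier Ω, ∀ x ∈ closure Ω,
      ‖x - x₀‖ ^ 2 ≤ R * inner ℝ (x - x₀) (N x₀) := by
  rcases (frontier Ω).eq_empty_or_nonempty with hem | ⟨x₁, hx₁⟩
  · exact ⟨1, one_pos, by simp [hem]⟩
  have hD : 0 ≤ D := by
    have := h.norm_sub_le (frontier_subset_closure hx₁) (frontier_subset_closure hx₁)
    simp at this
    linarith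
  obtain ⟨r, R₁, hr0, hR₁0, hnear⟩ := h.exists_enclosing_near (h.C_pos hx₁)
  refine ⟨R₁ + 2 * D * R₁ / r, by positivity, fun x₀ hx₀ x hx => ?_⟩
  have hy0 := h.inner_normal_nonneg hx₀ hx
  have hDR : 0 ≤ 2 * D * R₁ / r * inner ℝ (x - x₀) (N x₀) := by positivity
  rcases le_or_gt ‖x - x₀‖ r with hle | hgt
  · have := hnear x₀ hx₀ x hx hle
    rw [add_mul]
    linarith
  · -- pull `x` back along the segment to distance `r` of `x₀`
    have hXpos : 0 < ‖x - x₀‖ := hr0.trans hgt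
    set s := r / ‖x - x₀‖ with hs
    have hs0 : 0 < s := by positivity
    have hs1 : s ≤ 1 := (div_le_one hXpos).2 hgt.le
    have hm : x₀ + s • (x - x₀) ∈ closure Ω :=
      h.convex.closure.add_smul_sub_mem (frontier_subset_closure hx₀) hx ⟨hs0.le, hs1⟩
    have hsn : ‖x₀ + s • (x - x₀) - x₀‖ = r := by
      rw [add_sub_cancel_left, norm_smul, Real.norm_of_nonneg hs0.le, hs]
      field_simp
    have h1 := hnear x₀ hx₀ _ hm hsn.le
    rw [hsn, add_sub_cancel_left, real_inner_smul_left] at h1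
    have h2 : r * ‖x - x₀‖ ≤ R₁ * inner ℝ (x - x₀) (N x₀) := by
      have : r ^ 2 * ‖x - x₀‖ ≤ r * (R₁ * inner ℝ (x - x₀) (N x₀)) := by
        calc r ^ 2 * ‖x - x₀‖ ≤ R₁ * (s * inner ℝ (x - x₀) (N x₀)) * ‖x - x₀‖ := by gcongr
          _ = _ := by rw [hs]; field_simp
      rw [sq, mul_assoc] at this
      exact le_of_mul_le_mul_left this hr0
    have h3 := h.norm_sub_le hx (frontier_subset_closure hx₀)
    have h4 : ‖x - x₀‖ ^ 2 ≤ 2 * D * R₁ / r * inner ℝ (x - x₀) (N x₀) := by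
      calc ‖x - x₀‖ ^ 2 ≤ 2 * D * ‖x - x₀‖ := by rw [sq]; gcongr
        _ = 2 * D / r * (r * ‖x - x₀‖) := by field_simp
        _ ≤ 2 * D / r * (R₁ * inner ℝ (x - x₀) (N x₀)) := by gcongr
        _ = _ := by ring
    rw [add_mul]
    have : 0 ≤ R₁ * inner ℝ (x - x₀) (N x₀) := by positivity
    linarith

/-- Points at a small fixed distance along the inner normal lie in the domain. -/
lemma exists_inward (h : DefiningFunction Ω ρ ρ₁ ρ₂ ρ₃ ρ₄ N C D κ p₀) :
    ∃ r : ℝ, 0 < r ∧ ∀ x₀ ∈ frontier Ω, ∀ s ∈ Ioc 0 r, x₀ + s • N x₀ ∈ Ω := by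
  rcases (frontier Ω).eq_empty_or_nonempty with hem | ⟨x₁, hx₁⟩
  · exact ⟨1, one_pos, by simp [hem]⟩
  have hC := h.C_pos hx₁
  have hp₀ := h.p₀_pos
  refine ⟨min 1 (p₀ / (2 * C)), lt_min one_pos (by positivity), fun x₀ hx₀ s hs => ?_⟩
  have hN := h.norm_normal x₀ hx₀
  have hs1 : s ≤ 1 := hs.2.trans (min_le_left _ _)
  have hs2 : s ≤ p₀ / (2 * C) := hs.2.trans (min_le_right _ _)
  have hsC : C * s ≤ p₀ / 2 := by
    calc C * s ≤ C * (p₀ / (2 * C)) := by gcongr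
      _ = _ := by field_simp
  have hns : ‖s • N x₀‖ = s := by rw [norm_smul, hN, mul_one, Real.norm_of_nonneg hs.1.le]
  have hT := taylor_one_le (convex_closedBall 0 D) h.jet.deriv₁ h.jet.deriv₂ h.jet.bound₂
    (h.frontier_subset_ball hx₀)
    (h.add_mem_ball (frontier_subset_closure hx₀) (v := s • N x₀) (by rw [hns]; exact hs1))
  rw [add_sub_cancel_left, hns, h.frontier_zero x₀ hx₀, h.fderiv_eq x₀ hx₀,
    real_inner_smul_left, real_inner_self_eq_norm_sq, hN, Real.norm_eq_abs] at hT
  rw [h.eq]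
  have h1 := (abs_le.1 hT).2
  have hp := h.le_norm x₀ hx₀
  have hs0 := hs.1
  change ρ _ < 0
  nlinarith [mul_pos hp₀ hs0]

/-- Boundary points near `x₀` over each tangential direction. -/
lemma exists_boundary_point (h : DefiningFunction Ω ρ ρ₁ ρ₂ ρ₃ ρ₄ N C D κ p₀) :
    ∃ r A : ℝ, 0 < r ∧ 0 ≤ A ∧ ∀ x₀ ∈ frontier Ω, ∀ e, ‖e‖ = 1 → inner ℝ e (N x₀) = 0 →
      ∀ s ∈ Ioc 0 r, ∃ q, 0 ≤ q ∧ q ≤ A * s ^ 2 ∧ x₀ + (s • e + q • N x₀) ∈ frontier Ω := by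
  rcases (frontier Ω).eq_empty_or_nonempty with hem | ⟨x₁, hx₁⟩
  · exact ⟨1, 0, one_pos, le_rfl, by simp [hem]⟩
  obtain ⟨R, hR, henc⟩ := h.exists_enclosing
  have hC := h.C_pos hx₁
  have hp₀ := h.p₀_pos
  set A : ℝ := 3 * C / p₀ with hA
  have hA0 : 0 < A := by positivity
  refine ⟨min (1 / 2) (1 / A), A, lt_min (by norm_num) (by positivity), hA0.le,
    fun x₀ hx₀ e he heN s hs => ?_⟩
  have hN := h.norm_normal x₀ hx₀
  have hs0 := hs.1
  have hs1 : s ≤ 1 / 2 := hs.2.trans (min_le_left _ _)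
  have hs2 : A * s ≤ 1 := by
    have : s ≤ 1 / A := hs.2.trans (min_le_right _ _)
    rwa [le_div_iff₀ hA0, mul_comm] at this
  set γ : ℝ → E := fun q => x₀ + (s • e + q • N x₀) with hγ
  have hγc : Continuous γ := by fun_prop
  have hout : γ 0 ∉ Ω := by
    intro hin
    have := henc x₀ hx₀ _ (subset_closure hin)
    simp only [hγ, zero_smul, add_zero, add_sub_cancel_left, norm_smul, he,
      real_inner_smul_left, heN, mul_zero, Real.norm_eq_abs, mul_one, sq_abs] at this
    nlinarith
  have hq : A * s ^ 2 ≤ s := by nlinarith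
  have hsq : ‖s • e + (A * s ^ 2) • N x₀‖ ^ 2 = s ^ 2 + (A * s ^ 2) ^ 2 := by
    have h0 : inner ℝ (s • e) ((A * s ^ 2) • N x₀) = 0 := by
      rw [real_inner_smul_left, real_inner_smul_right, heN, mul_zero, mul_zero]
    have := norm_add_sq_eq_norm_sq_add_norm_sq_of_inner_eq_zero _ _ h0
    rw [sq, this, norm_smul, norm_smul, he, hN]
    simp only [mul_one, Real.norm_eq_abs, abs_mul_abs_self]
    ring
  have hin : γ (A * s ^ 2) ∈ Ω := by
    have hle1 : ‖s • e + (A * s ^ 2) • N x₀‖ ≤ 1 := by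
      refine le_of_sq_le_sq ?_ one_pos.le |>.trans le_rfl
      rw [hsq]
      have : 0 ≤ A * s ^ 2 := by positivity
      nlinarith
    have hT := taylor_one_le (convex_closedBall 0 D) h.jet.deriv₁ h.jet.deriv₂ h.jet.bound₂
      (h.frontier_subset_ball hx₀) (h.add_mem_ball (frontier_subset_closure hx₀) hle1)
    rw [add_sub_cancel_left, hsq, h.frontier_zero x₀ hx₀, h.fderiv_eq x₀ hx₀, inner_add_left,
      real_inner_smul_left, real_inner_smul_left, heN, real_inner_self_eq_norm_sq, hN,
      Real.norm_eq_abs] at hT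
    rw [h.eq]
    have h1 := (abs_le.1 hT).2
    have hp := h.le_norm x₀ hx₀
    change ρ _ < 0
    have h2 : p₀ * (A * s ^ 2) ≤ ‖ρ₁ x₀‖ * (A * s ^ 2) := by gcongr
    have h3 : p₀ * (A * s ^ 2) = 3 * C * s ^ 2 := by rw [hA]; field_simp
    have h4 : C * (A * s ^ 2) ^ 2 ≤ C * s ^ 2 := by
      have : 0 ≤ A * s ^ 2 := by positivity
      gcongr
    have h5 : 0 < C * s ^ 2 := by positivity
    linarith
  have hpre : IsPreconnected (γ '' Icc 0 (A * s ^ 2)) :=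
    isPreconnected_Icc.image γ hγc.continuousOn
  have hnn : 0 ≤ A * s ^ 2 := by positivity
  obtain ⟨_, ⟨q, hq', rfl⟩, hfr⟩ := inter_frontier_nonempty hpre
    (s := Ω) ⟨_, ⟨A * s ^ 2, ⟨hnn, le_rfl⟩, rfl⟩, hin⟩ ⟨_, ⟨0, ⟨le_rfl, hnn⟩, rfl⟩, hout⟩
  exact ⟨q, hq'.1, hq'.2, hfr⟩

end DefiningFunction

end BoundaryGeometry

/-! ### Tangential rotations and expansions of boundary values -/

section BoundaryFrames

variable {E : Type*} [NormedAddCommGroup E] [InnerProductSpace ℝ E]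

lemma HasJet.mono_const {K : Set E} {f : E → ℝ} {f₁ : E → E →L[ℝ] ℝ}
    {f₂ : E → E →L[ℝ] E →L[ℝ] ℝ}
    {f₃ : E → E →L[ℝ] E →L[ℝ] E →L[ℝ] ℝ} {f₄ : E → E →L[ℝ] E →L[ℝ] E →L[ℝ] E →L[ℝ] ℝ} {C C' : ℝ}
    (h : HasJet K f f₁ f₂ f₃ f₄ C) (hC : C ≤ C') : HasJet K f f₁ f₂ f₃ f₄ C' :=
  ⟨h.deriv₁, h.deriv₂, h.deriv₃, h.deriv₄, fun x hx => (h.bound₁ x hx).trans hC,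
    fun x hx => (h.bound₂ x hx).trans hC, fun x hx => (h.bound₃ x hx).trans hC,
    fun x hx => (h.bound₄ x hx).trans hC⟩

namespace DefiningFunction

variable [CompleteSpace E] {Ω : Set E} {ρ : E → ℝ} {ρ₁ : E → E →L[ℝ] ℝ}
    {ρ₂ : E → E →L[ℝ] E →L[ℝ] ℝ} {ρ₃ : E → E →L[ℝ] E →L[ℝ] E →L[ℝ] ℝ}
    {ρ₄ : E → E →L[ℝ] E →L[ℝ] E →L[ℝ] E →L[ℝ] ℝ} {N : E → E} {C D κ p₀ : ℝ}

/-- For each tangent vector `τ` at a boundary point `x₀` there is an infinitesimal rotation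
`x ↦ τ + S (x - x₀)`, with `S` skew, that is tangential to the boundary up to second order. -/
lemma exists_rotation (h : DefiningFunction Ω ρ ρ₁ ρ₂ ρ₃ ρ₄ N C D κ p₀) :
    ∃ A : ℝ, 0 ≤ A ∧ ∀ x₀ ∈ frontier Ω, ∀ τ, ‖τ‖ = 1 → inner ℝ τ (N x₀) = 0 →
      ∃ S : E →L[ℝ] E, (∀ v, inner ℝ (S v) v = 0) ∧ ‖S‖ ≤ A ∧
        ∀ x ∈ frontier Ω, |inner ℝ (τ + S (x - x₀)) (N x)| ≤ A * ‖x - x₀‖ ^ 2 := by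
  rcases (frontier Ω).eq_empty_or_nonempty with hem | ⟨x₁, hx₁⟩
  · exact ⟨1, zero_le_one, by simp [hem]⟩
  have hC := h.C_pos hx₁
  have hp₀ := h.p₀_pos
  set A₁ : ℝ := 2 * C / p₀ with hA₁
  set A₂ : ℝ := (C + C * A₁ + C * C / p₀) / p₀ with hA₂
  have hA₁0 : 0 ≤ A₁ := by positivity
  have hA₂0 : 0 ≤ A₂ := by positivity
  refine ⟨A₁ + A₂, by positivity, fun x₀ hx₀ τ hτ hτN => ?_⟩
  have hx₀b := h.frontier_subset_ball hx₀
  have hN := h.norm_normal x₀ hx₀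
  have hp := h.le_norm x₀ hx₀
  have hppos : 0 < ‖ρ₁ x₀‖ := hp₀.trans_le hp
  -- the vector representing `v ↦ D²ρ(v, τ)`
  set c : E := (InnerProductSpace.toDual ℝ E).symm ((ρ₂ x₀).flip τ) with hc
  have hcv : ∀ v, inner ℝ c v = ρ₂ x₀ v τ := fun v => by
    rw [hc, InnerProductSpace.toDual_symm_apply, ContinuousLinearMap.flip_apply]
  have hcn : ‖c‖ ≤ C := by
    rw [hc, LinearIsometryEquiv.norm_map]
    refine ContinuousLinearMap.opNorm_le_bound _ hC.le fun v => ?_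
    rw [ContinuousLinearMap.flip_apply, Real.norm_eq_abs]
    have := abs_apply₂_le (h.jet.bound₂ x₀ hx₀b) v τ
    rwa [hτ, mul_one] at this
  obtain ⟨b, hb⟩ : ∃ b : E, b = ‖ρ₁ x₀‖⁻¹ • c := ⟨_, rfl⟩
  have hbn : ‖b‖ ≤ C / p₀ := by
    rw [hb, norm_smul, norm_inv, norm_norm, inv_mul_eq_div]
    gcongr
  set S : E →L[ℝ] E := (innerSL ℝ b).smulRight (N x₀) - (innerSL ℝ (N x₀)).smulRight b with hS
  have hSv : ∀ v, S v = inner ℝ b v • N x₀ - inner ℝ (N x₀) v • b := fun v => by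
    simp [hS]
  have hSn : ‖S‖ ≤ A₁ := by
    refine ContinuousLinearMap.opNorm_le_bound _ hA₁0 fun v => ?_
    rw [hSv]
    have h1 : |inner ℝ b v| ≤ C / p₀ * ‖v‖ := (abs_real_inner_le_norm b v).trans (by gcongr)
    have h2 : |inner ℝ (N x₀) v| ≤ ‖v‖ := by simpa [hN] using abs_real_inner_le_norm (N x₀) v
    calc _ ≤ ‖inner ℝ b v • N x₀‖ + ‖inner ℝ (N x₀) v • b‖ := _root_.norm_sub_le _ _
      _ = |inner ℝ b v| + |inner ℝ (N x₀) v| * ‖b‖ := by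
        rw [norm_smul, norm_smul, hN, mul_one, Real.norm_eq_abs, Real.norm_eq_abs]
      _ ≤ C / p₀ * ‖v‖ + ‖v‖ * (C / p₀) := by gcongr
      _ = _ := by rw [hA₁]; ring
  refine ⟨S, fun v => ?_, hSn.trans (by linarith), fun x hx => ?_⟩
  · rw [hSv, inner_sub_left, real_inner_smul_left, real_inner_smul_left]
    ring
  have hxb := h.frontier_subset_ball hx
  have hpx := h.le_norm x hx
  have hy := h.abs_inner_normal_le hx₀ hx
  have hT1 := taylor_one_le (convex_closedBall 0 D) h.jet.deriv₂ h.jet.deriv₃ h.jet.bound₃ hx₀b hxb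
  have hT2 := norm_sub_le_of_fderiv_le (convex_closedBall 0 D) h.jet.deriv₂ h.jet.bound₂ hx₀b hxb
  have hX0 : ρ₁ x (τ + S (x - x₀)) = -(‖ρ₁ x‖ * inner ℝ (τ + S (x - x₀)) (N x)) :=
    h.fderiv_eq x hx _
  have hτ0 : ρ₁ x₀ τ = 0 := by rw [h.fderiv_eq x₀ hx₀, hτN, mul_zero, neg_zero]
  set X := x - x₀ with hX
  -- the first order terms cancel by the choice of `S`
  have hlin : ρ₂ x₀ X τ + ρ₁ x₀ (S X) = inner ℝ X (N x₀) * inner ℝ c (N x₀) := by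
    rw [h.fderiv_eq x₀ hx₀, hSv, inner_sub_left, real_inner_smul_left, real_inner_smul_left,
      real_inner_self_eq_norm_sq, hN, ← hcv, hb, real_inner_smul_left, real_inner_smul_left,
      real_inner_comm (N x₀) X]
    field_simp
    ring
  have hexp : ρ₁ x (τ + S X) = (ρ₁ x - ρ₁ x₀ - ρ₂ x₀ X) τ + (ρ₁ x - ρ₁ x₀) (S X)
      + inner ℝ X (N x₀) * inner ℝ c (N x₀) := by
    rw [← hlin, map_add]
    simp only [sub_apply]
    rw [hτ0]
    ring
  have g1 : |(ρ₁ x - ρ₁ x₀ - ρ₂ x₀ X) τ| ≤ C * ‖X‖ ^ 2 := by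
    have := abs_apply_le hT1 τ
    rwa [hτ, mul_one] at this
  have g2 : |(ρ₁ x - ρ₁ x₀) (S X)| ≤ C * A₁ * ‖X‖ ^ 2 := by
    calc _ ≤ C * ‖X‖ * ‖S X‖ := abs_apply_le hT2 (S X)
      _ ≤ C * ‖X‖ * (A₁ * ‖X‖) := by gcongr; exact S.le_of_opNorm_le hSn X
      _ = _ := by ring
  have g3 : |inner ℝ X (N x₀) * inner ℝ c (N x₀)| ≤ C * C / p₀ * ‖X‖ ^ 2 := by
    rw [abs_mul]
    have : |inner ℝ c (N x₀)| ≤ C := (abs_inner_le hN c).trans hcn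
    calc _ ≤ (C / p₀ * ‖X‖ ^ 2) * C := by gcongr
      _ = _ := by ring
  have g : ‖ρ₁ x‖ * |inner ℝ (τ + S X) (N x)| ≤ (C + C * A₁ + C * C / p₀) * ‖X‖ ^ 2 := by
    calc _ = |ρ₁ x (τ + S X)| := by rw [hX0, abs_neg, abs_mul, abs_norm]
      _ ≤ C * ‖X‖ ^ 2 + C * A₁ * ‖X‖ ^ 2 + C * C / p₀ * ‖X‖ ^ 2 := by
        rw [hexp]
        exact (abs_add_three _ _ _).trans (by gcongr)
      _ = _ := by ring
  have hfin : |inner ℝ (τ + S X) (N x)| ≤ A₂ * ‖X‖ ^ 2 := by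
    rw [hA₂, div_mul_eq_mul_div, le_div_iff₀ hp₀, mul_comm]
    exact le_trans (by gcongr) g
  refine hfin.trans ?_
  gcongr
  linarith

/-- The boundary values of a smooth function near `x₀`, after subtracting its linear part and a
multiple `μ` of the normal coordinate that cancels the second order term in the tangential
direction `e`: what remains is bilinear in `⟨X, e⟩` and the complementary part `z` of
`X = x - x₀`, up to `O(|z|²)`. -/
lemma exists_boundary_expansion (h : DefiningFunction Ω ρ ρ₁ ρ₂ ρ₃ ρ₄ N C D κ p₀) (Cf : ℝ) :
    ∃ A : ℝ, 0 ≤ A ∧ ∀ {f : E → ℝ} {f₁ : E → E →L[ℝ] ℝ}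
    {f₂ : E → E →L[ℝ] E →L[ℝ] ℝ} {f₃ : E → E →L[ℝ] E →L[ℝ] E →L[ℝ] ℝ}
    {f₄ : E → E →L[ℝ] E →L[ℝ] E →L[ℝ] E →L[ℝ] ℝ}, HasJet (closure Ω) f f₁ f₂ f₃ f₄ Cf →
    ∀ x₀ ∈ frontier Ω, ∀ e, ‖e‖ = 1 → inner ℝ e (N x₀) = 0 →
    ∃ (μ : ℝ) (a : E), |μ| ≤ A ∧ ‖a‖ ≤ A ∧ inner ℝ a e = 0 ∧ ∀ x ∈ frontier Ω,
      |f x - f x₀ - f₁ x₀ (x - x₀) - μ * inner ℝ (x - x₀) (N x₀)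
        - inner ℝ (x - x₀) e * inner ℝ a (x - x₀ - inner ℝ (x - x₀) e • e)|
        ≤ A * ‖x - x₀ - inner ℝ (x - x₀) e • e‖ ^ 2 := by
  rcases (frontier Ω).eq_empty_or_nonempty with hem | ⟨x₁, hx₁⟩
  · exact ⟨1, zero_le_one, by simp [hem]⟩
  have hCpos := h.C_pos hx₁
  have hp₀ := h.p₀_pos
  have hκ := h.κ_pos
  have hD : 0 ≤ D := by
    have := h.norm_sub_le (frontier_subset_closure hx₁) (frontier_subset_closure hx₁)
    simp at this
    linarith
  obtain ⟨R, hR, henc⟩ := h.exists_enclosing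
  obtain ⟨B, hB⟩ : ∃ B, B = max C Cf := ⟨_, rfl⟩
  have hCB : C ≤ B := hB ▸ le_max_left _ _
  have hB0 : 0 < B := hCpos.trans_le hCB
  set α₀ : ℝ := κ * p₀ / 2 with hα₀
  have hα₀pos : 0 < α₀ := by positivity
  set C₁ : ℝ := B * R ^ 2 + B + 3 * B * R + 4 * B * (2 * D) with hC₁
  have hC₁0 : 0 ≤ C₁ := by positivity
  obtain ⟨A₁, hA₁⟩ : ∃ A : ℝ, A = C₁ + B / α₀ * C₁
    + (B + B * B / α₀) * ((2 * D * C₁ + R * B + B * R ^ 2) / α₀) := ⟨_, rfl⟩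
  obtain ⟨A₂, hA₂⟩ : ∃ A : ℝ, A = B * B / α₀ := ⟨_, rfl⟩
  obtain ⟨A₃, hA₃⟩ : ∃ A : ℝ, A = B + B / α₀ * B + (B + B * B / α₀) * (B / α₀) := ⟨_, rfl⟩
  have hA₁0 : 0 ≤ A₁ := by rw [hA₁]; positivity
  have hA₂0 : 0 ≤ A₂ := by rw [hA₂]; positivity
  have hA₃0 : 0 ≤ A₃ := by rw [hA₃]; positivity
  refine ⟨A₁ + A₂ + A₃, by positivity, ?_⟩
  intro f f₁ f₂ f₃ f₄ hf x₀ hx₀ e he heN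
  have hf' := hf.mono_const (hB ▸ le_max_right C Cf : Cf ≤ B)
  have hρ' := (h.jet.mono h.closure_subset_ball).mono_const hCB
  have hx₀c := frontier_subset_closure hx₀
  have hN := h.norm_normal x₀ hx₀
  have hp := h.le_norm x₀ hx₀
  set p := ‖ρ₁ x₀‖ with hpdef
  have hppos : 0 < p := hp₀.trans_le hp
  have hpB : p ≤ B := hρ'.bound₁ x₀ hx₀c
  set α : ℝ := 1 / 2 * ρ₂ x₀ e e with hα
  have hαle : α₀ ≤ α := by
    have := h.curvature x₀ hx₀ e heN
    rw [he] at this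
    have h2 : κ * p₀ ≤ κ * p := by gcongr
    rw [hα₀, hα]
    linarith
  have hαpos : 0 < α := hα₀pos.trans_le hαle
  have half : ∀ {g₂ : E →L[ℝ] E →L[ℝ] ℝ}, ‖g₂‖ ≤ B → |1 / 2 * g₂ e e| ≤ B := by
    intro g₂ hg
    have := abs_apply₂_le hg e e
    rw [he, mul_one, mul_one] at this
    rw [abs_mul, abs_of_pos (by norm_num : (0 : ℝ) < 1 / 2)]
    linarith
  have sixth : ∀ {g₃ : E →L[ℝ] E →L[ℝ] E →L[ℝ] ℝ}, ‖g₃‖ ≤ B → |1 / 6 * g₃ e e e| ≤ B := by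
    intro g₃ hg
    have := abs_apply₃_le hg e e e
    rw [he, mul_one, mul_one, mul_one] at this
    rw [abs_mul, abs_of_pos (by norm_num : (0 : ℝ) < 1 / 6)]
    linarith
  have mixed : ∀ {g₂ : E →L[ℝ] E →L[ℝ] ℝ}, ‖g₂‖ ≤ B → ∀ z,
      |1 / 2 * (g₂ e z + g₂ z e)| ≤ B * ‖z‖ := by
    intro g₂ hg z
    have h1 := abs_apply₂_le hg e z
    have h2 := abs_apply₂_le hg z e
    rw [he, mul_one] at h1 h2
    rw [abs_mul, abs_of_pos (by norm_num : (0 : ℝ) < 1 / 2)]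
    linarith [abs_add_le (g₂ e z) (g₂ z e)]
  have hA := half (hf'.bound₂ x₀ hx₀c)
  have hBρ := sixth (hρ'.bound₃ x₀ hx₀c)
  have hBf := sixth (hf'.bound₃ x₀ hx₀c)
  have hLf := mixed (hf'.bound₂ x₀ hx₀c)
  have hLρ := mixed (hρ'.bound₂ x₀ hx₀c)
  obtain ⟨Af, hAf⟩ : ∃ a, a = 1 / 2 * f₂ x₀ e e := ⟨_, rfl⟩
  obtain ⟨Bρ, hBρe⟩ : ∃ b, b = 1 / 6 * ρ₃ x₀ e e e := ⟨_, rfl⟩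
  obtain ⟨Bf, hBfe⟩ : ∃ b, b = 1 / 6 * f₃ x₀ e e e := ⟨_, rfl⟩
  rw [← hAf] at hA
  rw [← hBρe] at hBρ
  rw [← hBfe] at hBf
  -- the coefficient of the bilinear term, as a linear functional of `z`
  obtain ⟨ℓ, hℓ⟩ : ∃ ℓ : E →L[ℝ] ℝ, ∀ z, ℓ z = 1 / 2 * (f₂ x₀ e z + f₂ x₀ z e)
      - Af / α * (1 / 2 * (ρ₂ x₀ e z + ρ₂ x₀ z e))
      + (Bf - Af * Bρ / α) * (p / α) * inner ℝ z (N x₀) := by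
    refine ⟨(1 / 2 : ℝ) • (f₂ x₀ e + (f₂ x₀).flip e)
      - (Af / α) • ((1 / 2 : ℝ) • (ρ₂ x₀ e + (ρ₂ x₀).flip e))
      + ((Bf - Af * Bρ / α) * (p / α)) • innerSL ℝ (N x₀), fun z => ?_⟩
    simp only [add_apply, sub_apply, smul_apply, ContinuousLinearMap.flip_apply, smul_eq_mul,
      innerSL_apply_apply, real_inner_comm z (N x₀)]
  have hAα : |Af / α| ≤ B / α₀ := by
    rw [abs_div, abs_of_pos hαpos]; gcongr
  have hℓn : ‖ℓ‖ ≤ A₃ := by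
    refine ContinuousLinearMap.opNorm_le_bound _ hA₃0 fun z => ?_
    rw [hℓ, Real.norm_eq_abs]
    have t1 : |Af / α * (1 / 2 * (ρ₂ x₀ e z + ρ₂ x₀ z e))| ≤ B / α₀ * (B * ‖z‖) := by
      rw [abs_mul]
      exact mul_le_mul hAα (hLρ z) (abs_nonneg _) (by positivity)
    have t2 : |Bf - Af * Bρ / α| ≤ B + B * B / α₀ := by
      have t0 : |Af * Bρ / α| ≤ B * B / α₀ := by
        rw [abs_div, abs_mul, abs_of_pos hαpos]
        gcongr
      exact (abs_sub _ _).trans (add_le_add hBf t0)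
    have t3 : |(Bf - Af * Bρ / α) * (p / α) * inner ℝ z (N x₀)|
        ≤ (B + B * B / α₀) * (B / α₀) * ‖z‖ := by
      rw [abs_mul, abs_mul, abs_div, abs_of_pos hαpos, abs_of_pos hppos]
      exact mul_le_mul (mul_le_mul t2 (by gcongr) (by positivity) (by positivity))
        (abs_inner_le hN z) (abs_nonneg _) (by positivity)
    calc _ ≤ _ := abs_add_le _ _
      _ ≤ B * ‖z‖ + B / α₀ * (B * ‖z‖) + (B + B * B / α₀) * (B / α₀) * ‖z‖ := by
        refine add_le_add ((abs_sub _ _).trans (add_le_add (hLf z) t1)) t3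
      _ = _ := by rw [hA₃]; ring
  set a₀ : E := (InnerProductSpace.toDual ℝ E).symm ℓ with ha₀
  have ha₀v : ∀ z, inner ℝ a₀ z = ℓ z := fun z => by
    rw [ha₀, InnerProductSpace.toDual_symm_apply]
  have ha₀n : ‖a₀‖ ≤ A₃ := by rw [ha₀, LinearIsometryEquiv.norm_map]; exact hℓn
  -- the multiple `Af / α` of the boundary relation `ρ = 0` eliminates the term in `s ^ 2`
  refine ⟨Af * p / α, a₀ - inner ℝ a₀ e • e, ?_, ?_, inner_sub_smul_self he a₀, fun x hx => ?_⟩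
  · have : |Af * p / α| ≤ A₂ := by
      rw [abs_div, abs_mul, abs_of_pos hαpos, abs_of_pos hppos, hA₂]
      gcongr
    linarith
  · have := (norm_sub_smul_le he a₀).trans ha₀n
    linarith
  have hxc := frontier_subset_closure hx
  have hsplit := norm_sq_split he (x - x₀)
  have hzX := norm_sub_smul_le he (x - x₀)
  have hze := inner_sub_smul_self he (x - x₀)
  have hsX := abs_inner_le he (x - x₀)
  have hXD := h.norm_sub_le hxc hx₀c
  have henx := henc x₀ hx₀ x hxc
  have hXs : x - x₀ = inner ℝ (x - x₀) e • e + (x - x₀ - inner ℝ (x - x₀) e • e) := by abel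
  generalize hs : inner ℝ (x - x₀) e = s at *
  generalize hz : x - x₀ - s • e = z at *
  have hyz : inner ℝ (x - x₀) (N x₀) = inner ℝ z (N x₀) := by
    conv_lhs => rw [hXs]
    rw [inner_add_left, real_inner_smul_left, heN, mul_zero, zero_add]
  have hXR : ‖x - x₀‖ ^ 2 ≤ R * ‖z‖ := by
    refine henx.trans ?_
    rw [hyz]
    gcongr
    exact (le_abs_self _).trans (abs_inner_le hN z)
  have hsR : s ^ 2 ≤ R * ‖z‖ := by linarith [sq_nonneg ‖z‖]
  have E1 := hρ'.abs_sub_le h.convex.closure hx₀c hxc he hXs hXR hsR (hsX.trans hXD)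
    (hzX.trans hXD)
  have E2 := hf'.abs_sub_le h.convex.closure hx₀c hxc he hXs hXR hsR (hsX.trans hXD)
    (hzX.trans hXD)
  rw [h.frontier_zero x hx, h.frontier_zero x₀ hx₀, h.fderiv_eq x₀ hx₀, sub_zero, zero_sub,
    neg_neg] at E1
  rw [← hα, ← hBρe] at E1
  rw [← hAf, ← hBfe] at E2
  have hel := abs_eliminated_le hα₀pos hαle hB0.le hR.le E1 E2 (hLρ z) hA hBρ hBf hsR
    (hsX.trans hXD) (norm_nonneg z)
  have hinner : inner ℝ (a₀ - inner ℝ a₀ e • e) z = ℓ z := by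
    rw [inner_sub_left, real_inner_smul_left, real_inner_comm z e, hze, mul_zero, sub_zero, ha₀v]
  rw [hinner, hℓ, ← hyz]
  rw [← hA₁] at hel
  refine hel.trans ?_
  gcongr
  linarith

end DefiningFunction

lemma IsUniformlyConvexDomain.isOpen {n : ℕ} {Ω : Set (EuclideanSpace ℝ (Fin n))}
    (hΩ : IsUniformlyConvexDomain Ω) : IsOpen Ω := by
  obtain ⟨ρ, hρ, rfl, -⟩ := hΩ.smooth_uniformlyConvex_boundary
  exact isOpen_lt hρ.continuous continuous_const

/-- A uniformly convex domain admits a defining function with uniform bounds. -/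
lemma IsUniformlyConvexDomain.exists_definingFunction {n : ℕ}
    {Ω : Set (EuclideanSpace ℝ (Fin n))} (hΩ : IsUniformlyConvexDomain Ω) :
    ∃ ρ ρ₁ ρ₂ ρ₃ ρ₄ N C D κ p₀, DefiningFunction Ω ρ ρ₁ ρ₂ ρ₃ ρ₄ N C D κ p₀ := by
  obtain ⟨ρ, hρ, hΩρ, hne, κ, hκ, hcurv⟩ := hΩ.smooth_uniformlyConvex_boundary
  have hd : ∀ m : ℕ, ContDiff ℝ m ρ := fun m => hρ.of_le (by exact_mod_cast le_top)
  have c1 : ContDiff ℝ (3 : ℕ) (fderiv ℝ ρ) :=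
    (hd 4).fderiv_right (by exact_mod_cast le_rfl)
  have c2 : ContDiff ℝ (2 : ℕ) (fderiv ℝ (fderiv ℝ ρ)) :=
    c1.fderiv_right (by exact_mod_cast le_rfl)
  have c3 : ContDiff ℝ (1 : ℕ) (fderiv ℝ (fderiv ℝ (fderiv ℝ ρ))) :=
    c2.fderiv_right (by exact_mod_cast le_rfl)
  have c4 : Continuous (fderiv ℝ (fderiv ℝ (fderiv ℝ (fderiv ℝ ρ)))) :=
    c3.continuous_fderiv (by simp)
  obtain ⟨D, hD⟩ := hΩ.bounded.closure.subset_closedBall (0 : EuclideanSpace ℝ (Fin n))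
  have hcomp : IsCompact (Metric.closedBall (0 : EuclideanSpace ℝ (Fin n)) (D + 1)) :=
    isCompact_closedBall _ _
  obtain ⟨C₁, hC₁⟩ := hcomp.exists_bound_of_continuousOn c1.continuous.continuousOn
  obtain ⟨C₂, hC₂⟩ := hcomp.exists_bound_of_continuousOn c2.continuous.continuousOn
  obtain ⟨C₃, hC₃⟩ := hcomp.exists_bound_of_continuousOn c3.continuous.continuousOn
  obtain ⟨C₄, hC₄⟩ := hcomp.exists_bound_of_continuousOn
    (f := fderiv ℝ (fderiv ℝ (fderiv ℝ (fderiv ℝ ρ)))) c4.continuousOn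
  have hopen := hΩ.isOpen
  have hfr0 : ∀ x ∈ frontier Ω, ρ x = 0 := by
    intro x hx
    have h1 : ρ x ≤ 0 := by
      have : closure Ω ⊆ {x | ρ x ≤ 0} := by
        refine closure_minimal ?_ (isClosed_le hρ.continuous continuous_const)
        rw [hΩρ]
        intro y hy
        have hy' : ρ y < 0 := hy
        exact hy'.le
      exact this hx.1
    have h2 : ¬ ρ x < 0 := by
      have := hx.2
      rw [hopen.interior_eq, hΩρ] at this
      exact this
    exact le_antisymm h1 (not_lt.1 h2)
  have hfrc : IsCompact (frontier Ω) :=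
    (Metric.isCompact_of_isClosed_isBounded isClosed_frontier
      (hΩ.bounded.closure.subset frontier_subset_closure))
  obtain ⟨p₀, hp₀, hp₀le⟩ : ∃ p₀ : ℝ, 0 < p₀ ∧ ∀ x ∈ frontier Ω, p₀ ≤ ‖fderiv ℝ ρ x‖ := by
    rcases (frontier Ω).eq_empty_or_nonempty with hem | hnef
    · exact ⟨1, one_pos, by simp [hem]⟩
    · obtain ⟨y, hy, hmin⟩ := hfrc.exists_isMinOn hnef c1.continuous.norm.continuousOn
      exact ⟨_, norm_pos_iff.2 (hne y (hfr0 y hy)), fun x hx => hmin hx⟩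
  have hdual : ∀ x v, fderiv ℝ ρ x v
      = inner ℝ v ((InnerProductSpace.toDual ℝ (EuclideanSpace ℝ (Fin n))).symm
        (fderiv ℝ ρ x)) := fun x v => by
    rw [real_inner_comm, InnerProductSpace.toDual_symm_apply]
  have hpos : ∀ x ∈ frontier Ω, 0 < ‖fderiv ℝ ρ x‖ := fun x hx => hp₀.trans_le (hp₀le x hx)
  have hfe : ∀ x ∈ frontier Ω, ∀ v, fderiv ℝ ρ x v = -(‖fderiv ℝ ρ x‖ * inner ℝ v
      (-(‖fderiv ℝ ρ x‖⁻¹ • (InnerProductSpace.toDual ℝ (EuclideanSpace ℝ (Fin n))).symm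
        (fderiv ℝ ρ x)))) := fun x hx v => by
    have := hpos x hx
    rw [inner_neg_right, real_inner_smul_right, ← hdual]
    field_simp
  refine ⟨ρ, fderiv ℝ ρ, fderiv ℝ (fderiv ℝ ρ), fderiv ℝ (fderiv ℝ (fderiv ℝ ρ)),
    fderiv ℝ (fderiv ℝ (fderiv ℝ (fderiv ℝ ρ))),
    fun x => -(‖fderiv ℝ ρ x‖⁻¹ • (InnerProductSpace.toDual ℝ (EuclideanSpace ℝ (Fin n))).symm
      (fderiv ℝ ρ x)), max (max C₁ C₂) (max C₃ C₄), D + 1, κ, p₀, ?_⟩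
  refine ⟨hΩ.convex, hΩρ, ⟨?_, ?_, ?_, ?_, ?_, ?_, ?_, ?_⟩, ?_, hfr0, hκ, hp₀, hp₀le, ?_, hfe, ?_⟩
  · exact fun x _ => ((hd 1).differentiable (by simp) x).hasFDerivAt.hasFDerivWithinAt
  · exact fun x _ => (c1.differentiable (by simp) x).hasFDerivAt.hasFDerivWithinAt
  · exact fun x _ => (c2.differentiable (by simp) x).hasFDerivAt.hasFDerivWithinAt
  · exact fun x _ => (c3.differentiable (by simp) x).hasFDerivAt.hasFDerivWithinAt
  · exact fun x hx => (hC₁ x hx).trans ((le_max_left _ _).trans (le_max_left _ _))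
  · exact fun x hx => (hC₂ x hx).trans ((le_max_right _ _).trans (le_max_left _ _))
  · exact fun x hx => (hC₃ x hx).trans ((le_max_left _ _).trans (le_max_right _ _))
  · exact fun x hx => (hC₄ x hx).trans ((le_max_right _ _).trans (le_max_right _ _))
  · rw [add_sub_cancel_right]
    exact hD
  · intro x hx
    have := hpos x hx
    rw [norm_neg, norm_smul, LinearIsometryEquiv.norm_map, norm_inv, norm_norm]
    field_simp
  · intro x hx τ hτ
    have h0 : fderiv ℝ ρ x τ = 0 := by rw [hfe x hx, hτ, mul_zero, neg_zero]
    have := hcurv x (hfr0 x hx) τ h0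
    rw [iteratedFDeriv_two_apply] at this
    simpa using this

end BoundaryFrames

/-! ### Minimum and maximum principles -/

section MaximumPrinciple

open Filter Topology

/-- If no point of `Ω × (0, T]` is a minimum over the closed cylinder, a lower bound on the
parabolic boundary propagates inside. -/
lemma le_of_no_interior_min {n : ℕ} {Ω : Set (EuclideanSpace ℝ (Fin n))}
    (hb : Bornology.IsBounded Ω) {T : ℝ} {w : EuclideanSpace ℝ (Fin n) → ℝ → ℝ} {m : ℝ}
    (hc : ContinuousOn (fun p : EuclideanSpace ℝ (Fin n) × ℝ => w p.1 p.2) (closedCylinder Ω T))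
    (hbd : ∀ p ∈ parabolicBoundary Ω T, m ≤ w p.1 p.2)
    (hint : ∀ x ∈ Ω, ∀ t ∈ Ioc 0 T,
      ¬ ∀ y ∈ closure Ω, ∀ s ∈ Icc 0 T, w x t ≤ w y s)
    {x : EuclideanSpace ℝ (Fin n)} (hx : x ∈ closure Ω) {t : ℝ} (ht : t ∈ Icc 0 T) :
    m ≤ w x t := by
  have hcomp : IsCompact (closedCylinder Ω T) :=
    (Metric.isCompact_of_isClosed_isBounded isClosed_closure hb.closure).prod isCompact_Icc
  obtain ⟨⟨y, s⟩, ⟨hy, hs⟩, hmin⟩ := hcomp.exists_isMinOn ⟨(x, t), hx, ht⟩ hc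
  have hall : ∀ z ∈ closure Ω, ∀ r ∈ Icc 0 T, w y s ≤ w z r := fun z hz r hr =>
    hmin (show (z, r) ∈ closedCylinder Ω T from ⟨hz, hr⟩)
  refine le_trans ?_ (hall x hx t ht)
  refine hbd (y, s) ?_
  rcases eq_or_lt_of_le hs.1 with h0 | h0
  · exact Or.inl ⟨hy, h0.symm⟩
  · rw [closure_eq_self_union_frontier] at hy
    rcases hy with hy | hy
    · exact absurd hall (hint y hy s ⟨h0, hs.2⟩)
    · exact Or.inr ⟨hy, hs⟩

/-- Elliptic counterpart: an upper bound on the frontier propagates inside if there is no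
interior maximum. -/
lemma ge_of_no_interior_max {E : Type*} [NormedAddCommGroup E] [ProperSpace E] {Ω : Set E}
    (hb : Bornology.IsBounded Ω) {f : E → ℝ} {m : ℝ} (hc : ContinuousOn f (closure Ω))
    (hbd : ∀ x ∈ frontier Ω, f x ≤ m) (hint : ∀ x ∈ Ω, ¬ ∀ y ∈ closure Ω, f y ≤ f x)
    {x : E} (hx : x ∈ closure Ω) : f x ≤ m := by
  have hcomp : IsCompact (closure Ω) :=
    Metric.isCompact_of_isClosed_isBounded isClosed_closure hb.closure
  obtain ⟨y, hy, hmax⟩ := hcomp.exists_isMaxOn ⟨x, hx⟩ hc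
  refine le_trans (hmax hx) ?_
  rw [closure_eq_self_union_frontier] at hy
  rcases hy with hy | hy
  · exact absurd (fun z hz => hmax hz) (hint y hy)
  · exact hbd y hy

end MaximumPrinciple

/-! ### Quadratic polynomials and inward derivatives -/

section Quadratic

variable {E : Type*} [NormedAddCommGroup E] [NormedSpace ℝ E]

/-- Derivative of a quadratic polynomial centred at `x₀`. -/
lemma hasFDerivAt_quadratic (ℓ : E →L[ℝ] ℝ) (b : E →L[ℝ] E →L[ℝ] ℝ) (x₀ x : E) :
    HasFDerivAt (fun y => ℓ (y - x₀) + b (y - x₀) (y - x₀))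
      (ℓ + (b + b.flip) (x - x₀)) x := by
  have h0 : HasFDerivAt (fun y : E => y - x₀) (ContinuousLinearMap.id ℝ E) x :=
    (hasFDerivAt_id x).sub_const x₀
  have h1 : HasFDerivAt (fun y => ℓ (y - x₀)) ℓ x := by
    have := ℓ.hasFDerivAt (x := x - x₀) |>.comp x h0
    rwa [ContinuousLinearMap.comp_id] at this
  have h2 : HasFDerivAt (fun y => b (y - x₀)) b x := by
    have := b.hasFDerivAt (x := x - x₀) |>.comp x h0
    rwa [ContinuousLinearMap.comp_id] at this
  refine h1.add ((h2.clm_apply h0).congr_fderiv ?_)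
  ext v
  simp

lemma hasFDerivAt_fderiv_quadratic (ℓ : E →L[ℝ] ℝ) (b : E →L[ℝ] E →L[ℝ] ℝ) (x₀ x : E) :
    HasFDerivAt (fun y => ℓ + (b + b.flip) (y - x₀)) (b + b.flip) x := by
  have h0 : HasFDerivAt (fun y : E => y - x₀) (ContinuousLinearMap.id ℝ E) x :=
    (hasFDerivAt_id x).sub_const x₀
  have := ((b + b.flip).hasFDerivAt (x := x - x₀) |>.comp x h0).const_add ℓ
  rwa [ContinuousLinearMap.comp_id] at this

/-- At a minimum over a convex set, the derivative in an inward direction is nonnegative. -/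
lemma fderiv_inward_nonneg {K : Set E} (hK : Convex ℝ K) {f : E → ℝ} {f' : E →L[ℝ] ℝ} {x₀ v : E}
    (hf : HasFDerivWithinAt f f' K x₀) (hx₀ : x₀ ∈ K) {r : ℝ} (hr : 0 < r)
    (hv : x₀ + r • v ∈ K) (hmin : ∀ y ∈ K, f x₀ ≤ f y) : 0 ≤ f' v := by
  have hl : IsLocalMinOn f K x₀ := by
    filter_upwards [self_mem_nhdsWithin] with y hy using hmin y hy
  have hcone := mem_posTangentConeAt_of_segment_subset (hK.segment_subset hx₀ hv)
  have h := hl.hasFDerivWithinAt_nonneg hf hcone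
  rw [map_smul, smul_eq_mul] at h
  exact nonneg_of_mul_nonneg_right h hr

/-- A convex function lies above its tangent plane, also at a boundary point. -/
lemma fderivWithin_le_sub_of_convexOn {K : Set E} {f : E → ℝ} {f' : E →L[ℝ] ℝ} {x y : E}
    (hconv : ConvexOn ℝ K f) (hf : HasFDerivWithinAt f f' K x) (hx : x ∈ K) (hy : y ∈ K) :
    f' (y - x) ≤ f y - f x := by
  have hmaps : MapsTo (fun s : ℝ => x + s • (y - x)) (Icc 0 1) K := fun r hr =>
    hconv.1.add_smul_sub_mem hx hy hr
  have hline : HasDerivWithinAt (fun s : ℝ => x + s • (y - x)) (y - x) (Icc 0 1) 0 := by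
    simpa using (((hasDerivAt_id (0 : ℝ)).smul_const (y - x)).const_add x).hasDerivWithinAt
  have hf0 : HasFDerivWithinAt f f' K (x + (0 : ℝ) • (y - x)) := by simpa using hf
  have h1 : HasDerivWithinAt (fun s : ℝ => f (x + s • (y - x))) (f' (y - x)) (Icc 0 1) 0 :=
    hf0.comp_hasDerivWithinAt 0 hline hmaps
  have h2 : HasDerivWithinAt (fun s : ℝ => s * (f y - f x) - f (x + s • (y - x)))
      ((f y - f x) - f' (y - x)) (Icc 0 1) 0 := by
    have := ((hasDerivAt_id (0 : ℝ)).mul_const (f y - f x)).hasDerivWithinAt (s := Icc 0 1)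
    exact (this.sub h1).congr_deriv (by simp)
  have h3 := fderiv_inward_nonneg (convex_Icc (0 : ℝ) 1) (v := (1 : ℝ)) h2.hasFDerivWithinAt
    (left_mem_Icc.2 zero_le_one) one_pos (by simp) (fun s hs => by
      have hc := hconv.2 hx hy (by linarith [hs.2] : 0 ≤ 1 - s) hs.1 (by ring)
      have harg : (1 - s) • x + s • y = x + s • (y - x) := by
        rw [smul_sub, sub_smul, one_smul]; abel
      rw [harg, smul_eq_mul, smul_eq_mul] at hc
      simp only [zero_mul, zero_smul, add_zero, zero_sub]
      linarith)
  simp only [ContinuousLinearMap.toSpanSingleton_apply, one_smul] at h3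
  linarith

end Quadratic

/-! ### The initial-boundary value problem and the lower bound for the determinant -/

section Solutions

variable {n : ℕ}

lemma continuousOn_det_formMatrix {X : Type*} [TopologicalSpace X] {S : Set X}
    {B : X → EuclideanSpace ℝ (Fin n) →L[ℝ] EuclideanSpace ℝ (Fin n) →L[ℝ] ℝ}
    (hB : ContinuousOn B S) : ContinuousOn (fun x => (formMatrix (B x)).det) S := by
  have hm : ContinuousOn (fun x => formMatrix (B x)) S := by
    refine continuousOn_pi.2 fun i => continuousOn_pi.2 fun j => ?_
    exact (hB.clm_apply continuousOn_const).clm_apply continuousOn_const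
  exact (continuous_id.matrix_det).comp_continuousOn hm

/-- The data of the initial-boundary value problem on a bounded convex domain, with one constant
`M` bounding all norms of `φ` and `ψ` that enter the estimates. The bounds on `φ` are those that
the `C̃⁴` norm gives on `Q_T`; they are extended to the closed cylinder where needed. -/
structure SolutionData (Ω : Set (EuclideanSpace ℝ (Fin n))) (T c₀ θ M : ℝ)
    (φ ψ u : EuclideanSpace ℝ (Fin n) → ℝ → ℝ) : Prop where
  isOpen : IsOpen Ω
  convex : Convex ℝ Ω
  bounded : Bornology.IsBounded Ω
  nonempty : Ω.Nonempty
  T_pos : 0 < T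
  c₀_pos : 0 < c₀
  θ_pos : 0 < θ
  φ_mem : MemParabolicC 4 Ω T φ
  ψ_mem : MemParabolicC 4 Ω T ψ
  u_mem : MemParabolicC 4 Ω T u
  lateral : ∀ x ∈ frontier Ω, ∀ t ∈ Icc 0 T, c₀ ≤ timeDeriv T φ x t + ψ x t
  initial : InitiallyUniformlyConvex Ω θ φ
  ψ_concave : ∀ t ∈ Icc 0 T, ConcaveOn ℝ (closure Ω) (fun x => ψ x t)
  u_convex : ∀ t ∈ Icc 0 T, ConvexOn ℝ (closure Ω) (fun x => u x t)
  sol : IsSolution Ω T φ ψ u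
  φ_le : ∀ x ∈ Ω, ∀ t ∈ Ioc 0 T, |φ x t| ≤ M
  φt_le : ∀ x ∈ Ω, ∀ t ∈ Ioc 0 T, |timeDeriv T φ x t| ≤ M
  φ₁_le : ∀ x ∈ Ω, ∀ t ∈ Ioc 0 T, ‖sd1 (closure Ω) (fun y => φ y t) x‖ ≤ M
  φ₂_le : ∀ x ∈ Ω, ∀ t ∈ Ioc 0 T, ‖sd2 (closure Ω) (fun y => φ y t) x‖ ≤ M
  φ₃_le : ∀ x ∈ Ω, ∀ t ∈ Ioc 0 T, ‖sd3 (closure Ω) (fun y => φ y t) x‖ ≤ M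
  φ₄_le : ∀ x ∈ Ω, ∀ t ∈ Ioc 0 T, ‖sd4 (closure Ω) (fun y => φ y t) x‖ ≤ M
  φt₁_le : ∀ x ∈ Ω, ∀ t ∈ Ioc 0 T, ‖sd1 (closure Ω) (fun y => timeDeriv T φ y t) x‖ ≤ M
  ψ_le : ∀ x ∈ closure Ω, ∀ t ∈ Icc 0 T, |ψ x t| ≤ M
  ψ₁_le : ∀ x ∈ closure Ω, ∀ t ∈ Icc 0 T, ‖sd1 (closure Ω) (fun y => ψ y t) x‖ ≤ M

namespace SolutionData

variable {Ω : Set (EuclideanSpace ℝ (Fin n))} {T c₀ θ M : ℝ}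
    {φ ψ u : EuclideanSpace ℝ (Fin n) → ℝ → ℝ}

lemma uniqueDiff (h : SolutionData Ω T c₀ θ M φ ψ u) : UniqueDiffOn ℝ (closure Ω) :=
  uniqueDiffOn_closure h.isOpen h.convex h.nonempty

lemma isCompact_closure (h : SolutionData Ω T c₀ θ M φ ψ u) : IsCompact (closure Ω) :=
  Metric.isCompact_of_isClosed_isBounded isClosed_closure h.bounded.closure

lemma u_slice (h : SolutionData Ω T c₀ θ M φ ψ u) {t : ℝ} (ht : t ∈ Icc 0 T) :
    ContDiffOn ℝ (4 : ℕ) (fun y => u y t) (closure Ω) :=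
  h.u_mem.contDiffOn_slice ht

lemma φ_slice (h : SolutionData Ω T c₀ θ M φ ψ u) {t : ℝ} (ht : t ∈ Icc 0 T) :
    ContDiffOn ℝ (4 : ℕ) (fun y => φ y t) (closure Ω) :=
  h.φ_mem.contDiffOn_slice ht

lemma ψ_slice (h : SolutionData Ω T c₀ θ M φ ψ u) {t : ℝ} (ht : t ∈ Icc 0 T) :
    ContDiffOn ℝ (4 : ℕ) (fun y => ψ y t) (closure Ω) :=
  h.ψ_mem.contDiffOn_slice ht

lemma ut_slice (h : SolutionData Ω T c₀ θ M φ ψ u) {t : ℝ} (ht : t ∈ Icc 0 T) :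
    ContDiffOn ℝ (2 : ℕ) (fun y => timeDeriv T u y t) (closure Ω) := by
  have := h.u_mem.contDiffOn_timeSlice (j := 2) (s := 1) (by omega) ht
  rwa [timeSlice_one] at this

lemma u_symm (h : SolutionData Ω T c₀ θ M φ ψ u) {t : ℝ} (ht : t ∈ Icc 0 T)
    {x : EuclideanSpace ℝ (Fin n)} (hx : x ∈ closure Ω) (v w : EuclideanSpace ℝ (Fin n)) :
    sd2 (closure Ω) (fun y => u y t) x v w = sd2 (closure Ω) (fun y => u y t) x w v :=
  sd2_symm (m := 2) h.uniqueDiff (closure_subset_closure_interior h.isOpen) (h.u_slice ht) hx v w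

lemma u_isHermitian (h : SolutionData Ω T c₀ θ M φ ψ u) {t : ℝ} (ht : t ∈ Icc 0 T)
    {x : EuclideanSpace ℝ (Fin n)} (hx : x ∈ closure Ω) :
    (formMatrix (sd2 (closure Ω) (fun y => u y t) x)).IsHermitian :=
  isHermitian_formMatrix (h.u_symm ht hx)

/-- Interior derivatives of a `C²` slice. -/
lemma hasFDerivAt_of_slice (h : SolutionData Ω T c₀ θ M φ ψ u)
    {f : EuclideanSpace ℝ (Fin n) → ℝ} (hf : ContDiffOn ℝ (2 : ℕ) f (closure Ω))
    {x : EuclideanSpace ℝ (Fin n)} (hx : x ∈ Ω) :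
    (∀ᶠ y in nhds x, HasFDerivAt f (sd1 (closure Ω) f y) y) ∧
      HasFDerivAt (sd1 (closure Ω) f) (sd2 (closure Ω) f x) x := by
  refine ⟨?_, ?_⟩
  · filter_upwards [h.isOpen.mem_nhds hx] with y hy
    exact (hasFDerivWithinAt_sd1 (m := 1) hf (subset_closure hy)).hasFDerivAt
      (closure_mem_nhds h.isOpen hy)
  · exact (hasFDerivWithinAt_sd2 (m := 0) h.uniqueDiff hf (subset_closure hx)).hasFDerivAt
      (closure_mem_nhds h.isOpen hx)

lemma u_nonneg (h : SolutionData Ω T c₀ θ M φ ψ u) {t : ℝ} (ht : t ∈ Icc 0 T)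
    {x : EuclideanSpace ℝ (Fin n)} (hx : x ∈ closure Ω) (v : EuclideanSpace ℝ (Fin n)) :
    0 ≤ sd2 (closure Ω) (fun y => u y t) x v v := by
  refine form_nonneg_closure
    (contDiffOn_sd2 (m := 2) h.uniqueDiff (h.u_slice ht)).continuousOn ?_ hx v
  intro y hy w
  obtain ⟨h1, h2⟩ := h.hasFDerivAt_of_slice ((h.u_slice ht).of_le (by norm_num)) hy
  exact second_fderiv_nonneg_of_convexOn (closure_mem_nhds h.isOpen hy) (h.u_convex t ht) h1 h2 w

lemma ψ_nonpos (h : SolutionData Ω T c₀ θ M φ ψ u) {t : ℝ} (ht : t ∈ Icc 0 T)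
    {x : EuclideanSpace ℝ (Fin n)} (hx : x ∈ Ω) (v : EuclideanSpace ℝ (Fin n)) :
    sd2 (closure Ω) (fun y => ψ y t) x v v ≤ 0 := by
  obtain ⟨h1, h2⟩ := h.hasFDerivAt_of_slice ((h.ψ_slice ht).of_le (by norm_num)) hx
  have := second_fderiv_nonneg_of_convexOn (closure_mem_nhds h.isOpen hx) (h.ψ_concave t ht).neg
    (h1.mono fun y hy => hy.neg) h2.neg v
  simpa using this

/-- The equation, with the Hessian read as a bilinear form, up to the lateral boundary. -/
lemma equation (h : SolutionData Ω T c₀ θ M φ ψ u) {t : ℝ} (ht : t ∈ Ioc 0 T)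
    {x : EuclideanSpace ℝ (Fin n)} (hx : x ∈ closure Ω) :
    (formMatrix (sd2 (closure Ω) (fun y => u y t) x)).det = timeDeriv T u x t + ψ x t := by
  have ht' : t ∈ Icc 0 T := ⟨ht.1.le, ht.2⟩
  have hc : ContinuousOn (fun x => (formMatrix (sd2 (closure Ω) (fun y => u y t) x)).det
      - (timeDeriv T u x t + ψ x t)) (closure Ω) :=
    (continuousOn_det_formMatrix
      (contDiffOn_sd2 (m := 2) h.uniqueDiff (h.u_slice ht')).continuousOn).sub
      ((h.ut_slice ht').continuousOn.add (h.ψ_slice ht').continuousOn)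
  have h0 : ∀ y ∈ Ω, ‖(formMatrix (sd2 (closure Ω) (fun y => u y t) y)).det
      - (timeDeriv T u y t + ψ y t)‖ ≤ 0 := by
    intro y hy
    have := h.sol.equation y hy t ht
    rw [hessian_eq_formMatrix h.uniqueDiff (subset_closure hy)] at this
    rw [norm_le_zero_iff]
    linarith
  have := norm_le_closure h0 (hc x hx) subset_closure hx
  rw [norm_le_zero_iff] at this
  linarith

lemma eq_on_frontier (h : SolutionData Ω T c₀ θ M φ ψ u) {t : ℝ} (ht : t ∈ Icc 0 T)
    {x : EuclideanSpace ℝ (Fin n)} (hx : x ∈ frontier Ω) : u x t = φ x t :=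
  h.sol.boundary (x, t) (Or.inr ⟨hx, ht⟩)

lemma eq_initial (h : SolutionData Ω T c₀ θ M φ ψ u)
    {x : EuclideanSpace ℝ (Fin n)} (hx : x ∈ closure Ω) : u x 0 = φ x 0 :=
  h.sol.boundary (x, 0) (Or.inl ⟨hx, rfl⟩)

lemma sd1_initial (h : SolutionData Ω T c₀ θ M φ ψ u)
    {x : EuclideanSpace ℝ (Fin n)} (hx : x ∈ closure Ω) :
    sd1 (closure Ω) (fun y => u y 0) x = sd1 (closure Ω) (fun y => φ y 0) x :=
  fderivWithin_congr (fun _ hy => h.eq_initial hy) (h.eq_initial hx)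

lemma sd2_initial (h : SolutionData Ω T c₀ θ M φ ψ u)
    {x : EuclideanSpace ℝ (Fin n)} (hx : x ∈ closure Ω) :
    sd2 (closure Ω) (fun y => u y 0) x = sd2 (closure Ω) (fun y => φ y 0) x :=
  fderivWithin_congr (fun _ hy => h.sd1_initial hy) (h.sd1_initial hx)

lemma sd2_initial_ge (h : SolutionData Ω T c₀ θ M φ ψ u)
    {x : EuclideanSpace ℝ (Fin n)} (hx : x ∈ closure Ω) (v : EuclideanSpace ℝ (Fin n)) :
    θ * ‖v‖ ^ 2 ≤ sd2 (closure Ω) (fun y => u y 0) x v v := by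
  have := h.initial x hx v
  rw [iteratedFDerivWithin_two_apply _ h.uniqueDiff hx] at this
  rw [h.sd2_initial hx]
  simpa using this

lemma timeDeriv_frontier (h : SolutionData Ω T c₀ θ M φ ψ u) {t : ℝ} (ht : t ∈ Icc 0 T)
    {x : EuclideanSpace ℝ (Fin n)} (hx : x ∈ frontier Ω) :
    timeDeriv T u x t = timeDeriv T φ x t :=
  derivWithin_congr (fun _ hs => h.eq_on_frontier hs hx) (h.eq_on_frontier ht hx)

/-- `det D²u` is a supersolution of the linearized equation, because `ψ` is concave; hence its
minimum is attained on the parabolic boundary. -/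
lemma le_det (h : SolutionData Ω T c₀ θ M φ ψ u) {t : ℝ} (ht : t ∈ Icc 0 T)
    {x : EuclideanSpace ℝ (Fin n)} (hx : x ∈ closure Ω) :
    min c₀ (θ ^ n) ≤ (formMatrix (sd2 (closure Ω) (fun y => u y t) x)).det := by
  -- a small multiple of `t` makes the differential inequality strict
  have key : ∀ η > 0, min c₀ (θ ^ n)
      ≤ (formMatrix (sd2 (closure Ω) (fun y => u y t) x)).det + η * t := by
    intro η hη
    refine le_of_no_interior_min (w := fun x t =>
      (formMatrix (sd2 (closure Ω) (fun y => u y t) x)).det + η * t) h.bounded ?_ ?_ ?_ hx ht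
    · have hc := h.u_mem.continuousOn_sd2 h.uniqueDiff (s := 0) (by omega)
      simp only [timeSlice_zero] at hc
      exact (continuousOn_det_formMatrix hc).add
        (continuous_const.mul continuous_snd).continuousOn
    · rintro ⟨y, s⟩ (⟨hy, hs⟩ | ⟨hy, hs⟩)
      · have hs0 : s = 0 := hs
        subst hs0
        refine (min_le_right _ _).trans ?_
        have := pow_le_det (h.u_symm ⟨le_rfl, h.T_pos.le⟩ hy) h.θ_pos.le (h.sd2_initial_ge hy)
        simpa using this
      · rcases eq_or_lt_of_le hs.1 with h0 | h0
        · have hs0 : s = 0 := h0.symm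
          subst hs0
          refine (min_le_right _ _).trans ?_
          have := pow_le_det (h.u_symm ⟨le_rfl, h.T_pos.le⟩ (frontier_subset_closure hy))
            h.θ_pos.le (h.sd2_initial_ge (frontier_subset_closure hy))
          simpa using this
        · refine (min_le_left _ _).trans ?_
          have e := h.equation ⟨h0, hs.2⟩ (frontier_subset_closure hy)
          have l := h.lateral y hy s hs
          simp only
          rw [e, h.timeDeriv_frontier hs hy]
          have : 0 ≤ η * s := by positivity
          linarith
    · intro y hy s hs hmin
      have hs' : s ∈ Icc 0 T := ⟨hs.1.le, hs.2⟩
      have hyc := subset_closure hy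
      have hH := h.u_isHermitian hs' hyc
      -- second order condition in space for `u_t + ψ`
      obtain ⟨a1, a2⟩ := h.hasFDerivAt_of_slice (h.ut_slice hs') hy
      obtain ⟨b1, b2⟩ := h.hasFDerivAt_of_slice ((h.ψ_slice hs').of_le (by norm_num)) hy
      have hlm : IsLocalMin (fun z => timeDeriv T u z s + ψ z s) y := by
        filter_upwards [h.isOpen.mem_nhds hy] with z hz
        have := hmin z (subset_closure hz) s hs'
        rw [← h.equation hs hyc, ← h.equation hs (subset_closure hz)]
        linarith
      have hsp := second_fderiv_nonneg_of_isLocalMin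
        (f := fun z => timeDeriv T u z s + ψ z s) (by
          filter_upwards [a1, b1] with z h1 h2 using h1.add h2) (a2.add b2) hlm
      -- first order condition in time
      have hder := (hasDerivWithinAt_det_formMatrix
        (h.u_mem.hasDerivWithinAt_sd2 h.isOpen h.uniqueDiff hy hs') hH).add
          (((hasDerivAt_id s).const_mul η).hasDerivWithinAt)
      have htm := deriv_time_nonpos_of_min hs hder (fun r hr => hmin y hyc r hr)
      have hnn : 0 ≤ ∑ i, diagCofactor hH.eigenvalues i *
          sd2 (closure Ω) (fun z => timeDeriv T u z s) y (hH.eigenvectorBasis i)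
            (hH.eigenvectorBasis i) := by
        refine Finset.sum_nonneg fun i _ => mul_nonneg (diagCofactor_nonneg
          (le_eigenvalue hH (by simpa using h.u_nonneg hs' hyc)) i) ?_
        have h1 := hsp (hH.eigenvectorBasis i)
        have h2 := h.ψ_nonpos hs' hy (hH.eigenvectorBasis i)
        simp only [add_apply] at h1
        linarith
      rw [mul_one] at htm
      linarith
  refine le_of_forall_pos_le_add fun ε hε => ?_
  have hT := h.T_pos
  refine (key (ε / T) (by positivity)).trans ?_
  gcongr
  rw [div_mul_eq_mul_div, div_le_iff₀ hT]
  exact mul_le_mul_of_nonneg_left ht.2 hε.le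

end SolutionData

end Solutions

/-! ### Degenerate quadratic barriers -/

section QuadraticForms

variable {E : Type*} [NormedAddCommGroup E] [InnerProductSpace ℝ E]

lemma exists_form (P : E →L[ℝ] E) (a d : ℝ) : ∃ b : E →L[ℝ] E →L[ℝ] ℝ, ∀ v w,
    b v w = a * inner ℝ v w + d * inner ℝ (P v) (P w) :=
  ⟨a • (innerSL ℝ : E →L[ℝ] E →L[ℝ] ℝ)
    + d • (innerSL ℝ : E →L[ℝ] E →L[ℝ] ℝ).bilinearComp P P, fun _ _ => rfl⟩

/-- Completing the square: along the boundary the quadratic `|x₁ a + B z|² / 2B` dominates the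
mixed term `x₁ ⟨a, z⟩` and the error `A |z|²`, while it degenerates in the direction
`e - a / B`. -/
lemma exists_degenerate_square {e a : E} (he : ‖e‖ = 1) (hae : inner ℝ a e = 0) {A B : ℝ}
    (hA : 0 ≤ A) (ha : ‖a‖ ≤ A) (hB : B = 2 * A + 1) : ∃ (P : E →L[ℝ] E) (k : E), k ≠ 0 ∧
      P k = 0 ∧ (∀ v, ‖P v‖ ^ 2 ≤ (A + B) ^ 2 * ‖v‖ ^ 2) ∧
      ∀ v, inner ℝ v e * inner ℝ a (v - inner ℝ v e • e) + A * ‖v - inner ℝ v e • e‖ ^ 2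
        ≤ 1 / (2 * B) * ‖P v‖ ^ 2 := by
  have hB0 : 0 < B := by rw [hB]; positivity
  refine ⟨(innerSL ℝ e).smulRight a + B • (ContinuousLinearMap.id ℝ E
    - (innerSL ℝ e).smulRight e), e - B⁻¹ • a, ?_, ?_, ?_, ?_⟩
  · intro h
    have : inner ℝ (e - B⁻¹ • a) e = 0 := by rw [h, inner_zero_left]
    rw [inner_sub_left, real_inner_smul_left, hae, real_inner_self_eq_norm_sq, he] at this
    norm_num at this
  · have h1 : inner ℝ e (e - B⁻¹ • a) = 1 := by
      rw [inner_sub_right, real_inner_smul_right, real_inner_comm a e, hae,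
        real_inner_self_eq_norm_sq, he]
      norm_num
    simp only [add_apply, smul_apply, sub_apply, ContinuousLinearMap.smulRight_apply,
      innerSL_apply_apply, ContinuousLinearMap.id_apply, h1, one_smul]
    rw [sub_sub_cancel_left, smul_neg, smul_inv_smul₀ hB0.ne', add_neg_cancel]
  · intro v
    have e1 : ((innerSL ℝ e).smulRight a + B • (ContinuousLinearMap.id ℝ E
      - (innerSL ℝ e).smulRight e)) v = inner ℝ v e • a + B • (v - inner ℝ v e • e) := by
      simp [real_inner_comm]
    rw [e1, ← mul_pow]
    gcongr
    calc _ ≤ ‖inner ℝ v e • a‖ + ‖B • (v - inner ℝ v e • e)‖ := norm_add_le _ _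
      _ = |inner ℝ v e| * ‖a‖ + B * ‖v - inner ℝ v e • e‖ := by
        rw [norm_smul, norm_smul, Real.norm_eq_abs, Real.norm_of_nonneg hB0.le]
      _ ≤ ‖v‖ * A + B * ‖v‖ := by
        gcongr
        · exact abs_inner_le he v
        · exact norm_sub_smul_le he v
      _ = _ := by ring
  · intro v
    have e1 : ((innerSL ℝ e).smulRight a + B • (ContinuousLinearMap.id ℝ E
      - (innerSL ℝ e).smulRight e)) v = inner ℝ v e • a + B • (v - inner ℝ v e • e) := by
      simp [real_inner_comm]
    rw [e1]
    generalize v - inner ℝ v e • e = z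
    generalize inner ℝ v e = s
    rw [norm_add_sq_real, real_inner_smul_left, real_inner_smul_right, norm_smul, norm_smul,
      Real.norm_of_nonneg hB0.le, one_div, ← div_eq_inv_mul, le_div_iff₀ (by positivity)]
    have h1 : 2 * (A * B) * ‖z‖ ^ 2 ≤ B ^ 2 * ‖z‖ ^ 2 := by
      have : 2 * (A * B) ≤ B ^ 2 := by rw [sq]; nlinarith
      gcongr
    nlinarith [sq_nonneg (‖s‖ * ‖a‖)]

end QuadraticForms

/-! ### The gradient on the lateral boundary -/

section SliceEstimates

variable {n : ℕ} {Ω : Set (EuclideanSpace ℝ (Fin n))} {T c₀ θ M : ℝ}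
    {φ ψ u : EuclideanSpace ℝ (Fin n) → ℝ → ℝ}

namespace SolutionData

lemma M_nonneg (h : SolutionData Ω T c₀ θ M φ ψ u) : 0 ≤ M := by
  obtain ⟨x, hx⟩ := h.nonempty
  exact (abs_nonneg _).trans (h.φ_le x hx T ⟨h.T_pos, le_rfl⟩)

/-- Bounds on `Q_T` extend to the closed cylinder. -/
lemma norm_le_cylinder (h : SolutionData Ω T c₀ θ M φ ψ u) {F : Type*} [NormedAddCommGroup F]
    {g : EuclideanSpace ℝ (Fin n) → ℝ → F} {C : ℝ}
    (hg : ContinuousOn (fun p : EuclideanSpace ℝ (Fin n) × ℝ => g p.1 p.2) (closedCylinder Ω T))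
    (hb : ∀ x ∈ Ω, ∀ t ∈ Ioc 0 T, ‖g x t‖ ≤ C) {x : EuclideanSpace ℝ (Fin n)}
    (hx : x ∈ closure Ω) {t : ℝ} (ht : t ∈ Icc 0 T) : ‖g x t‖ ≤ C := by
  refine norm_le_closure (Ω := Ω ×ˢ Ioc 0 T) (S := closedCylinder Ω T)
    (g := fun p : EuclideanSpace ℝ (Fin n) × ℝ => g p.1 p.2) (x := (x, t))
    (fun p hp => hb p.1 hp.1 p.2 hp.2) (hg (x, t) ⟨hx, ht⟩)
    (prod_mono subset_closure Ioc_subset_Icc_self) ?_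
  rw [closure_prod_eq, closure_Ioc h.T_pos.ne]
  exact ⟨hx, ht⟩

lemma abs_φ_le (h : SolutionData Ω T c₀ θ M φ ψ u) {x : EuclideanSpace ℝ (Fin n)}
    (hx : x ∈ closure Ω) {t : ℝ} (ht : t ∈ Icc 0 T) : |φ x t| ≤ M := by
  have hc := h.φ_mem.continuousOn_timeSlice (s := 0) (by omega)
  simp only [timeSlice_zero] at hc
  exact h.norm_le_cylinder hc h.φ_le hx ht

lemma abs_φt_le (h : SolutionData Ω T c₀ θ M φ ψ u) {x : EuclideanSpace ℝ (Fin n)}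
    (hx : x ∈ closure Ω) {t : ℝ} (ht : t ∈ Icc 0 T) : |timeDeriv T φ x t| ≤ M := by
  have hc := h.φ_mem.continuousOn_timeSlice (s := 1) (by omega)
  simp only [timeSlice_one] at hc
  exact h.norm_le_cylinder hc h.φt_le hx ht

lemma norm_φ₂_le (h : SolutionData Ω T c₀ θ M φ ψ u) {x : EuclideanSpace ℝ (Fin n)}
    (hx : x ∈ closure Ω) {t : ℝ} (ht : t ∈ Icc 0 T) :
    ‖sd2 (closure Ω) (fun y => φ y t) x‖ ≤ M := by
  have hc := h.φ_mem.continuousOn_sd2 h.uniqueDiff (s := 0) (by omega)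
  simp only [timeSlice_zero] at hc
  exact h.norm_le_cylinder hc h.φ₂_le hx ht

lemma φ_jet (h : SolutionData Ω T c₀ θ M φ ψ u) {t : ℝ} (ht : t ∈ Ioc 0 T) :
    HasJet (closure Ω) (fun y => φ y t) (sd1 (closure Ω) (fun y => φ y t))
      (sd2 (closure Ω) (fun y => φ y t)) (sd3 (closure Ω) (fun y => φ y t))
      (sd4 (closure Ω) (fun y => φ y t)) M := by
  have hs := h.φ_slice (Ioc_subset_Icc_self ht)
  have hK := h.uniqueDiff
  exact ⟨fun x hx => hasFDerivWithinAt_sd1 (m := 3) hs hx,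
    fun x hx => hasFDerivWithinAt_sd2 (m := 2) hK hs hx,
    fun x hx => hasFDerivWithinAt_sd3 (m := 1) hK hs hx,
    fun x hx => hasFDerivWithinAt_sd4 (m := 0) hK hs hx,
    fun x hx => norm_le_closure (fun y hy => h.φ₁_le y hy t ht)
      ((contDiffOn_sd1 (m := 3) hK hs).continuousOn x hx) subset_closure hx,
    fun x hx => norm_le_closure (fun y hy => h.φ₂_le y hy t ht)
      ((contDiffOn_sd2 (m := 2) hK hs).continuousOn x hx) subset_closure hx,
    fun x hx => norm_le_closure (fun y hy => h.φ₃_le y hy t ht)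
      ((contDiffOn_sd3 (m := 1) hK hs).continuousOn x hx) subset_closure hx,
    fun x hx => norm_le_closure (fun y hy => h.φ₄_le y hy t ht)
      ((contDiffOn_sd4 (m := 0) hK hs).continuousOn x hx) subset_closure hx⟩

/-- The derivatives of a slice of `u` are bounded, by a constant that depends on `u`. -/
lemma exists_u_jet (h : SolutionData Ω T c₀ θ M φ ψ u) {t : ℝ} (ht : t ∈ Icc 0 T) :
    ∃ C, HasJet (closure Ω) (fun y => u y t) (sd1 (closure Ω) (fun y => u y t))
      (sd2 (closure Ω) (fun y => u y t)) (sd3 (closure Ω) (fun y => u y t))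
      (sd4 (closure Ω) (fun y => u y t)) C := by
  have hs := h.u_slice ht
  have hK := h.uniqueDiff
  have hcomp := h.isCompact_closure
  obtain ⟨C₁, h₁⟩ := hcomp.exists_bound_of_continuousOn
    (contDiffOn_sd1 (m := 3) hK hs).continuousOn
  obtain ⟨C₂, h₂⟩ := hcomp.exists_bound_of_continuousOn
    (contDiffOn_sd2 (m := 2) hK hs).continuousOn
  obtain ⟨C₃, h₃⟩ := hcomp.exists_bound_of_continuousOn
    (f := sd3 (closure Ω) (fun y => u y t)) (contDiffOn_sd3 (m := 1) hK hs).continuousOn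
  obtain ⟨C₄, h₄⟩ := hcomp.exists_bound_of_continuousOn
    (f := sd4 (closure Ω) (fun y => u y t)) (contDiffOn_sd4 (m := 0) hK hs).continuousOn
  exact ⟨max (max C₁ C₂) (max C₃ C₄), fun x hx => hasFDerivWithinAt_sd1 (m := 3) hs hx,
    fun x hx => hasFDerivWithinAt_sd2 (m := 2) hK hs hx,
    fun x hx => hasFDerivWithinAt_sd3 (m := 1) hK hs hx,
    fun x hx => hasFDerivWithinAt_sd4 (m := 0) hK hs hx,
    fun x hx => (h₁ x hx).trans (by simp), fun x hx => (h₂ x hx).trans (by simp),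
    fun x hx => (h₃ x hx).trans (by simp), fun x hx => (h₄ x hx).trans (by simp)⟩

lemma det_pos (h : SolutionData Ω T c₀ θ M φ ψ u) {t : ℝ} (ht : t ∈ Icc 0 T)
    {x : EuclideanSpace ℝ (Fin n)} (hx : x ∈ closure Ω) :
    0 < (formMatrix (sd2 (closure Ω) (fun y => u y t) x)).det :=
  lt_of_lt_of_le (lt_min h.c₀_pos (pow_pos h.θ_pos n)) (h.le_det ht hx)

/-- Lower barrier `φ + A (‖X‖² - R ⟨X, N⟩)` for `u`: at an interior minimum of the difference,
`D²u` would be at least `2M + 1` while `det D²u ≤ φ_t + ψ ≤ 2M`. -/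
lemma le_sub_of_paraboloid (hn : 1 ≤ n) (h : SolutionData Ω T c₀ θ M φ ψ u)
    {x₀ N : EuclideanSpace ℝ (Fin n)} {R : ℝ}
    (henc : ∀ x ∈ closure Ω, ‖x - x₀‖ ^ 2 ≤ R * inner ℝ (x - x₀) N)
    {x : EuclideanSpace ℝ (Fin n)} (hx : x ∈ closure Ω) {t : ℝ} (ht : t ∈ Icc 0 T) :
    0 ≤ u x t - φ x t + ((3 * M + 1) / 2 * R * inner ℝ (x - x₀) N
      - (3 * M + 1) / 2 * inner ℝ (x - x₀) (x - x₀)) := by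
  have hM := h.M_nonneg
  refine le_of_no_interior_min (w := fun x t => u x t - φ x t
    + ((3 * M + 1) / 2 * R * inner ℝ (x - x₀) N
      - (3 * M + 1) / 2 * inner ℝ (x - x₀) (x - x₀))) h.bounded ?_ ?_ ?_ hx ht
  · have h1 := h.u_mem.continuousOn_timeSlice (s := 0) (by omega)
    have h2 := h.φ_mem.continuousOn_timeSlice (s := 0) (by omega)
    simp only [timeSlice_zero] at h1 h2
    refine (h1.sub h2).add (Continuous.continuousOn ?_)
    fun_prop
  · have hq : ∀ y ∈ closure Ω, 0 ≤ (3 * M + 1) / 2 * R * inner ℝ (y - x₀) N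
        - (3 * M + 1) / 2 * inner ℝ (y - x₀) (y - x₀) := fun y hy => by
      rw [real_inner_self_eq_norm_sq, mul_assoc, ← mul_sub]
      exact mul_nonneg (by positivity) (sub_nonneg.2 (henc y hy))
    rintro ⟨y, s⟩ (⟨hy, hs⟩ | ⟨hy, hs⟩)
    · have hs0 : s = 0 := hs
      subst hs0
      have := h.eq_initial hy
      simp only
      linarith [hq y hy]
    · have := h.eq_on_frontier hs hy
      simp only
      linarith [hq y (frontier_subset_closure hy)]
  · intro y hy s hs hmin
    have hs' : s ∈ Icc 0 T := Ioc_subset_Icc_self hs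
    have hyc := subset_closure hy
    obtain ⟨b, hb⟩ := exists_form (E := EuclideanSpace ℝ (Fin n)) 0 (-((3 * M + 1) / 2)) 0
    obtain ⟨a1, a2⟩ := h.hasFDerivAt_of_slice ((h.u_slice hs').of_le (by norm_num)) hy
    obtain ⟨b1, b2⟩ := h.hasFDerivAt_of_slice ((h.φ_slice hs').of_le (by norm_num)) hy
    have hlm : IsLocalMin (fun z => u z s - φ z s
        + ((((3 * M + 1) / 2 * R) • innerSL ℝ N) (z - x₀) + b (z - x₀) (z - x₀))) y := by
      filter_upwards [h.isOpen.mem_nhds hy] with z hz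
      have := hmin z (subset_closure hz) s hs'
      simp only [smul_apply, innerSL_apply_apply, smul_eq_mul, hb, real_inner_comm _ N]
      linarith
    have hsp := second_fderiv_nonneg_of_isLocalMin (by
      filter_upwards [a1, b1] with z h1 h2 using
        (h1.sub h2).add (hasFDerivAt_quadratic _ b x₀ z))
      ((a2.sub b2).add (hasFDerivAt_fderiv_quadratic _ b x₀ y)) hlm
    have htm := deriv_time_nonpos_of_min hs
      (((h.u_mem.hasDerivWithinAt_time hyc hs').sub
        (h.φ_mem.hasDerivWithinAt_time hyc hs')).add_const _) (fun r hr => hmin y hyc r hr)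
    have hform : ∀ v, (2 * M + 1) * ‖v‖ ^ 2 ≤ sd2 (closure Ω) (fun z => u z s) y v v := by
      intro v
      have h1 := hsp v
      simp only [add_apply, sub_apply, ContinuousLinearMap.flip_apply, hb,
        real_inner_self_eq_norm_sq] at h1
      have h2 := (abs_le.1 (abs_apply₂_le (h.φ₂_le y hy s hs) v v)).1
      rw [mul_assoc, ← sq] at h2
      linarith
    have hdet := pow_le_det (h.u_symm hs' hyc) (by positivity) hform
    have hpow : (2 * M + 1) ^ 1 ≤ (2 * M + 1) ^ n := pow_le_pow_right₀ (by linarith) hn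
    rw [h.equation hs hyc] at hdet
    have e1 := (abs_le.1 (h.φt_le y hy s hs)).2
    have e2 := (abs_le.1 (h.ψ_le y hyc s hs')).2
    linarith

lemma u_le (hn : 1 ≤ n) (h : SolutionData Ω T c₀ θ M φ ψ u) {x : EuclideanSpace ℝ (Fin n)}
    (hx : x ∈ closure Ω) {t : ℝ} (ht : t ∈ Icc 0 T) : u x t ≤ M := by
  refine ge_of_no_interior_max (f := fun y => u y t) h.bounded (h.u_slice ht).continuousOn
    (fun y hy => ?_) (fun y hy hmax => ?_) hx
  · rw [h.eq_on_frontier ht hy]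
    exact (abs_le.1 (h.abs_φ_le (frontier_subset_closure hy) ht)).2
  · obtain ⟨a1, a2⟩ := h.hasFDerivAt_of_slice ((h.u_slice ht).of_le (by norm_num)) hy
    have hsp := second_fderiv_nonneg_of_isLocalMin (f := fun z => -u z t)
      (a1.mono fun z hz => hz.neg) a2.neg (by
        filter_upwards [h.isOpen.mem_nhds hy] with z hz
        exact neg_le_neg (hmax z (subset_closure hz)))
    have hle : ∀ v, sd2 (closure Ω) (fun z => u z t) y v v ≤ 0 * ‖v‖ ^ 2 := fun v => by
      have := hsp v
      simp only [neg_apply] at this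
      linarith
    have hd := det_le_of_degenerate hn (h.u_symm ht (subset_closure hy))
      (h.u_nonneg ht (subset_closure hy)) hle
      (k := EuclideanSpace.single ⟨0, hn⟩ 1) (by simp) (hle _)
    rw [zero_mul] at hd
    exact absurd (h.det_pos ht (subset_closure hy)) (not_lt.2 hd)

end SolutionData

namespace DefiningFunction

variable {ρ : EuclideanSpace ℝ (Fin n) → ℝ}
    {ρ₁ : EuclideanSpace ℝ (Fin n) → EuclideanSpace ℝ (Fin n) →L[ℝ] ℝ}
    {ρ₂ : EuclideanSpace ℝ (Fin n) → EuclideanSpace ℝ (Fin n) →L[ℝ]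
      EuclideanSpace ℝ (Fin n) →L[ℝ] ℝ}
    {ρ₃ : EuclideanSpace ℝ (Fin n) → EuclideanSpace ℝ (Fin n) →L[ℝ]
      EuclideanSpace ℝ (Fin n) →L[ℝ] EuclideanSpace ℝ (Fin n) →L[ℝ] ℝ}
    {ρ₄ : EuclideanSpace ℝ (Fin n) → EuclideanSpace ℝ (Fin n) →L[ℝ]
      EuclideanSpace ℝ (Fin n) →L[ℝ] EuclideanSpace ℝ (Fin n) →L[ℝ]
      EuclideanSpace ℝ (Fin n) →L[ℝ] ℝ}
    {N : EuclideanSpace ℝ (Fin n) → EuclideanSpace ℝ (Fin n)} {C D κ p₀ : ℝ}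

/-- Barrier and convexity bounds for the normal derivative of `u - φ` on the lateral boundary. -/
lemma exists_normal_deriv_le (hn : 1 ≤ n) (hρ : DefiningFunction Ω ρ ρ₁ ρ₂ ρ₃ ρ₄ N C D κ p₀)
    (M : ℝ) : ∃ A : ℝ, 0 ≤ A ∧ ∀ {T c₀ θ : ℝ} {φ ψ u : EuclideanSpace ℝ (Fin n) → ℝ → ℝ},
      SolutionData Ω T c₀ θ M φ ψ u → ∀ x₀ ∈ frontier Ω, ∀ t ∈ Ioc 0 T,
        |sd1 (closure Ω) (fun y => u y t) x₀ (N x₀)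
          - sd1 (closure Ω) (fun y => φ y t) x₀ (N x₀)| ≤ A := by
  obtain ⟨R, hR, henc⟩ := hρ.exists_enclosing
  obtain ⟨r, hr, hin⟩ := hρ.exists_inward
  refine ⟨max 0 (max ((3 * M + 1) / 2 * R) (2 * M / r + M)), le_max_left _ _, ?_⟩
  intro T c₀ θ φ ψ u h x₀ hx₀ t ht
  have ht' := Ioc_subset_Icc_self ht
  have hx₀c := frontier_subset_closure hx₀
  have hN := hρ.norm_normal x₀ hx₀
  have hrN := hin x₀ hx₀ r ⟨hr, le_rfl⟩
  have hu := hasFDerivWithinAt_sd1 (m := 3) (h.u_slice ht') hx₀c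
  have hφ := (h.φ_jet ht).deriv₁ x₀ hx₀c
  have hφN := abs_apply_le ((h.φ_jet ht).bound₁ x₀ hx₀c) (N x₀)
  rw [hN, mul_one] at hφN
  rw [abs_le]
  constructor
  · obtain ⟨b, hb⟩ := exists_form (E := EuclideanSpace ℝ (Fin n)) 0 (-((3 * M + 1) / 2)) 0
    have h1 := fderiv_inward_nonneg h.convex.closure (v := N x₀) ((hu.sub hφ).add
      (hasFDerivAt_quadratic (((3 * M + 1) / 2 * R) • innerSL ℝ (N x₀)) b x₀
        x₀).hasFDerivWithinAt) hx₀c hr (subset_closure hrN) (by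
          intro y hy
          have h2 := h.le_sub_of_paraboloid hn (henc x₀ hx₀) hy ht'
          have h3 := h.eq_on_frontier ht' hx₀
          simp only [Pi.add_apply, Pi.sub_apply, sub_self, smul_apply,
            innerSL_apply_apply, smul_eq_mul, hb, real_inner_comm _ (N x₀), h3, zero_apply,
            inner_zero_left, mul_zero, add_zero]
          linarith)
    simp only [sub_self, map_zero, add_zero, add_apply, sub_apply, smul_apply,
      innerSL_apply_apply, smul_eq_mul, real_inner_self_eq_norm_sq, hN] at h1
    have : (3 * M + 1) / 2 * R ≤ max 0 (max ((3 * M + 1) / 2 * R) (2 * M / r + M)) :=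
      (le_max_left _ _).trans (le_max_right _ _)
    linarith
  · have h1 := fderivWithin_le_sub_of_convexOn (h.u_convex t ht') hu hx₀c (subset_closure hrN)
    rw [add_sub_cancel_left, map_smul, smul_eq_mul] at h1
    have h2 := h.u_le hn (subset_closure hrN) ht'
    have h3 := h.eq_on_frontier ht' hx₀
    have h4 := (abs_le.1 (h.abs_φ_le hx₀c ht')).1
    have h5 : sd1 (closure Ω) (fun y => u y t) x₀ (N x₀) ≤ 2 * M / r := by
      rw [le_div_iff₀ hr]
      linarith
    have : 2 * M / r + M ≤ max 0 (max ((3 * M + 1) / 2 * R) (2 * M / r + M)) :=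
      (le_max_right _ _).trans (le_max_right _ _)
    linarith [(abs_le.1 hφN).1]

/-- On the lateral boundary `D(u - φ)` is normal. -/
lemma sd1_sub_eq (hρ : DefiningFunction Ω ρ ρ₁ ρ₂ ρ₃ ρ₄ N C D κ p₀)
    (h : SolutionData Ω T c₀ θ M φ ψ u) {x₀ : EuclideanSpace ℝ (Fin n)} (hx₀ : x₀ ∈ frontier Ω)
    {t : ℝ} (ht : t ∈ Ioc 0 T) (v : EuclideanSpace ℝ (Fin n)) :
    sd1 (closure Ω) (fun y => u y t) x₀ v - sd1 (closure Ω) (fun y => φ y t) x₀ v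
      = inner ℝ v (N x₀) * (sd1 (closure Ω) (fun y => u y t) x₀ (N x₀)
        - sd1 (closure Ω) (fun y => φ y t) x₀ (N x₀)) := by
  have ht' := Ioc_subset_Icc_self ht
  have hx₀c := frontier_subset_closure hx₀
  have hN := hρ.norm_normal x₀ hx₀
  obtain ⟨Cu, hju⟩ := h.exists_u_jet ht'
  have hjφ := h.φ_jet ht
  obtain ⟨r, A, hr, hA, hpt⟩ := hρ.exists_boundary_point
  obtain ⟨L, hL⟩ : ∃ L, L = sd1 (closure Ω) (fun y => u y t) x₀
    - sd1 (closure Ω) (fun y => φ y t) x₀ := ⟨_, rfl⟩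
  -- tangential derivatives vanish
  have htan : ∀ e, ‖e‖ = 1 → inner ℝ e (N x₀) = 0 → L e = 0 := by
    intro e he heN
    rw [← abs_nonpos_iff]
    refine nonpos_of_le_mul (C := A * |L (N x₀)| + (Cu + M) * (1 + A * r) ^ 2) hr ?_
    intro s hs
    obtain ⟨q, hq0, hq, hfr⟩ := hpt x₀ hx₀ e he heN s hs
    have hs0 := hs.1
    have hX : ‖s • e + q • N x₀‖ ≤ (1 + A * r) * s := by
      calc _ ≤ ‖s • e‖ + ‖q • N x₀‖ := norm_add_le _ _
        _ = s + q := by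
          rw [norm_smul, norm_smul, he, hN, mul_one, mul_one, Real.norm_of_nonneg hs0.le,
            Real.norm_of_nonneg hq0]
        _ ≤ s + A * s * r := by
          have : A * s ^ 2 ≤ A * s * r := by
            rw [sq, ← mul_assoc]
            exact mul_le_mul_of_nonneg_left hs.2 (by positivity)
          linarith
        _ = _ := by ring
    have h1 := taylor_one_le h.convex.closure hju.deriv₁ hju.deriv₂ hju.bound₂ hx₀c
      (frontier_subset_closure hfr)
    have h2 := taylor_one_le h.convex.closure hjφ.deriv₁ hjφ.deriv₂ hjφ.bound₂ hx₀c
      (frontier_subset_closure hfr)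
    simp only [h.eq_on_frontier ht' hx₀, h.eq_on_frontier ht' hfr, add_sub_cancel_left,
      Real.norm_eq_abs] at h1 h2
    have hCu : 0 ≤ Cu := (norm_nonneg _).trans (hju.bound₂ x₀ hx₀c)
    have hM := h.M_nonneg
    have h3 : |L (s • e + q • N x₀)| ≤ (Cu + M) * ((1 + A * r) * s) ^ 2 := by
      have h4 : |L (s • e + q • N x₀)| ≤ (Cu + M) * ‖s • e + q • N x₀‖ ^ 2 := by
        rw [hL, sub_apply, abs_le]
        rw [abs_le] at h1 h2
        constructor <;> linarith [h1.1, h1.2, h2.1, h2.2]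
      refine h4.trans ?_
      gcongr
    rw [map_add, map_smul, map_smul, smul_eq_mul, smul_eq_mul] at h3
    have h5 : s * |L e| ≤ s * ((A * |L (N x₀)| + (Cu + M) * (1 + A * r) ^ 2) * s) := by
      calc s * |L e| = |(s * L e + q * L (N x₀)) - q * L (N x₀)| := by
            rw [add_sub_cancel_right, abs_mul, abs_of_pos hs0]
        _ ≤ |s * L e + q * L (N x₀)| + |q * L (N x₀)| := abs_sub _ _
        _ ≤ (Cu + M) * ((1 + A * r) * s) ^ 2 + A * s ^ 2 * |L (N x₀)| := by
          rw [abs_mul q, abs_of_nonneg hq0]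
          gcongr
        _ = _ := by ring
    exact le_of_mul_le_mul_left h5 hs0
  rw [← sub_apply, ← sub_apply, ← hL]
  have hdecomp : v = inner ℝ v (N x₀) • N x₀ + (v - inner ℝ v (N x₀) • N x₀) := by abel
  have hz : L (v - inner ℝ v (N x₀) • N x₀) = 0 := by
    rcases eq_or_ne (v - inner ℝ v (N x₀) • N x₀) 0 with h0 | h0
    · rw [h0, map_zero]
    · have h1 := htan (‖v - inner ℝ v (N x₀) • N x₀‖⁻¹ • (v - inner ℝ v (N x₀) • N x₀))
        (norm_smul_inv_norm h0) (by
          rw [real_inner_smul_left, inner_sub_smul_self hN, mul_zero])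
      rw [map_smul, smul_eq_mul] at h1
      exact (mul_eq_zero.1 h1).resolve_left (inv_ne_zero (norm_ne_zero_iff.2 h0))
  conv_lhs => rw [hdecomp]
  rw [map_add, hz, add_zero, map_smul, smul_eq_mul]

end DefiningFunction

end SliceEstimates

/-! ### Tangential second derivatives on the lateral boundary -/

section TangentialDerivatives

namespace DefiningFunction

variable {n : ℕ} {Ω : Set (EuclideanSpace ℝ (Fin n))}
    {ρ : EuclideanSpace ℝ (Fin n) → ℝ}
    {ρ₁ : EuclideanSpace ℝ (Fin n) → EuclideanSpace ℝ (Fin n) →L[ℝ] ℝ}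
    {ρ₂ : EuclideanSpace ℝ (Fin n) → EuclideanSpace ℝ (Fin n) →L[ℝ]
      EuclideanSpace ℝ (Fin n) →L[ℝ] ℝ}
    {ρ₃ : EuclideanSpace ℝ (Fin n) → EuclideanSpace ℝ (Fin n) →L[ℝ]
      EuclideanSpace ℝ (Fin n) →L[ℝ] EuclideanSpace ℝ (Fin n) →L[ℝ] ℝ}
    {ρ₄ : EuclideanSpace ℝ (Fin n) → EuclideanSpace ℝ (Fin n) →L[ℝ]
      EuclideanSpace ℝ (Fin n) →L[ℝ] EuclideanSpace ℝ (Fin n) →L[ℝ]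
      EuclideanSpace ℝ (Fin n) →L[ℝ] ℝ}
    {N : EuclideanSpace ℝ (Fin n) → EuclideanSpace ℝ (Fin n)} {C D κ p₀ : ℝ}

/-- Comparison with a quadratic whose Hessian is almost degenerate. If, along the boundary,
`φ(·, t)` exceeds an affine function by at most `⟨X, e⟩ ⟨a, z⟩ + A |z|²`, then the inner normal
derivative of `u(·, t)` at `x₀` lies below that of the affine function by a fixed amount. -/
lemma exists_normal_deriv_gap (hn : 1 ≤ n)
    (hρ : DefiningFunction Ω ρ ρ₁ ρ₂ ρ₃ ρ₄ N C D κ p₀) {c₀ θ : ℝ} (hc₀ : 0 < c₀) (hθ : 0 < θ)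
    {A : ℝ} (hA : 0 ≤ A) : ∃ ε : ℝ, 0 < ε ∧ ∀ {T M : ℝ}
      {φ ψ u : EuclideanSpace ℝ (Fin n) → ℝ → ℝ}, SolutionData Ω T c₀ θ M φ ψ u →
      ∀ x₀ ∈ frontier Ω, ∀ t ∈ Ioc 0 T, ∀ e a : EuclideanSpace ℝ (Fin n), ∀ μ : ℝ,
      ‖e‖ = 1 → ‖a‖ ≤ A → inner ℝ a e = 0 →
      (∀ x ∈ frontier Ω, φ x t - φ x₀ t - sd1 (closure Ω) (fun y => φ y t) x₀ (x - x₀)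
        - μ * inner ℝ (x - x₀) (N x₀)
        - inner ℝ (x - x₀) e * inner ℝ a (x - x₀ - inner ℝ (x - x₀) e • e)
        ≤ A * ‖x - x₀ - inner ℝ (x - x₀) e • e‖ ^ 2) →
      sd1 (closure Ω) (fun y => u y t) x₀ (N x₀) - sd1 (closure Ω) (fun y => φ y t) x₀ (N x₀) - μ
        ≤ -ε := by
  rcases (frontier Ω).eq_empty_or_nonempty with hem | ⟨x₁, hx₁⟩
  · exact ⟨1, one_pos, by simp [hem]⟩
  have hC := hρ.C_pos hx₁
  have hp₀ := hρ.p₀_pos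
  obtain ⟨r, hr, hin⟩ := hρ.exists_inward
  -- `L` bounds the Hessian of the quadratic and `2 δ` its value in the degenerate direction, so
  -- `δ` is taken so small that `2 δ L ^ (n - 1)` stays below the lower bound `c₁` of `det D²u`
  obtain ⟨B, hB⟩ : ∃ B, B = 2 * A + 1 := ⟨_, rfl⟩
  have hB0 : 0 < B := by rw [hB]; positivity
  obtain ⟨L, hL⟩ : ∃ L, L = 2 + (A + B) ^ 2 / B := ⟨_, rfl⟩
  have hL0 : 0 < L := by rw [hL]; positivity
  obtain ⟨c₁, hc₁⟩ : ∃ c, c = min c₀ (θ ^ n) := ⟨_, rfl⟩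
  have hc₁0 : 0 < c₁ := by rw [hc₁]; exact lt_min hc₀ (pow_pos hθ n)
  obtain ⟨δ, hδ⟩ : ∃ δ, δ = min 1 (c₁ / (4 * L ^ (n - 1))) := ⟨_, rfl⟩
  have hδ0 : 0 < δ := by rw [hδ]; exact lt_min one_pos (by positivity)
  have hδ1 : δ ≤ 1 := by rw [hδ]; exact min_le_left _ _
  have hδ2 : 2 * δ * L ^ (n - 1) < c₁ := by
    have : δ ≤ c₁ / (4 * L ^ (n - 1)) := by rw [hδ]; exact min_le_right _ _
    rw [le_div_iff₀ (by positivity)] at this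
    linarith
  -- on the boundary `δ p₀ / C` times the normal coordinate is absorbed by `δ ‖X‖ ^ 2`
  refine ⟨δ * p₀ / C, by positivity, ?_⟩
  intro T M φ ψ u h x₀ hx₀ t ht e a μ he ha hae hbd
  have ht' := Ioc_subset_Icc_self ht
  have hx₀c := frontier_subset_closure hx₀
  have hN := hρ.norm_normal x₀ hx₀
  have hu := hasFDerivWithinAt_sd1 (m := 3) (h.u_slice ht') hx₀c
  obtain ⟨P, k, hk, hPk, hP, hPlow⟩ := exists_degenerate_square he hae hA ha hB
  obtain ⟨b, hb⟩ := exists_form P (-δ) (-(1 / (2 * B)))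
  obtain ⟨ℓ, hℓ⟩ : ∃ ℓ : EuclideanSpace ℝ (Fin n) →L[ℝ] ℝ, ∀ v, ℓ v =
      -(sd1 (closure Ω) (fun y => φ y t) x₀ v) - (μ - δ * p₀ / C) * inner ℝ v (N x₀) :=
    ⟨-(sd1 (closure Ω) (fun y => φ y t) x₀) - (μ - δ * p₀ / C) • innerSL ℝ (N x₀),
      fun v => by
        simp [real_inner_comm]⟩
  have hcont : ContinuousOn (fun x => u x t + (ℓ (x - x₀) + b (x - x₀) (x - x₀))) (closure Ω) := by
    refine (h.u_slice ht').continuousOn.add (Continuous.continuousOn ?_)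
    fun_prop
  have hcmp : ∀ x ∈ closure Ω, u x t + (ℓ (x - x₀) + b (x - x₀) (x - x₀)) ≤ φ x₀ t := by
    intro x hx
    refine ge_of_no_interior_max (f := fun x => u x t + (ℓ (x - x₀) + b (x - x₀) (x - x₀)))
      h.bounded hcont ?_ ?_ hx
    · intro y hy
      have h1 := hbd y hy
      have h2 := hPlow (y - x₀)
      have h3 : δ * p₀ / C * inner ℝ (y - x₀) (N x₀) ≤ δ * ‖y - x₀‖ ^ 2 := by
        have := (abs_le.1 (hρ.abs_inner_normal_le hx₀ hy)).2
        calc _ ≤ δ * p₀ / C * (C / p₀ * ‖y - x₀‖ ^ 2) := by gcongr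
          _ = _ := by field_simp
      have h4 := h.eq_on_frontier ht' hy
      simp only [h4, hb, hℓ, real_inner_self_eq_norm_sq]
      linarith
    · intro y hy hmax
      have hyc := subset_closure hy
      obtain ⟨a1, a2⟩ := h.hasFDerivAt_of_slice ((h.u_slice ht').of_le (by norm_num)) hy
      have hsp := second_fderiv_nonneg_of_isLocalMin
        (f := fun z => -(u z t + (ℓ (z - x₀) + b (z - x₀) (z - x₀)))) (by
          filter_upwards [a1] with z h1 using (h1.add (hasFDerivAt_quadratic ℓ b x₀ z)).neg)
        (a2.add (hasFDerivAt_fderiv_quadratic ℓ b x₀ y)).neg (by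
          filter_upwards [h.isOpen.mem_nhds hy] with z hz
          exact neg_le_neg (hmax z (subset_closure hz)))
      have hle : ∀ v, sd2 (closure Ω) (fun z => u z t) y v v
          ≤ 2 * δ * ‖v‖ ^ 2 + 1 / B * ‖P v‖ ^ 2 := fun v => by
        have h1 := hsp v
        simp only [neg_apply, add_apply, ContinuousLinearMap.flip_apply, hb,
          real_inner_self_eq_norm_sq] at h1
        have h2 : 1 / B * ‖P v‖ ^ 2 = 2 * (1 / (2 * B) * ‖P v‖ ^ 2) := by field_simp
        linarith
      have hd := det_le_of_degenerate hn (h.u_symm ht' hyc) (h.u_nonneg ht' hyc) (L := L)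
        (fun v => (hle v).trans ?_) hk (δ := 2 * δ) (by
          have := hle k
          rw [hPk, norm_zero] at this
          linarith)
      · have := h.le_det ht' hyc
        rw [← hc₁] at this
        linarith
      · have h1 : 1 / B * ‖P v‖ ^ 2 ≤ (A + B) ^ 2 / B * ‖v‖ ^ 2 := by
          calc _ ≤ 1 / B * ((A + B) ^ 2 * ‖v‖ ^ 2) := by gcongr; exact hP v
            _ = _ := by ring
        have h2 : 2 * δ * ‖v‖ ^ 2 ≤ 2 * ‖v‖ ^ 2 := by
          have : 0 ≤ ‖v‖ ^ 2 := by positivity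
          nlinarith
        rw [hL, add_mul]
        linarith
  have h1 := fderiv_inward_nonneg h.convex.closure (v := N x₀)
    (hu.add (hasFDerivAt_quadratic ℓ b x₀ x₀).hasFDerivWithinAt).neg hx₀c hr
    (subset_closure (hin x₀ hx₀ r ⟨hr, le_rfl⟩)) (by
      intro y hy
      have h2 := hcmp y hy
      have h3 := h.eq_on_frontier ht' hx₀
      simp only [Pi.add_apply, Pi.neg_apply, sub_self, map_zero, add_zero, h3]
      linarith)
  simp only [sub_self, map_zero, add_zero, add_apply, neg_apply, hℓ,
    real_inner_self_eq_norm_sq, hN] at h1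
  linarith

/-- Two-sided bounds for the tangential second derivatives of `u` on the lateral boundary. -/
lemma exists_tangential_bounds (hn : 1 ≤ n)
    (hρ : DefiningFunction Ω ρ ρ₁ ρ₂ ρ₃ ρ₄ N C D κ p₀) {c₀ θ : ℝ} (hc₀ : 0 < c₀) (hθ : 0 < θ)
    (M : ℝ) : ∃ c A : ℝ, 0 < c ∧ 0 ≤ A ∧ ∀ {T : ℝ}
      {φ ψ u : EuclideanSpace ℝ (Fin n) → ℝ → ℝ}, SolutionData Ω T c₀ θ M φ ψ u →
      ∀ x₀ ∈ frontier Ω, ∀ t ∈ Ioc 0 T, ∀ e : EuclideanSpace ℝ (Fin n),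
      ‖e‖ = 1 → inner ℝ e (N x₀) = 0 →
      c ≤ sd2 (closure Ω) (fun y => u y t) x₀ e e ∧
        sd2 (closure Ω) (fun y => u y t) x₀ e e ≤ A := by
  obtain ⟨R, hR, henc⟩ := hρ.exists_enclosing
  obtain ⟨Aw, hAw, hw⟩ := hρ.exists_normal_deriv_le hn M
  obtain ⟨A, hA, hexp⟩ := hρ.exists_boundary_expansion M
  obtain ⟨ε, hε, hgap⟩ := hρ.exists_normal_deriv_gap hn hc₀ hθ hA
  obtain ⟨r, A', hr, hA', hpt⟩ := hρ.exists_boundary_point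
  refine ⟨2 * ε / R, 2 * (A' * (Aw + A)), by positivity, by positivity, ?_⟩
  intro T φ ψ u h x₀ hx₀ t ht e he heN
  have ht' := Ioc_subset_Icc_self ht
  have hx₀c := frontier_subset_closure hx₀
  have hN := hρ.norm_normal x₀ hx₀
  obtain ⟨μ, a, hμ, ha, hae, hbd⟩ := hexp (h.φ_jet ht) x₀ hx₀ e he heN
  have hg := hgap h x₀ hx₀ t ht e a μ he ha hae (fun x hx => (abs_le.1 (hbd x hx)).2)
  have hw' := hw h x₀ hx₀ t ht
  obtain ⟨Cu, hju⟩ := h.exists_u_jet ht'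
  obtain ⟨p, hp⟩ : ∃ p, p = sd1 (closure Ω) (fun y => u y t) x₀ (N x₀)
    - sd1 (closure Ω) (fun y => φ y t) x₀ (N x₀) := ⟨_, rfl⟩
  rw [← hp] at hg hw'
  obtain ⟨H, hH⟩ : ∃ H, H = sd2 (closure Ω) (fun y => u y t) x₀ := ⟨_, rfl⟩
  rw [← hH]
  have hCu : 0 ≤ Cu := (norm_nonneg _).trans (hju.bound₂ x₀ hx₀c)
  have hHb : ∀ v w, |H v w| ≤ Cu * ‖v‖ * ‖w‖ := by
    rw [hH]; exact abs_apply₂_le (hju.bound₂ x₀ hx₀c)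
  -- second order expansion of `u = φ` along the boundary
  obtain ⟨K, hK⟩ : ∃ K, K = Cu * (1 + A' * r) ^ 3 + Cu * (2 * A' + A' ^ 2 * r)
    + (A * A' + A * A' ^ 2 * r) := ⟨_, rfl⟩
  have hmain : ∀ s ∈ Ioc 0 r, ∃ q, 0 ≤ q ∧ q ≤ A' * s ^ 2 ∧ s ^ 2 ≤ R * q ∧
      |1 / 2 * s ^ 2 * H e e - q * (μ - p)| ≤ K * s ^ 3 := by
    intro s hs
    obtain ⟨q, hq0, hq, hfr⟩ := hpt x₀ hx₀ e he heN s hs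
    have hs0 := hs.1
    have hfrc := frontier_subset_closure hfr
    refine ⟨q, hq0, hq, ?_, ?_⟩
    · have h1 := henc x₀ hx₀ _ hfrc
      have h2 : ‖s • e + q • N x₀‖ ^ 2 = s ^ 2 + q ^ 2 := by
        rw [norm_add_sq_real, real_inner_smul_left, real_inner_smul_right, heN, norm_smul,
          norm_smul, he, hN]
        simp
      rw [add_sub_cancel_left, h2, inner_add_left, real_inner_smul_left, heN,
        real_inner_smul_left, real_inner_self_eq_norm_sq, hN] at h1
      nlinarith [sq_nonneg q]
    have hX : ‖s • e + q • N x₀‖ ≤ (1 + A' * r) * s := by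
      calc _ ≤ ‖s • e‖ + ‖q • N x₀‖ := norm_add_le _ _
        _ = s + q := by
          rw [norm_smul, norm_smul, he, hN, mul_one, mul_one, Real.norm_of_nonneg hs0.le,
            Real.norm_of_nonneg hq0]
        _ ≤ s + A' * s * r := by
          have : A' * s ^ 2 ≤ A' * s * r := by
            rw [sq, ← mul_assoc]
            exact mul_le_mul_of_nonneg_left hs.2 (by positivity)
          linarith
        _ = _ := by ring
    have h1 := taylor_two_le h.convex.closure hju.deriv₁ hju.deriv₂ hju.deriv₃ hju.bound₃ hx₀c
      hfrc
    have h2 := hbd _ hfr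
    have hinn : inner ℝ (s • e + q • N x₀) e = s := by
      rw [inner_add_left, real_inner_smul_left, real_inner_self_eq_norm_sq, he,
        real_inner_smul_left, real_inner_comm, heN]
      ring
    have hinN : inner ℝ (s • e + q • N x₀) (N x₀) = q := by
      rw [inner_add_left, real_inner_smul_left, heN, real_inner_smul_left,
        real_inner_self_eq_norm_sq, hN]
      ring
    simp only [add_sub_cancel_left, hinn, hinN, Real.norm_eq_abs, smul_eq_mul,
      h.eq_on_frontier ht' hx₀, h.eq_on_frontier ht' hfr, ← hH] at h1 h2
    have hD : sd1 (closure Ω) (fun y => u y t) x₀ (s • e + q • N x₀)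
        = sd1 (closure Ω) (fun y => φ y t) x₀ (s • e + q • N x₀) + q * p := by
      have := hρ.sd1_sub_eq h hx₀ ht (s • e + q • N x₀)
      rw [hinN, ← hp] at this
      linarith
    have hq2 : q ^ 2 ≤ A' ^ 2 * r * s ^ 3 := by
      calc q ^ 2 ≤ (A' * s ^ 2) ^ 2 := by gcongr
        _ = A' ^ 2 * s * s ^ 3 := by ring
        _ ≤ _ := by gcongr; exact hs.2
    have hsq : s * q ≤ A' * s ^ 3 := by
      calc s * q ≤ s * (A' * s ^ 2) := by gcongr
        _ = _ := by ring
    have h1' := h1.trans (show _ ≤ Cu * (1 + A' * r) ^ 3 * s ^ 3 by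
      calc _ ≤ Cu * ((1 + A' * r) * s) ^ 3 := by gcongr
        _ = _ := by ring)
    have hHX : |H (s • e + q • N x₀) (s • e + q • N x₀) - s ^ 2 * H e e|
        ≤ Cu * (2 * A' + A' ^ 2 * r) * s ^ 3 := by
      have e1 : H (s • e + q • N x₀) (s • e + q • N x₀) - s ^ 2 * H e e
          = s * q * H e (N x₀) + s * q * H (N x₀) e + q ^ 2 * H (N x₀) (N x₀) := by
        simp only [map_add, map_smul, add_apply, smul_apply, smul_eq_mul]
        ring
      rw [e1]
      have n1 := hHb e (N x₀)
      have n2 := hHb (N x₀) e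
      have n3 := hHb (N x₀) (N x₀)
      rw [he, hN, mul_one, mul_one] at n1 n2
      rw [hN, mul_one, mul_one] at n3
      have hsq0 : 0 ≤ s * q := by positivity
      calc _ ≤ |s * q * H e (N x₀)| + |s * q * H (N x₀) e| + |q ^ 2 * H (N x₀) (N x₀)| :=
            abs_add_three _ _ _
        _ ≤ A' * s ^ 3 * Cu + A' * s ^ 3 * Cu + A' ^ 2 * r * s ^ 3 * Cu := by
          rw [abs_mul, abs_mul (s * q), abs_mul (q ^ 2), abs_of_nonneg hsq0,
            abs_of_nonneg (sq_nonneg q)]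
          gcongr
        _ = _ := by ring
    have hlast : |s * inner ℝ a (q • N x₀)| + A * ‖q • N x₀‖ ^ 2
        ≤ (A * A' + A * A' ^ 2 * r) * s ^ 3 := by
      rw [norm_smul, hN, mul_one, Real.norm_of_nonneg hq0,
        real_inner_smul_right, abs_mul, abs_mul, abs_of_pos hs0, abs_of_nonneg hq0]
      have : |inner ℝ a (N x₀)| ≤ A := (abs_inner_le hN a).trans ha
      calc s * (q * |inner ℝ a (N x₀)|) + A * q ^ 2
          = s * q * |inner ℝ a (N x₀)| + A * q ^ 2 := by ring
        _ ≤ A' * s ^ 3 * A + A * (A' ^ 2 * r * s ^ 3) := by gcongr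
        _ = _ := by ring
    have hlast' := (add_le_add (le_abs_self _) le_rfl).trans hlast
    have hlast'' := (add_le_add (neg_le_abs _) le_rfl).trans hlast
    rw [hD] at h1'
    have hnn : 0 ≤ Cu * (2 * A' + A' ^ 2 * r) * s ^ 3 := by positivity
    rw [hK]
    rw [abs_le] at h1' h2 hHX ⊢
    constructor <;> linarith [h1'.1, h1'.2, h2.1, h2.2, hHX.1, hHX.2]
  have hμp : μ - p ≤ Aw + A := by
    have h1 := (abs_le.1 hμ).2
    have h2 := (abs_le.1 hw').1
    linarith
  constructor
  · have h0 : 2 * ε / R - H e e ≤ 0 := by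
      refine nonpos_of_le_mul (C := 2 * K) hr fun s hs => ?_
      obtain ⟨q, hq0, -, hsq, hE⟩ := hmain s hs
      have hs0 := hs.1
      have h1 := (abs_le.1 hE).1
      have h2 : ε / R * s ^ 2 ≤ q * (μ - p) := by
        calc ε / R * s ^ 2 ≤ ε / R * (R * q) := by gcongr
          _ = q * ε := by field_simp
          _ ≤ _ := by gcongr; linarith
      have h3 : s ^ 2 * (2 * ε / R - H e e) ≤ s ^ 2 * (2 * K * s) := by
        have : s ^ 2 * (2 * ε / R) = 2 * (ε / R * s ^ 2) := by ring
        rw [mul_sub, this]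
        linarith
      exact le_of_mul_le_mul_left h3 (by positivity)
    linarith
  · have h0 : H e e - 2 * (A' * (Aw + A)) ≤ 0 := by
      refine nonpos_of_le_mul (C := 2 * K) hr fun s hs => ?_
      obtain ⟨q, hq0, hq, -, hE⟩ := hmain s hs
      have hs0 := hs.1
      have h1 := (abs_le.1 hE).2
      have h2 : q * (μ - p) ≤ A' * s ^ 2 * (Aw + A) := by
        calc q * (μ - p) ≤ q * (Aw + A) := by gcongr
          _ ≤ _ := by gcongr
      have h3 : s ^ 2 * (H e e - 2 * (A' * (Aw + A))) ≤ s ^ 2 * (2 * K * s) := by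
        rw [mul_sub]
        linarith
      exact le_of_mul_le_mul_left h3 (by positivity)
    linarith

end DefiningFunction

end TangentialDerivatives

/-! ### Derivatives along an affine field -/

section DerivativeAlongField

variable {E : Type*} [NormedAddCommGroup E] [NormedSpace ℝ E]

lemma hasFDerivAt_affine (τ : E) (S : E →L[ℝ] E) (x₀ x : E) :
    HasFDerivAt (fun y => τ + S (y - x₀)) S x := by
  have h0 : HasFDerivAt (fun y : E => y - x₀) (ContinuousLinearMap.id ℝ E) x :=
    (hasFDerivAt_id x).sub_const x₀
  have := (S.hasFDerivAt (x := x - x₀) |>.comp x h0).const_add τ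
  rwa [ContinuousLinearMap.comp_id] at this

/-- First derivative of `f` along the affine field `τ + S (y - x₀)`. -/
lemma hasFDerivWithinAt_along {K : Set E} {f₁ : E → E →L[ℝ] ℝ} {f₂ : E →L[ℝ] E →L[ℝ] ℝ} {x : E}
    (h : HasFDerivWithinAt f₁ f₂ K x) (τ : E) (S : E →L[ℝ] E) (x₀ : E) :
    HasFDerivWithinAt (fun y => f₁ y (τ + S (y - x₀)))
      (f₂.flip (τ + S (x - x₀)) + (f₁ x).comp S) K x := by
  refine (h.clm_apply (hasFDerivAt_affine τ S x₀ x).hasFDerivWithinAt).congr_fderiv ?_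
  ext v
  simp [add_comm]

/-- Second derivative of `Df` along the affine field `τ + S (y - x₀)`, on the diagonal. -/
lemma exists_second_fderiv_along {f₁ : E → E →L[ℝ] ℝ} {f₂ : E → E →L[ℝ] E →L[ℝ] ℝ}
    {f₃ : E →L[ℝ] E →L[ℝ] E →L[ℝ] ℝ} {x : E} (h₁ : HasFDerivAt f₁ (f₂ x) x)
    (h₂ : HasFDerivAt f₂ f₃ x) (τ : E) (S : E →L[ℝ] E) (x₀ : E) :
    ∃ g : E →L[ℝ] E →L[ℝ] ℝ,
      HasFDerivAt (fun y => (f₂ y).flip (τ + S (y - x₀)) + (f₁ y).comp S) g x ∧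
      ∀ v, g v v = f₃ v v (τ + S (x - x₀)) + 2 * f₂ x v (S v) := by
  have hflip : HasFDerivAt (fun y => (f₂ y).flip) _ x :=
    (ContinuousLinearMap.flipₗᵢ ℝ E E ℝ).toContinuousLinearEquiv.toContinuousLinearMap
      |>.hasFDerivAt.comp x h₂
  have hcomp : HasFDerivAt (fun y => (f₁ y).comp S) _ x :=
    ((ContinuousLinearMap.compL ℝ E E ℝ).flip S).hasFDerivAt.comp x h₁
  refine ⟨_, (hflip.clm_apply (hasFDerivAt_affine τ S x₀ x)).add hcomp, fun v => ?_⟩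
  simp
  ring

end DerivativeAlongField

/-! ### Mixed second derivatives on the lateral boundary -/

section MixedDerivative

variable {n : ℕ} {Ω : Set (EuclideanSpace ℝ (Fin n))} {T c₀ θ M : ℝ}
    {φ ψ u : EuclideanSpace ℝ (Fin n) → ℝ → ℝ}

namespace SolutionData

/-- The equation differentiated in the direction `V`, in an eigenbasis of `D²u`. -/
lemma sum_diagCofactor_sd3 (h : SolutionData Ω T c₀ θ M φ ψ u) {t : ℝ} (ht : t ∈ Ioc 0 T)
    {x : EuclideanSpace ℝ (Fin n)} (hx : x ∈ Ω)
    (hH : (formMatrix (sd2 (closure Ω) (fun y => u y t) x)).IsHermitian)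
    (V : EuclideanSpace ℝ (Fin n)) :
    ∑ i, diagCofactor hH.eigenvalues i * sd3 (closure Ω) (fun y => u y t) x
        (hH.eigenvectorBasis i) (hH.eigenvectorBasis i) V
      = sd1 (closure Ω) (fun y => timeDeriv T u y t) x V
        + sd1 (closure Ω) (fun y => ψ y t) x V := by
  have ht' := Ioc_subset_Icc_self ht
  have hxc := subset_closure hx
  have hKi := closure_subset_closure_interior h.isOpen
  have hnh := closure_mem_nhds h.isOpen hx
  have hline : HasDerivAt (fun r : ℝ => x + r • V) V 0 := by
    simpa using ((hasDerivAt_id (0 : ℝ)).smul_const V).const_add x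
  have hx0 : x + (0 : ℝ) • V = x := by simp
  have h3 : HasFDerivAt (sd2 (closure Ω) (fun y => u y t)) (sd3 (closure Ω) (fun y => u y t) x)
      (x + (0 : ℝ) • V) := by
    rw [hx0]
    exact (hasFDerivWithinAt_sd3 (m := 1) h.uniqueDiff (h.u_slice ht') hxc).hasFDerivAt hnh
  have hB : HasDerivWithinAt (fun r : ℝ => sd2 (closure Ω) (fun y => u y t) (x + r • V))
      (sd3 (closure Ω) (fun y => u y t) x V) univ 0 :=
    (h3.comp_hasDerivAt (0 : ℝ) hline).hasDerivWithinAt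
  have key : ∀ (B : ℝ → EuclideanSpace ℝ (Fin n) →L[ℝ] EuclideanSpace ℝ (Fin n) →L[ℝ] ℝ)
      (_ : HasDerivWithinAt B (sd3 (closure Ω) (fun y => u y t) x V) univ 0)
      (_ : B 0 = sd2 (closure Ω) (fun y => u y t) x),
      HasDerivWithinAt (fun r => (formMatrix (B r)).det)
        (∑ i, diagCofactor hH.eigenvalues i * sd3 (closure Ω) (fun y => u y t) x V
          (hH.eigenvectorBasis i) (hH.eigenvectorBasis i)) univ 0 := by
    intro B hB h0
    revert hH
    rw [← h0]
    intro hH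
    exact hasDerivWithinAt_det_formMatrix hB hH
  have hdet := (key _ hB (by simp only [hx0])).hasDerivAt Filter.univ_mem
  have hut : HasFDerivAt (fun y => timeDeriv T u y t)
      (sd1 (closure Ω) (fun y => timeDeriv T u y t) x) (x + (0 : ℝ) • V) := by
    rw [hx0]
    exact (hasFDerivWithinAt_sd1 (m := 1) (h.ut_slice ht') hxc).hasFDerivAt hnh
  have hψ : HasFDerivAt (fun y => ψ y t) (sd1 (closure Ω) (fun y => ψ y t) x)
      (x + (0 : ℝ) • V) := by
    rw [hx0]
    exact (hasFDerivWithinAt_sd1 (m := 3) (h.ψ_slice ht') hxc).hasFDerivAt hnh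
  have hrhs := (hut.add hψ).comp_hasDerivAt (0 : ℝ) hline
  have hev : (fun r : ℝ => (formMatrix (sd2 (closure Ω) (fun y => u y t) (x + r • V))).det)
      =ᶠ[nhds 0] ((fun y => timeDeriv T u y t) + fun y => ψ y t) ∘ fun r : ℝ => x + r • V := by
    have hc : Filter.Tendsto (fun r : ℝ => x + r • V) (nhds 0) (nhds x) := by
      have := hline.continuousAt.tendsto
      rwa [hx0] at this
    filter_upwards [hc.eventually (h.isOpen.mem_nhds hx)] with r hr
    exact h.equation ht (subset_closure hr)
  have huniq := hdet.unique (hrhs.congr_of_eventuallyEq hev)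
  rw [add_apply] at huniq
  rw [← huniq]
  refine Finset.sum_congr rfl fun i _ => ?_
  rw [sd3_rotate (m := 1) h.uniqueDiff hKi (h.u_slice ht') hxc]

end SolutionData

namespace DefiningFunction

variable {ρ : EuclideanSpace ℝ (Fin n) → ℝ}
    {ρ₁ : EuclideanSpace ℝ (Fin n) → EuclideanSpace ℝ (Fin n) →L[ℝ] ℝ}
    {ρ₂ : EuclideanSpace ℝ (Fin n) → EuclideanSpace ℝ (Fin n) →L[ℝ]
      EuclideanSpace ℝ (Fin n) →L[ℝ] ℝ}
    {ρ₃ : EuclideanSpace ℝ (Fin n) → EuclideanSpace ℝ (Fin n) →L[ℝ]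
      EuclideanSpace ℝ (Fin n) →L[ℝ] EuclideanSpace ℝ (Fin n) →L[ℝ] ℝ}
    {ρ₄ : EuclideanSpace ℝ (Fin n) → EuclideanSpace ℝ (Fin n) →L[ℝ]
      EuclideanSpace ℝ (Fin n) →L[ℝ] EuclideanSpace ℝ (Fin n) →L[ℝ]
      EuclideanSpace ℝ (Fin n) →L[ℝ] ℝ}
    {N : EuclideanSpace ℝ (Fin n) → EuclideanSpace ℝ (Fin n)} {C D κ p₀ : ℝ}

/-- Barrier for the derivative of `u - φ` along a field `V = τ + S (x - x₀)` with `S` skew. Skewness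
makes the linearized operator send `D_V u` to `D_V ψ`. Its cofactors have sum at least
`min 1 (min c₀ (θ ^ n))`, and `A` is so large that the contribution of the quadratic dominates those
of `D_V ψ` and `D_V φ`. -/
lemma barrier_along_nonneg (hn : 1 ≤ n) (h : SolutionData Ω T c₀ θ M φ ψ u)
    {x₀ N₀ τ : EuclideanSpace ℝ (Fin n)}
    {S : EuclideanSpace ℝ (Fin n) →L[ℝ] EuclideanSpace ℝ (Fin n)}
    {A As R B v₀ σ : ℝ} (hσ : |σ| = 1) (hB : 0 ≤ B)
    (henc : ∀ x ∈ closure Ω, ‖x - x₀‖ ^ 2 ≤ R * inner ℝ (x - x₀) N₀)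
    (hskew : ∀ v, inner ℝ (S v) v = 0) (hS : ‖S‖ ≤ As)
    (hV : ∀ x ∈ closure Ω, ‖τ + S (x - x₀)‖ ≤ v₀)
    (hbd : ∀ x ∈ frontier Ω, ∀ t ∈ Ioc 0 T,
      |sd1 (closure Ω) (fun y => u y t) x (τ + S (x - x₀))
        - sd1 (closure Ω) (fun y => φ y t) x (τ + S (x - x₀))| ≤ B * ‖x - x₀‖ ^ 2)
    (hA : 2 * A = M * v₀ + 2 * (M * As) + (2 * (M * v₀) + 1) / min 1 (min c₀ (θ ^ n)))
    {x : EuclideanSpace ℝ (Fin n)} (hx : x ∈ closure Ω) {t : ℝ} (ht : t ∈ Icc 0 T) :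
    0 ≤ (A + B) * R * inner ℝ (x - x₀) N₀ - A * inner ℝ (x - x₀) (x - x₀)
      + σ * (sd1 (closure Ω) (fun y => u y t) x (τ + S (x - x₀))
        - sd1 (closure Ω) (fun y => φ y t) x (τ + S (x - x₀))) := by
  have hM := h.M_nonneg
  have hm : 0 < min 1 (min c₀ (θ ^ n)) :=
    lt_min one_pos (lt_min h.c₀_pos (pow_pos h.θ_pos n))
  have hv₀ : 0 ≤ v₀ := (norm_nonneg _).trans (hV x hx)
  have hAs : 0 ≤ As := (norm_nonneg _).trans hS
  have hA0 : 0 ≤ A := by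
    have : 0 ≤ M * v₀ + 2 * (M * As) + (2 * (M * v₀) + 1) / min 1 (min c₀ (θ ^ n)) := by
      positivity
    linarith
  refine le_of_no_interior_min (w := fun x t => (A + B) * R * inner ℝ (x - x₀) N₀
    - A * inner ℝ (x - x₀) (x - x₀) + σ * (sd1 (closure Ω) (fun y => u y t) x (τ + S (x - x₀))
        - sd1 (closure Ω) (fun y => φ y t) x (τ + S (x - x₀)))) h.bounded ?_ ?_ ?_ hx ht
  · have h1 := h.u_mem.continuousOn_sd1 h.uniqueDiff (s := 0) (by omega)
    have h2 := h.φ_mem.continuousOn_sd1 h.uniqueDiff (s := 0) (by omega)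
    simp only [timeSlice_zero] at h1 h2
    have hVc : ContinuousOn (fun p : EuclideanSpace ℝ (Fin n) × ℝ => τ + S (p.1 - x₀))
        (closedCylinder Ω T) := Continuous.continuousOn (by fun_prop)
    refine ContinuousOn.add (Continuous.continuousOn (by fun_prop)) ?_
    exact continuousOn_const.mul ((h1.clm_apply hVc).sub (h2.clm_apply hVc))
  · have hq : ∀ y ∈ closure Ω, B * ‖y - x₀‖ ^ 2 ≤ (A + B) * R * inner ℝ (y - x₀) N₀
        - A * inner ℝ (y - x₀) (y - x₀) := fun y hy => by
      have := mul_le_mul_of_nonneg_left (henc y hy) (by positivity : 0 ≤ A + B)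
      rw [real_inner_self_eq_norm_sq]
      linarith
    have hini : ∀ y ∈ closure Ω, 0 ≤ (A + B) * R * inner ℝ (y - x₀) N₀
        - A * inner ℝ (y - x₀) (y - x₀)
        + σ * (sd1 (closure Ω) (fun y => u y 0) y (τ + S (y - x₀))
          - sd1 (closure Ω) (fun y => φ y 0) y (τ + S (y - x₀))) := fun y hy => by
      rw [h.sd1_initial hy, sub_self, mul_zero, add_zero]
      exact le_trans (by positivity) (hq y hy)
    rintro ⟨y, s⟩ (⟨hy, hs⟩ | ⟨hy, hs⟩)
    · have hs0 : s = 0 := hs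
      subst hs0
      exact hini y hy
    · rcases eq_or_lt_of_le hs.1 with h0 | h0
      · have hs0 : s = 0 := h0.symm
        subst hs0
        exact hini y (frontier_subset_closure hy)
      · have h1 := hbd y hy s ⟨h0, hs.2⟩
        have h2 := hq y (frontier_subset_closure hy)
        have h3 := neg_abs_le (σ * (sd1 (closure Ω) (fun y => u y s) y (τ + S (y - x₀))
          - sd1 (closure Ω) (fun y => φ y s) y (τ + S (y - x₀))))
        rw [abs_mul, hσ, one_mul] at h3
        simp only
        linarith
  · intro y hy s hs hmin
    have hs' : s ∈ Icc 0 T := Ioc_subset_Icc_self hs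
    have hyc := subset_closure hy
    have hH := h.u_isHermitian hs' hyc
    have hnh : ∀ z ∈ Ω, closure Ω ∈ nhds z := fun z hz => closure_mem_nhds h.isOpen hz
    obtain ⟨b, hb⟩ := exists_form (E := EuclideanSpace ℝ (Fin n)) 0 (-A) 0
    have hK := h.uniqueDiff
    have hus := h.u_slice hs'
    have hφs := h.φ_slice hs'
    -- second derivative in space of the two parts of the barrier
    obtain ⟨g, hg, hgv⟩ := exists_second_fderiv_along
      ((hasFDerivWithinAt_sd2 (m := 2) hK hus hyc).hasFDerivAt (hnh y hy))
      ((hasFDerivWithinAt_sd3 (m := 1) hK hus hyc).hasFDerivAt (hnh y hy)) τ S x₀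
    obtain ⟨k, hk, hkv⟩ := exists_second_fderiv_along
      ((hasFDerivWithinAt_sd2 (m := 2) hK hφs hyc).hasFDerivAt (hnh y hy))
      ((hasFDerivWithinAt_sd3 (m := 1) hK hφs hyc).hasFDerivAt (hnh y hy)) τ S x₀
    have hlm : IsLocalMin (fun z => ((((A + B) * R) • innerSL ℝ N₀) (z - x₀)
        + b (z - x₀) (z - x₀)) + σ * (sd1 (closure Ω) (fun y => u y s) z (τ + S (z - x₀))
        - sd1 (closure Ω) (fun y => φ y s) z (τ + S (z - x₀)))) y := by
      filter_upwards [h.isOpen.mem_nhds hy] with z hz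
      have := hmin z (subset_closure hz) s hs'
      simp only [smul_apply, innerSL_apply_apply, smul_eq_mul, hb, real_inner_comm _ N₀]
      linarith
    have hsp := second_fderiv_nonneg_of_isLocalMin (by
      filter_upwards [h.isOpen.mem_nhds hy] with z hz
      exact (hasFDerivAt_quadratic _ b x₀ z).add
        (((hasFDerivWithinAt_along (hasFDerivWithinAt_sd2 (m := 2) hK hus (subset_closure hz))
          τ S x₀).hasFDerivAt (hnh z hz)).sub
        ((hasFDerivWithinAt_along (hasFDerivWithinAt_sd2 (m := 2) hK hφs (subset_closure hz))
          τ S x₀).hasFDerivAt (hnh z hz)) |>.const_mul σ))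
      ((hasFDerivAt_fderiv_quadratic _ b x₀ y).add ((hg.sub hk).const_smul σ)) hlm
    -- first derivative in time
    have htm := deriv_time_nonpos_of_min hs
      (((((h.u_mem.hasDerivWithinAt_sd1 h.isOpen hK hy hs').clm_apply
        (hasDerivWithinAt_const s (Icc 0 T) (τ + S (y - x₀)))).sub
        ((h.φ_mem.hasDerivWithinAt_sd1 h.isOpen hK hy hs').clm_apply
        (hasDerivWithinAt_const s (Icc 0 T) (τ + S (y - x₀))))).const_mul σ).const_add
        ((A + B) * R * inner ℝ (y - x₀) N₀ - A * inner ℝ (y - x₀) (y - x₀)))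
      (fun r hr => hmin y hyc r hr)
    simp only [map_zero, add_zero] at htm
    have hVy := hV y hyc
    have heq := h.sum_diagCofactor_sd3 hs hy hH (τ + S (y - x₀))
    obtain ⟨V, hVd⟩ : ∃ V, V = τ + S (y - x₀) := ⟨_, rfl⟩
    rw [← hVd] at hgv hkv htm hVy heq
    have hl0 : ∀ i, 0 ≤ hH.eigenvalues i :=
      le_eigenvalue hH (by simpa using h.u_nonneg hs' hyc)
    have hμ0 : ∀ i, 0 ≤ diagCofactor hH.eigenvalues i := diagCofactor_nonneg hl0
    have hμ : min 1 (min c₀ (θ ^ n)) ≤ ∑ i, diagCofactor hH.eigenvalues i := by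
      refine min_one_le_sum_diagCofactor hn hl0 ?_
      rw [← det_formMatrix_eq_prod hH]
      exact h.le_det hs' hyc
    have hψV : σ * sd1 (closure Ω) (fun z => ψ z s) y V ≤ M * v₀ := by
      refine (le_abs_self _).trans ?_
      rw [abs_mul, hσ, one_mul]
      refine (abs_apply_le (h.ψ₁_le y hyc s hs') V).trans ?_
      gcongr
    have hφtV : σ * sd1 (closure Ω) (fun z => timeDeriv T φ z s) y V ≤ M * v₀ := by
      refine (le_abs_self _).trans ?_
      rw [abs_mul, hσ, one_mul]
      refine (abs_apply_le (h.φt₁_le y hy s hs) V).trans ?_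
      gcongr
    -- second order condition in the eigenbasis
    have hterm : ∀ i, 0 ≤ diagCofactor hH.eigenvalues i * (-(2 * A))
        + σ * (diagCofactor hH.eigenvalues i * sd3 (closure Ω) (fun z => u z s) y
          (hH.eigenvectorBasis i) (hH.eigenvectorBasis i) V)
        + diagCofactor hH.eigenvalues i * (M * v₀ + 2 * (M * As)) := by
      intro i
      obtain ⟨e, he⟩ : ∃ e, e = hH.eigenvectorBasis i := ⟨_, rfl⟩
      have he1 : ‖e‖ = 1 := by rw [he]; exact hH.eigenvectorBasis.orthonormal.1 i
      have hSe : ‖S e‖ ≤ As := by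
        have := S.le_of_opNorm_le hS e
        rwa [he1, mul_one] at this
      -- skewness of `S` in the eigenbasis
      have hz : sd2 (closure Ω) (fun z => u z s) y e (S e) = 0 := by
        rw [h.u_symm hs' hyc, he, form_eigenvectorBasis hH, hskew, mul_zero]
      have h1 := hsp e
      simp only [add_apply, smul_apply, sub_apply, ContinuousLinearMap.flip_apply, hb, hgv, hkv,
        real_inner_self_eq_norm_sq, he1, hz, smul_eq_mul] at h1
      have h2 : -(σ * (sd3 (closure Ω) (fun z => φ z s) y e e V
          + 2 * sd2 (closure Ω) (fun z => φ z s) y e (S e))) ≤ M * v₀ + 2 * (M * As) := by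
        refine (neg_le_abs _).trans ?_
        rw [abs_mul, hσ, one_mul]
        refine (abs_add_le _ _).trans ?_
        have n1 := abs_apply₃_le (h.φ₃_le y hy s hs) e e V
        have n2 := abs_apply₂_le (h.φ₂_le y hy s hs) e (S e)
        rw [he1, mul_one] at n1 n2
        rw [mul_one] at n1
        rw [abs_mul, abs_two]
        have n3 : M * ‖V‖ ≤ M * v₀ := by gcongr
        have n4 : M * ‖S e‖ ≤ M * As := by gcongr
        linarith
      rw [← he]
      have h3 : 0 ≤ -(2 * A) + σ * sd3 (closure Ω) (fun z => u z s) y e e V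
          + (M * v₀ + 2 * (M * As)) := by linarith
      have h4 := mul_nonneg (hμ0 i) h3
      linarith
    have hsum := Finset.sum_nonneg fun i (_ : i ∈ Finset.univ) => hterm i
    rw [Finset.sum_add_distrib, Finset.sum_add_distrib, ← Finset.sum_mul, ← Finset.sum_mul,
      ← Finset.mul_sum, heq] at hsum
    obtain ⟨s₁, hs₁⟩ : ∃ q, q = ∑ i, diagCofactor hH.eigenvalues i := ⟨_, rfl⟩
    rw [← hs₁] at hsum hμ
    have hq : 2 * (M * v₀) + 1 ≤ s₁ * ((2 * (M * v₀) + 1) / min 1 (min c₀ (θ ^ n))) := by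
      rw [mul_div_assoc', le_div_iff₀ hm, mul_comm]
      exact mul_le_mul_of_nonneg_right hμ (by positivity)
    have hexp : s₁ * (2 * A) = s₁ * (M * v₀ + 2 * (M * As))
        + s₁ * ((2 * (M * v₀) + 1) / min 1 (min c₀ (θ ^ n))) := by rw [hA]; ring
    linarith

/-- Bound for the mixed tangential-normal second derivatives of `u` on the lateral boundary. -/
lemma exists_mixed_bound (hn : 1 ≤ n)
    (hρ : DefiningFunction Ω ρ ρ₁ ρ₂ ρ₃ ρ₄ N C D κ p₀) (c₀ θ M : ℝ) :
    ∃ A : ℝ, 0 ≤ A ∧ ∀ {T : ℝ}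
      {φ ψ u : EuclideanSpace ℝ (Fin n) → ℝ → ℝ}, SolutionData Ω T c₀ θ M φ ψ u →
      ∀ x₀ ∈ frontier Ω, ∀ t ∈ Ioc 0 T, ∀ τ : EuclideanSpace ℝ (Fin n),
      ‖τ‖ = 1 → inner ℝ τ (N x₀) = 0 →
      |sd2 (closure Ω) (fun y => u y t) x₀ τ (N x₀)| ≤ A := by
  obtain ⟨R, hR, henc⟩ := hρ.exists_enclosing
  obtain ⟨Aw, hAw, hw⟩ := hρ.exists_normal_deriv_le hn M
  obtain ⟨r, hr, hin⟩ := hρ.exists_inward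
  obtain ⟨As, hAs, hrot⟩ := hρ.exists_rotation
  obtain ⟨v₀, hv₀⟩ : ∃ v, v = 1 + As * (2 * D) := ⟨_, rfl⟩
  obtain ⟨A, hA⟩ : ∃ A, 2 * A = M * v₀ + 2 * (M * As)
    + (2 * (M * v₀) + 1) / min 1 (min c₀ (θ ^ n)) := ⟨_, mul_div_cancel₀ _ two_ne_zero⟩
  refine ⟨max 0 ((A + As * Aw) * R + M), le_max_left _ _, ?_⟩
  intro T φ ψ u h x₀ hx₀ t ht τ hτ hτN
  have ht' := Ioc_subset_Icc_self ht
  have hx₀c := frontier_subset_closure hx₀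
  have hN := hρ.norm_normal x₀ hx₀
  obtain ⟨S, hskew, hS, hSN⟩ := hrot x₀ hx₀ τ hτ hτN
  have hV : ∀ x ∈ closure Ω, ‖τ + S (x - x₀)‖ ≤ v₀ := fun x hx => by
    calc _ ≤ ‖τ‖ + ‖S (x - x₀)‖ := norm_add_le _ _
      _ ≤ 1 + As * (2 * D) := by
        have h1 := S.le_of_opNorm_le hS (x - x₀)
        have h2 := mul_le_mul_of_nonneg_left (hρ.norm_sub_le hx hx₀c) hAs
        linarith
      _ = _ := hv₀.symm
  have hbd : ∀ x ∈ frontier Ω, ∀ s ∈ Ioc 0 T,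
      |sd1 (closure Ω) (fun y => u y s) x (τ + S (x - x₀))
        - sd1 (closure Ω) (fun y => φ y s) x (τ + S (x - x₀))| ≤ As * Aw * ‖x - x₀‖ ^ 2 := by
    intro x hx s hs
    rw [hρ.sd1_sub_eq h hx hs, abs_mul]
    calc _ ≤ (As * ‖x - x₀‖ ^ 2) * Aw :=
          mul_le_mul (hSN x hx) (hw h x hx s hs) (abs_nonneg _) (by positivity)
      _ = _ := by ring
  have hside : ∀ σ : ℝ, |σ| = 1 →
      0 ≤ (A + As * Aw) * R + M + σ * sd2 (closure Ω) (fun y => u y t) x₀ τ (N x₀) := by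
    intro σ hσ
    obtain ⟨b, hb⟩ := exists_form (E := EuclideanSpace ℝ (Fin n)) 0 (-A) 0
    have hu2 := hasFDerivWithinAt_along
      (hasFDerivWithinAt_sd2 (m := 2) h.uniqueDiff (h.u_slice ht') hx₀c) τ S x₀
    have hφ2 := hasFDerivWithinAt_along
      (hasFDerivWithinAt_sd2 (m := 2) h.uniqueDiff (h.φ_slice ht') hx₀c) τ S x₀
    have hz : sd1 (closure Ω) (fun y => u y t) x₀ τ
        - sd1 (closure Ω) (fun y => φ y t) x₀ τ = 0 := by
      rw [hρ.sd1_sub_eq h hx₀ ht, hτN, zero_mul]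
    have hzS : sd1 (closure Ω) (fun y => u y t) x₀ (S (N x₀))
        - sd1 (closure Ω) (fun y => φ y t) x₀ (S (N x₀)) = 0 := by
      rw [hρ.sd1_sub_eq h hx₀ ht, hskew, zero_mul]
    have h1 := fderiv_inward_nonneg h.convex.closure (v := N x₀)
      ((hasFDerivAt_quadratic (((A + As * Aw) * R) • innerSL ℝ (N x₀)) b x₀
        x₀).hasFDerivWithinAt.add ((hu2.sub hφ2).const_mul σ)) hx₀c hr
        (subset_closure (hin x₀ hx₀ r ⟨hr, le_rfl⟩)) (by
          intro y hy
          have h2 := barrier_along_nonneg hn h hσ (by positivity) (henc x₀ hx₀) hskew hS hV hbd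
            hA hy ht'
          simp only [Pi.add_apply, Pi.sub_apply, sub_self, smul_apply, map_zero,
            innerSL_apply_apply, smul_eq_mul, hb, real_inner_comm _ (N x₀), zero_apply,
            inner_zero_left, mul_zero, add_zero, hz]
          linarith)
    simp only [sub_self, map_zero, add_zero, add_apply, sub_apply, smul_apply,
      innerSL_apply_apply, smul_eq_mul, real_inner_self_eq_norm_sq, hN,
      ContinuousLinearMap.flip_apply, ContinuousLinearMap.comp_apply] at h1
    have h2 : -(σ * sd2 (closure Ω) (fun y => φ y t) x₀ (N x₀) τ) ≤ M := by
      refine (neg_le_abs _).trans ?_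
      rw [abs_mul, hσ, one_mul]
      have := abs_apply₂_le (h.norm_φ₂_le hx₀c ht') (N x₀) τ
      rwa [hN, hτ, mul_one, mul_one] at this
    rw [h.u_symm ht' hx₀c τ]
    have h3 : σ * (sd1 (closure Ω) (fun y => u y t) x₀ (S (N x₀))
        - sd1 (closure Ω) (fun y => φ y t) x₀ (S (N x₀))) = 0 := by rw [hzS, mul_zero]
    linarith
  refine le_trans ?_ (le_max_right _ _)
  have h1 := hside 1 (by simp)
  have h2 := hside (-1) (by simp)
  rw [abs_le]
  constructor <;> linarith

end DefiningFunction

end MixedDerivative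

/-! ### Eigenvalue bounds on the parabolic boundary -/

section EigenvalueBounds

variable {n : ℕ}

/-- Eigenvalue bounds on the lateral boundary at positive times. -/
lemma DefiningFunction.exists_lateral_bounds (hn : 1 ≤ n) {Ω : Set (EuclideanSpace ℝ (Fin n))}
    {ρ : EuclideanSpace ℝ (Fin n) → ℝ}
    {ρ₁ : EuclideanSpace ℝ (Fin n) → EuclideanSpace ℝ (Fin n) →L[ℝ] ℝ}
    {ρ₂ : EuclideanSpace ℝ (Fin n) → EuclideanSpace ℝ (Fin n) →L[ℝ]
      EuclideanSpace ℝ (Fin n) →L[ℝ] ℝ}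
    {ρ₃ : EuclideanSpace ℝ (Fin n) → EuclideanSpace ℝ (Fin n) →L[ℝ]
      EuclideanSpace ℝ (Fin n) →L[ℝ] EuclideanSpace ℝ (Fin n) →L[ℝ] ℝ}
    {ρ₄ : EuclideanSpace ℝ (Fin n) → EuclideanSpace ℝ (Fin n) →L[ℝ]
      EuclideanSpace ℝ (Fin n) →L[ℝ] EuclideanSpace ℝ (Fin n) →L[ℝ]
      EuclideanSpace ℝ (Fin n) →L[ℝ] ℝ}
    {N : EuclideanSpace ℝ (Fin n) → EuclideanSpace ℝ (Fin n)} {C D κ p₀ : ℝ}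
    (hρ : DefiningFunction Ω ρ ρ₁ ρ₂ ρ₃ ρ₄ N C D κ p₀) {c₀ θ M : ℝ} (hc₀ : 0 < c₀) (hθ : 0 < θ)
    (hM : 0 ≤ M) :
    ∃ l L : ℝ, 0 < l ∧ 0 < L ∧ ∀ {T : ℝ} {φ ψ u : EuclideanSpace ℝ (Fin n) → ℝ → ℝ},
      SolutionData Ω T c₀ θ M φ ψ u → ∀ x ∈ frontier Ω, ∀ t ∈ Ioc 0 T,
      ∀ (hH : (formMatrix (sd2 (closure Ω) (fun y => u y t) x)).IsHermitian) (i : Fin n),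
        l ≤ hH.eigenvalues i ∧ hH.eigenvalues i ≤ L := by
  obtain ⟨c, A₁, hc, hA₁, htan⟩ := hρ.exists_tangential_bounds hn hc₀ hθ M
  obtain ⟨A₂, hA₂, hmix⟩ := hρ.exists_mixed_bound hn c₀ θ M
  obtain ⟨L, hL, hbd⟩ := form_le_of_hyperplane (n := n) hc (C := max A₁ A₂)
    (hA₁.trans (le_max_left _ _)) (M := 2 * M) (by positivity)
  have hc₁ : 0 < min c₀ (θ ^ n) := lt_min hc₀ (pow_pos hθ n)
  refine ⟨min c₀ (θ ^ n) / L ^ (n - 1), L, by positivity, hL, ?_⟩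
  intro T φ ψ u h x hx t ht hH i
  have ht' := Ioc_subset_Icc_self ht
  have hxc := frontier_subset_closure hx
  have hle : ∀ j, hH.eigenvalues j ≤ L := hbd (h.u_symm ht' hxc) (N x) (hρ.norm_normal x hx)
    (fun e he heN => ⟨(htan h x hx t ht e he heN).1,
      (htan h x hx t ht e he heN).2.trans (le_max_left _ _),
      (hmix h x hx t ht e he heN).trans (le_max_right _ _)⟩) (by
      rw [h.equation ht hxc, h.timeDeriv_frontier ht' hx]
      have h1 := (abs_le.1 (h.abs_φt_le hxc ht')).2
      have h2 := (abs_le.1 (h.ψ_le x hxc t ht')).2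
      linarith) hH
  refine ⟨?_, hle i⟩
  rw [div_le_iff₀ (by positivity)]
  refine le_trans ?_ (prod_le_mul_pow (le_eigenvalue hH (by simpa using h.u_nonneg ht' hxc)) hle i)
  rw [← det_formMatrix_eq_prod hH]
  exact h.le_det ht' hxc

/-- Eigenvalue bounds at the initial time, where `D²u = D²φ`. -/
lemma SolutionData.initial_bounds {Ω : Set (EuclideanSpace ℝ (Fin n))} {T c₀ θ M : ℝ}
    {φ ψ u : EuclideanSpace ℝ (Fin n) → ℝ → ℝ} (h : SolutionData Ω T c₀ θ M φ ψ u)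
    {x : EuclideanSpace ℝ (Fin n)} (hx : x ∈ closure Ω)
    (hH : (formMatrix (sd2 (closure Ω) (fun y => u y 0) x)).IsHermitian) (i : Fin n) :
    θ ≤ hH.eigenvalues i ∧ hH.eigenvalues i ≤ M := by
  refine ⟨le_eigenvalue hH (h.sd2_initial_ge hx) i, eigenvalue_le hH (fun v => ?_) i⟩
  rw [h.sd2_initial hx, sq, ← mul_assoc]
  exact (le_abs_self _).trans (abs_apply₂_le (h.norm_φ₂_le hx ⟨le_rfl, h.T_pos.le⟩) v v)

/-- The hypotheses on `φ`, `ψ` and `u` give the data with a constant `M` that depends only on `n`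
and the given norms: operator norms of derivatives of order `j` cost a factor `n ^ j`. -/
lemma exists_solutionData {Ω : Set (EuclideanSpace ℝ (Fin n))} (hΩ : IsUniformlyConvexDomain Ω)
    {T : ℝ} (hT : 0 < T) {c₀ : ℝ} (hc₀ : 0 < c₀) {θ : ℝ} (hθ : 0 < θ) (Mφ Mψ MDψ : ℝ≥0) :
    ∃ M : ℝ, 0 ≤ M ∧ ∀ φ ψ u : EuclideanSpace ℝ (Fin n) → ℝ → ℝ,
      SmoothOnClosedCylinder Ω T φ → SmoothOnClosedCylinder Ω T ψ →
      (∀ x ∈ frontier Ω, ∀ t ∈ Icc 0 T, c₀ ≤ timeDeriv T φ x t + ψ x t) →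
      InitiallyUniformlyConvex Ω θ φ →
      (∀ t ∈ Icc 0 T, ConcaveOn ℝ (closure Ω) (fun x => ψ x t)) →
      parabolicNorm 4 Ω T φ ≤ Mφ →
      eLpNorm (fun p : EuclideanSpace ℝ (Fin n) × ℝ => ψ p.1 p.2) ⊤
        (volume.restrict (parabolicCylinder Ω T)) ≤ Mψ →
      eLpNorm (fun p : EuclideanSpace ℝ (Fin n) × ℝ => spaceDeriv Ω ψ p.1 p.2) ⊤
        (volume.restrict (parabolicCylinder Ω T)) ≤ MDψ →
      MemParabolicC 4 Ω T u →
      (∀ t ∈ Icc 0 T, ConvexOn ℝ (closure Ω) (fun x => u x t)) →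
      IsSolution Ω T φ ψ u → SolutionData Ω T c₀ θ M φ ψ u := by
  have hK := uniqueDiffOn_closure hΩ.isOpen hΩ.convex hΩ.nonempty
  have hn : (0 : ℝ) ≤ n := n.cast_nonneg
  obtain ⟨m₁, hm₁⟩ : ∃ m : ℝ, m = n * Mφ := ⟨_, rfl⟩
  obtain ⟨m₂, hm₂⟩ : ∃ m : ℝ, m = n * (n * Mφ) := ⟨_, rfl⟩
  obtain ⟨m₃, hm₃⟩ : ∃ m : ℝ, m = n * (n * (n * Mφ)) := ⟨_, rfl⟩
  obtain ⟨m₄, hm₄⟩ : ∃ m : ℝ, m = n * (n * (n * (n * Mφ))) := ⟨_, rfl⟩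
  have p₁ : 0 ≤ m₁ := by rw [hm₁]; positivity
  have p₂ : 0 ≤ m₂ := by rw [hm₂]; positivity
  have p₃ : 0 ≤ m₃ := by rw [hm₃]; positivity
  have p₄ : 0 ≤ m₄ := by rw [hm₄]; positivity
  have p₀ : (0 : ℝ) ≤ Mφ := Mφ.2
  have q₀ : (0 : ℝ) ≤ Mψ := Mψ.2
  have q₁ : (0 : ℝ) ≤ MDψ := MDψ.2
  refine ⟨Mφ + m₁ + m₂ + m₃ + m₄ + Mψ + MDψ, by positivity, ?_⟩
  intro φ ψ u hφ hψ hlat hini hconc hφM hψM hDψM hu hconv hsol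
  have hψ' := hψ.memParabolicC hT hK 4
  have hψc := hψ'.continuousOn_timeSlice (s := 0) (by omega)
  have hψ₁c := hψ'.continuousOn_sd1 hK (s := 0) (by omega)
  simp only [timeSlice_zero] at hψc hψ₁c
  refine
    { isOpen := hΩ.isOpen
      convex := hΩ.convex
      bounded := hΩ.bounded
      nonempty := hΩ.nonempty
      T_pos := hT
      c₀_pos := hc₀
      θ_pos := hθ
      φ_mem := hφ.memParabolicC hT hK 4
      ψ_mem := hψ'
      u_mem := hu
      lateral := hlat
      initial := hini
      ψ_concave := hconc
      u_convex := hconv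
      sol := hsol
      φ_le := fun x hx t ht => ?_
      φt_le := fun x hx t ht => ?_
      φ₁_le := fun x hx t ht => ?_
      φ₂_le := fun x hx t ht => ?_
      φ₃_le := fun x hx t ht => ?_
      φ₄_le := fun x hx t ht => ?_
      φt₁_le := fun x hx t ht => ?_
      ψ_le := fun x hx t ht => ?_
      ψ₁_le := fun x hx t ht => ?_ }
  · have := abs_timeSlice_le hφM (s := 0) (by omega) hx ht
    rw [timeSlice_zero] at this
    linarith
  · have := abs_timeSlice_le hφM (s := 1) (by omega) hx ht
    rw [timeSlice_one] at this
    linarith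
  · have := norm_sd1_le hK hφM (s := 0) (by omega) hx ht
    rw [timeSlice_zero] at this
    linarith
  · have := norm_sd2_le hK hφM (s := 0) (by omega) hx ht
    rw [timeSlice_zero] at this
    linarith
  · have := norm_sd3_le hK hφM (s := 0) (by omega) hx ht
    rw [timeSlice_zero] at this
    linarith
  · have := norm_sd4_le hK hφM (s := 0) (by omega) hx ht
    rw [timeSlice_zero] at this
    linarith
  · have := norm_sd1_le hK hφM (s := 1) (by omega) hx ht
    rw [timeSlice_one] at this
    linarith
  · have := norm_le_of_eLpNorm_top_le hΩ.isOpen hT hψc hψM hx ht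
    rw [Real.norm_eq_abs] at this
    linarith
  · have := norm_le_of_eLpNorm_top_le hΩ.isOpen hT hψ₁c hDψM hx ht
    linarith

end EigenvalueBounds

end ParabolicMA

open ParabolicMA

theorem theorem2p3 (n : ℕ) (hn : 1 ≤ n) (Ω : Set (EuclideanSpace ℝ (Fin n)))
    (hΩ : IsUniformlyConvexDomain Ω) (T : ℝ) (hT : 0 < T) (c₀ : ℝ) (hc₀ : 0 < c₀)
    (θ : ℝ) (hθ : 0 < θ) (Mφ Mψ MDψ Mψt : ℝ≥0) :
    ∃ C : ℝ, 0 < C ∧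
      ∀ φ ψ u : EuclideanSpace ℝ (Fin n) → ℝ → ℝ,
        SmoothOnClosedCylinder Ω T φ →
        SmoothOnClosedCylinder Ω T ψ →
        (∀ x ∈ frontier Ω, ∀ t ∈ Icc 0 T, c₀ ≤ timeDeriv T φ x t + ψ x t) →
        InitiallyUniformlyConvex Ω θ φ →
        (∀ t ∈ Icc 0 T, ConcaveOn ℝ (closure Ω) (fun x => ψ x t)) →
        parabolicNorm 4 Ω T φ ≤ Mφ →
        eLpNorm (fun p : EuclideanSpace ℝ (Fin n) × ℝ => ψ p.1 p.2) ⊤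
          (volume.restrict (parabolicCylinder Ω T)) ≤ Mψ →
        eLpNorm (fun p : EuclideanSpace ℝ (Fin n) × ℝ => spaceDeriv Ω ψ p.1 p.2) ⊤
          (volume.restrict (parabolicCylinder Ω T)) ≤ MDψ →
        eLpNorm (fun p : EuclideanSpace ℝ (Fin n) × ℝ => timeDeriv T ψ p.1 p.2)
          ((n + 1 : ℕ) : ℝ≥0∞) (volume.restrict (parabolicCylinder Ω T)) ≤ Mψt →
        MemParabolicC 4 Ω T u →
        (∀ t ∈ Icc 0 T, ConvexOn ℝ (closure Ω) (fun x => u x t)) →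
        IsSolution Ω T φ ψ u →
        ∀ p ∈ parabolicBoundary Ω T,
          ∃ hH : (hessian Ω u p.1 p.2).IsHermitian,
            ∀ i : Fin n, 1 / C ≤ hH.eigenvalues i ∧ hH.eigenvalues i ≤ C := by
  obtain ⟨ρ, ρ₁, ρ₂, ρ₃, ρ₄, N, Cρ, D, κ, p₀, hρ⟩ := hΩ.exists_definingFunction
  obtain ⟨M, hM, hdata⟩ := exists_solutionData hΩ hT hc₀ hθ Mφ Mψ MDψ
  obtain ⟨l, L, hl, hL, hlat⟩ := hρ.exists_lateral_bounds hn hc₀ hθ hM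
  -- `L`, `1 / l` serve at positive times and `M`, `1 / θ` at the initial time
  refine ⟨L + M + 1 / l + 1 / θ, by positivity, ?_⟩
  intro φ ψ u hφ hψ hcomp hini hconc hφM hψM hDψM _ hu hconv hsol
  have h := hdata φ ψ u hφ hψ hcomp hini hconc hφM hψM hDψM hu hconv hsol
  have hl' : 0 < 1 / l := by positivity
  have hθ' : 0 < 1 / θ := by positivity
  have hinit : ∀ x ∈ closure Ω,
      ∃ hH : (formMatrix (sd2 (closure Ω) (fun y => u y 0) x)).IsHermitian,
        ∀ i : Fin n, 1 / (L + M + 1 / l + 1 / θ) ≤ hH.eigenvalues i ∧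
          hH.eigenvalues i ≤ L + M + 1 / l + 1 / θ := fun x hx => by
    refine ⟨h.u_isHermitian ⟨le_rfl, hT.le⟩ hx, fun i => ?_⟩
    have h1 := h.initial_bounds hx (h.u_isHermitian ⟨le_rfl, hT.le⟩ hx) i
    refine ⟨le_trans ?_ h1.1, by linarith [h1.2]⟩
    rw [one_div_le (by positivity) hθ]
    linarith
  rintro ⟨x, t⟩ hp
  have hxc : x ∈ closure Ω := hp.elim (fun h => h.1) fun h => frontier_subset_closure h.1
  simp only [hessian_eq_formMatrix h.uniqueDiff hxc]
  rcases hp with ⟨hx, ht⟩ | ⟨hx, ht⟩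
  · have ht0 : t = 0 := ht
    subst ht0
    exact hinit x hx
  · rcases eq_or_lt_of_le ht.1 with h0 | h0
    · have ht0 : t = 0 := h0.symm
      subst ht0
      exact hinit x hxc
    · have hH := h.u_isHermitian ht hxc
      refine ⟨hH, fun i => ?_⟩
      have h1 := hlat h x hx t ⟨h0, ht.2⟩ hH i
      refine ⟨le_trans ?_ h1.1, by linarith [h1.2]⟩
      rw [one_div_le (by positivity) hl]
      linarith
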